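/- Let $(R,\mathfrak m)$ be a Noetherian local ring and $I\subsetneq R$ a proper ideal. For $n\ge 0$ let $I^{(n)}=\bigcap_{\mathfrak p\in\operatorname{Min}(I)}(I^nR_{\mathfrak p}\cap R)$ be the $n$-th symbolic power of $I$, where $\operatorname{Min}(I)$ is the set of minimal primes of $I$ and $I^nR_{\mathfrak p}\cap R$ is the preimage of $I^nR_{\mathfrak p}$ in $R$, and let $\mathcal R^s(I)=\bigoplus_{n\ge 0}I^{(n)}t^n\subseteq R[t]$ be the symbolic Rees algebra of $I$. Assume that 1. $R$ is formally equidimensional, i.e. $\dim \widehat R/P=\dim\widehat R$ for every minimal prime $P$ of the $\mathfrak m$-adic completion $\widehat R$; 2. $\operatorname{depth} R\ge \dim R/I+1$; 3. the ring $\mathcal R^s(I)$ is Noetherian; 4. $R/I^{(n)}$ is Cohen–Macaulay for all sufficiently large $n$. Then $I$ is a set-theoretic complete intersection, i.e. $\operatorname{ara}(I)=\operatorname{height} I$, where $\operatorname{ara}(I)$ is the least integer $u\ge 0$ for which there are $g_1,\dots,g_u\in R$ with $\sqrt{(g_1,\dots,g_u)}=\sqrt I$. -/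

import Mathlib

open Filter

/-- The `n`-th symbolic power `I^(n) = ⋂_{p ∈ Min(I)} (I^n R_p ∩ R)`. -/
noncomputable def symbolicPower {R : Type*} [CommRing R] (I : Ideal R) (n : ℕ) : Ideal R :=
  ⨅ p : {p : PrimeSpectrum R // p.asIdeal ∈ I.minimalPrimes},
    ((I ^ n).map (algebraMap R (Localization.AtPrime p.1.asIdeal))).comap
      (algebraMap R (Localization.AtPrime p.1.asIdeal))

theorem symbolicPower_zero {R : Type*} [CommRing R] (I : Ideal R) : symbolicPower I 0 = ⊤ := by
  simp [symbolicPower, Ideal.one_eq_top, Ideal.map_top, Ideal.comap_top]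

theorem mul_mem_symbolicPower {R : Type*} [CommRing R] (I : Ideal R) {m n : ℕ} {x y : R}
    (hx : x ∈ symbolicPower I m) (hy : y ∈ symbolicPower I n) :
    x * y ∈ symbolicPower I (m + n) := by
  simp only [symbolicPower, Ideal.mem_iInf, Ideal.mem_comap] at hx hy ⊢
  intro p
  rw [map_mul, pow_add, Ideal.map_mul]
  exact Ideal.mul_mem_mul (hx p) (hy p)

/-- The symbolic Rees algebra `⊕_n I^(n) t^n`, as the subalgebra of `R[t]` of the polynomials
whose coefficient of `t^n` lies in `I^(n)` for every `n`. -/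
noncomputable def symbolicReesAlgebra {R : Type*} [CommRing R] (I : Ideal R) :
    Subalgebra R (Polynomial R) where
  carrier := {f | ∀ n, f.coeff n ∈ symbolicPower I n}
  mul_mem' {f g} hf hg n := by
    rw [Polynomial.coeff_mul]
    refine Ideal.sum_mem _ fun c hc => ?_
    rw [← Finset.HasAntidiagonal.mem_antidiagonal.mp hc]
    exact mul_mem_symbolicPower I (hf c.1) (hg c.2)
  add_mem' {f g} hf hg n := by
    rw [Polynomial.coeff_add]
    exact Ideal.add_mem _ (hf n) (hg n)
  algebraMap_mem' r n := by
    rw [Polynomial.algebraMap_apply, Polynomial.coeff_C]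
    split_ifs with h
    · subst h
      rw [symbolicPower_zero]
      exact Submodule.mem_top
    · exact Ideal.zero_mem _

/-- The depth of a module over a local ring: the supremum of the lengths of the `M`-regular
sequences contained in the maximal ideal (used for nonzero finitely generated modules). -/
noncomputable def localDepth (R : Type*) [CommRing R] [IsLocalRing R]
    (M : Type*) [AddCommGroup M] [Module R M] : ℕ∞ :=
  ⨆ (rs : List R) (_ : (∀ r ∈ rs, r ∈ IsLocalRing.maximalIdeal R) ∧
    RingTheory.Sequence.IsRegular M rs), (rs.length : ℕ∞)

/-- A finitely generated module `M` over a Noetherian local ring is Cohen-Macaulay if it is zero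
or its depth equals its (Krull) dimension. -/
def IsCohenMacaulayModule (R : Type*) [CommRing R] [IsLocalRing R]
    (M : Type*) [AddCommGroup M] [Module R M] : Prop :=
  Subsingleton M ∨ (localDepth R M : WithBot ℕ∞) = Module.supportDim R M

/-- A Noetherian local ring `R` with completion `S` is formally equidimensional if
`dim S/P = dim S` for every minimal prime `P` of `S`. -/
def IsFormallyEquidimensional (R : Type*) [CommRing R] [IsLocalRing R] : Prop :=
  ∀ P ∈ minimalPrimes (AdicCompletion (IsLocalRing.maximalIdeal R) R),
    ringKrullDim (AdicCompletion (IsLocalRing.maximalIdeal R) R ⧸ P) =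
      ringKrullDim (AdicCompletion (IsLocalRing.maximalIdeal R) R)

/-- The arithmetic rank: the least `u` such that some `g_1, …, g_u ∈ R` generate an ideal with
the same radical as `I`. -/
noncomputable def arithmeticRank {R : Type*} [CommRing R] (I : Ideal R) : ℕ∞ :=
  ⨅ (u : ℕ) (_ : ∃ g : Fin u → R, (Ideal.span (Set.range g)).radical = I.radical), (u : ℕ∞)

/-- `I` is a set-theoretic complete intersection if its arithmetic rank equals its height. -/
def IsSetTheoreticCompleteIntersection {R : Type*} [CommRing R] (I : Ideal R) : Prop :=
  arithmeticRank I = I.height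

/-! Since the symbolic Rees algebra is Noetherian, some `k` satisfies I^(kn) = (I^(k))^n for all n,
and `k` can be taken as large as desired (`exists_symbolicPower_mul_eq_pow`). Put J = I^(k). It has
the same radical as I, and every R/J^n with n ≥ 1 is Cohen–Macaulay. Write r = dim R/I and dim R = r
+ e. It then suffices to show that e elements generate an ideal with the radical of J, and that e ≤
height I; the inequality height I ≤ ara I is Krull's height theorem.

Upper bound (`exists_radical_ofList_eq_of_isCohenMacaulayModule`, an analytic spread bound in the
style of Burch and Cowsik–Nori). Choose parameters y_1, …, y_r of R/J that also cut dim R down to at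
most e, and let c = (y). They form a regular sequence on every R/J^n, so c ∩ J^n = cJ^n, and hence
the graded piece J^n/mJ^n of the fiber cone is a quotient of the corresponding piece of gr_J(R/c).
The length of R/(J^N + c) grows at most like N^e. Algebraically independent elements of the fiber
cone would produce too many monomials, so chains of primes in it have length at most e
(`chain_length_le`). Homogeneous prime avoidance gives e forms of positive degree generating its
irrelevant ideal up to radical, and Nakayama's lemma transports this to J
(`exists_radical_ofList_eq`).

Lower bound (`IsFormallyEquidimensional.ringKrullDim_le_height_add`). The inequality dim R ≤ ht p +
dim R/p at each minimal prime p of I gives e ≤ ht p. It descends by flatness from the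
equidimensional completion, once the completion is known to be catenary. For that, a complete local
ring with finitely generated maximal ideal is a quotient of a power series ring over a coefficient
ring having a regular system of parameters (Cohen's theorem, `exists_coefficientRing`), and such a
ring is Cohen–Macaulay. In residue characteristic zero the coefficient ring is a field, found by
formal smoothness over ℚ; in residue characteristic p it is an intersection of subrings generated by
p^n-th powers and lifts of a p-basis. -/

section

open IsLocalRing RingTheory.Sequence Pointwise

universe u

/-! ### Krull dimension of quotients and parameters. -/

section KrullDimension

variable {R : Type*} [CommRing R]

theorem ringKrullDim_quotient_le_iff (a : Ideal R) (n : ℕ) :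
    ringKrullDim (R ⧸ a) ≤ n ↔
      ∀ l : LTSeries (PrimeSpectrum R), a ≤ l.head.asIdeal → l.length ≤ n := by
  rw [ringKrullDim_quotient, Order.krullDim, iSup_le_iff]
  constructor
  · intro h l hl
    have hmem : ∀ i, l i ∈ PrimeSpectrum.zeroLocus (a : Set R) := fun i =>
      hl.trans (l.head_le i)
    let l' : LTSeries (PrimeSpectrum.zeroLocus (R := R) a) :=
      ⟨l.length, fun i => ⟨l i, hmem i⟩, fun i => l.step i⟩
    exact_mod_cast h l'
  · intro h l
    exact_mod_cast h (l.map Subtype.val (fun _ _ h => h)) l.head.2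

theorem ringKrullDim_quotient_mono {a b : Ideal R} (h : a ≤ b) :
    ringKrullDim (R ⧸ b) ≤ ringKrullDim (R ⧸ a) :=
  ringKrullDim_le_of_surjective (Ideal.Quotient.factor h) (Ideal.Quotient.factor_surjective h)

theorem ringKrullDim_quotient_succ_le_of_lt {p q : Ideal R} [p.IsPrime] (h : p < q) :
    ringKrullDim (R ⧸ q) + 1 ≤ ringKrullDim (R ⧸ p) := by
  obtain ⟨x, hxq, hxp⟩ := SetLike.exists_of_lt h
  exact ringKrullDim_succ_le_of_surjective (Ideal.Quotient.factor h.le)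
    (Ideal.Quotient.factor_surjective h.le) (r := Ideal.Quotient.mk p x)
    (mem_nonZeroDivisors_of_ne_zero (by rwa [Ne, Ideal.Quotient.eq_zero_iff_mem]))
    (by simpa [Ideal.Quotient.eq_zero_iff_mem] using hxq)

theorem ringKrullDim_quotient_eq_of_radical_eq {a b : Ideal R} (h : a.radical = b.radical) :
    ringKrullDim (R ⧸ a) = ringKrullDim (R ⧸ b) := by
  rw [ringKrullDim_quotient, ringKrullDim_quotient, ← PrimeSpectrum.zeroLocus_radical a, h,
    PrimeSpectrum.zeroLocus_radical]

theorem ringKrullDim_quotient_ne_bot {a : Ideal R} (h : a ≠ ⊤) : ringKrullDim (R ⧸ a) ≠ ⊥ := by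
  have : Nontrivial (R ⧸ a) := Ideal.Quotient.nontrivial_iff.mpr h
  exact (bot_lt_iff_ne_bot.mp (lt_of_lt_of_le (WithBot.bot_lt_coe 0)
    (ringKrullDim_nonneg_of_nontrivial (R := R ⧸ a))))

theorem exists_ringKrullDim_quotient_eq [IsNoetherianRing R] [IsLocalRing R] {a : Ideal R}
    (h : a ≠ ⊤) : ∃ n : ℕ, ringKrullDim (R ⧸ a) = n := by
  have : Nontrivial (R ⧸ a) := Ideal.Quotient.nontrivial_iff.mpr h
  have : IsLocalRing (R ⧸ a) := .of_surjective' _ Ideal.Quotient.mk_surjective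
  have h1 := ringKrullDim_ne_top (R := R ⧸ a)
  have h2 := ringKrullDim_quotient_ne_bot h
  obtain ⟨m, hm⟩ := WithBot.ne_bot_iff_exists.mp h2
  have hm' : m ≠ ⊤ := by rintro rfl; exact h1 hm.symm
  obtain ⟨n, rfl⟩ := ENat.ne_top_iff_exists.mp hm'
  exact ⟨n, hm.symm⟩

/-- An element of `J` cutting down the dimension of `R ⧸ a` and of `R ⧸ b` at once. -/
theorem exists_mem_ringKrullDim_quotient_sup_span_le [IsNoetherianRing R] [IsLocalRing R]
    (a b J : Ideal R)
    (ha : ∀ p : Ideal R, p.IsPrime → a ≤ p → J ≤ p → p = maximalIdeal R)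
    (hb : ∀ p : Ideal R, p.IsPrime → b ≤ p → J ≤ p → p = maximalIdeal R) :
    ∃ y ∈ J, (∀ n : ℕ, ringKrullDim (R ⧸ a) ≤ (n + 1 : ℕ) →
        ringKrullDim (R ⧸ (a ⊔ Ideal.span {y})) ≤ n) ∧
      ∀ n : ℕ, ringKrullDim (R ⧸ b) ≤ (n + 1 : ℕ) →
        ringKrullDim (R ⧸ (b ⊔ Ideal.span {y})) ≤ n := by
  -- The prime `maximalIdeal R` is discarded: it cannot be avoided, and a chain starting at it has
  -- length zero. In every other case the chain can be extended downwards by a minimal prime that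
  -- misses `y`.
  have hfin : ((a.minimalPrimes ∪ b.minimalPrimes) \ {maximalIdeal R}).Finite :=
    ((Ideal.finite_minimalPrimes_of_isNoetherianRing R a).union
      (Ideal.finite_minimalPrimes_of_isNoetherianRing R b)).sdiff
  have key : ¬ ((J : Set R) ⊆ ⋃ p ∈ (a.minimalPrimes ∪ b.minimalPrimes) \ {maximalIdeal R},
      (p : Set R)) := by
    intro hsub
    obtain ⟨p, hp, hle⟩ := (Ideal.subset_union_prime_finite hfin (f := id) ⊤ ⊤
      (fun p hp _ _ => by rcases hp.1 with h | h <;> exact h.1.1)).mp (by simpa using hsub)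
    rcases hp.1 with h | h
    · exact hp.2 (ha p h.1.1 h.1.2 hle)
    · exact hp.2 (hb p h.1.1 h.1.2 hle)
  obtain ⟨y, hyJ, hy⟩ := Set.not_subset.mp key
  simp only [Set.mem_iUnion, not_exists] at hy
  have main : ∀ c : Ideal R, c.minimalPrimes ⊆ a.minimalPrimes ∪ b.minimalPrimes →
      ∀ n : ℕ, ringKrullDim (R ⧸ c) ≤ (n + 1 : ℕ) →
        ringKrullDim (R ⧸ (c ⊔ Ideal.span {y})) ≤ n := by
    intro c hc n hn
    rw [ringKrullDim_quotient_le_iff] at hn ⊢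
    intro l hl
    obtain ⟨p, hp, hpl⟩ := Ideal.exists_minimalPrimes_le (le_sup_left.trans hl)
    by_cases hpm : p = maximalIdeal R
    · by_contra! hlen
      have hpos : 0 < l.length := lt_of_le_of_lt (Nat.zero_le _) hlen
      have h1 : l.head < l.last := l.strictMono (Fin.pos_iff_ne_zero.mpr (by
        intro h; have := congrArg Fin.val h; simp at this; omega))
      have h2 : l.last.asIdeal ≤ p := hpm ▸ le_maximalIdeal l.last.2.ne_top
      exact absurd (h2.trans hpl) (not_le_of_gt h1)
    · have hyl : y ∈ l.head.asIdeal := hl (Ideal.mem_sup_right (Ideal.mem_span_singleton_self y))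
      have hyp : y ∉ p := hy p ⟨hc hp, hpm⟩
      have hlt : (⟨p, hp.1.1⟩ : PrimeSpectrum R) < l.head :=
        lt_of_le_of_ne hpl (fun h => hyp (by rw [← h] at hyl; exact hyl))
      have := hn (l.cons ⟨p, hp.1.1⟩ hlt) (by simpa using hp.1.2)
      simpa using this
  exact ⟨y, hyJ, main a Set.subset_union_left, main b Set.subset_union_right⟩

end KrullDimension

/-! ### Depth, regular sequences and associated primes. -/

section Depth

theorem exists_mem_associatedPrimes_of_not_isSMulRegular {R M : Type*} [CommRing R]
    [IsNoetherianRing R] [AddCommGroup M] [Module R M] {x : R} (h : ¬ IsSMulRegular M x) :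
    ∃ p ∈ associatedPrimes R M, x ∈ p := by
  by_contra! hc
  apply h
  have : x ∉ ⋃ p ∈ associatedPrimes R M, (p : Set R) := by simpa using hc
  rw [biUnion_associatedPrimes_eq_compl_regular R M] at this
  simpa using this

variable {R : Type u} [CommRing R] [IsNoetherianRing R] [IsLocalRing R]
  {M : Type u} [AddCommGroup M] [Module R M] [Module.Finite R M]

open CategoryTheory Abelian Limits in
-- Depth drops by at most one modulo any regular element, whether or not it belongs to `rs`. By
-- Rees's criterion, regular sequences are detected by the vanishing of low Ext groups, and
-- vanishing in degrees i and i + 1 for M forces it in degree i for M/xM.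
theorem exists_isRegular_quotSMulTop [Nontrivial M] {x : R} (hx : x ∈ maximalIdeal R)
    (hreg : IsSMulRegular M x) {rs : List R} (hrs : ∀ r ∈ rs, r ∈ maximalIdeal R)
    (h : IsRegular M rs) {n : ℕ} (hn : rs.length = n + 1) :
    ∃ ss : List R, ss.length = n ∧ (∀ r ∈ ss, r ∈ maximalIdeal R) ∧
      IsRegular (QuotSMulTop x M) ss := by
  have lt_top : ∀ (N : Type u) [AddCommGroup N] [Module R N] [Module.Finite R N] [Nontrivial N],
      maximalIdeal R • (⊤ : Submodule R N) < ⊤ := fun N _ _ _ _ =>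
    (Submodule.top_ne_ideal_smul_of_le_jacobson_annihilator
      ((maximalIdeal_le_jacobson _))).symm.lt_top
  have hnt : Nontrivial (QuotSMulTop x M) := nontrivial_quotSMulTop_of_mem_maximalIdeal M hx
  have t1 := ModuleCat.exists_isRegular_tfae (maximalIdeal R) (n + 1) (ModuleCat.of R M)
    (lt_top M)
  have t2 := ModuleCat.exists_isRegular_tfae (maximalIdeal R) n
    (ModuleCat.of R (QuotSMulTop x M)) (lt_top _)
  have h2 := (t1.out 3 1 rfl rfl).mp ⟨rs, hn, hrs, h⟩
  refine (t2.out 1 3 rfl rfl).mp ?_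
  intro i hi
  have zero1 := AddCommGrpCat.isZero_of_iff_subsingleton.mpr (h2 i (by omega))
  have zero2 := AddCommGrpCat.isZero_of_iff_subsingleton.mpr (h2 (i + 1) (by omega))
  exact AddCommGrpCat.subsingleton_of_isZero <| ShortComplex.Exact.isZero_of_both_zeros
    ((Ext.covariant_sequence_exact₃' _
      (IsSMulRegular.smulShortComplex_shortExact (M := ModuleCat.of R M) hreg)) i (i + 1) rfl)
    (zero1.eq_zero_of_src _) (zero2.eq_zero_of_tgt _)

/-- The length of a regular sequence is at most the dimension of each associated prime. -/
theorem length_le_ringKrullDim_quotient_of_mem_associatedPrimes {rs : List R}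
    (hrs : ∀ r ∈ rs, r ∈ maximalIdeal R) (h : IsRegular M rs) {p : Ideal R}
    (hp : p ∈ associatedPrimes R M) : (rs.length : WithBot ℕ∞) ≤ ringKrullDim (R ⧸ p) := by
  induction rs generalizing M p with
  | nil =>
    have : p.IsPrime := hp.1
    simpa using ringKrullDim_nonneg_of_nontrivial (R := R ⧸ p)
  | cons x rs ih =>
    have hpp : p.IsPrime := hp.1
    obtain ⟨hx, hreg⟩ := (isRegular_cons_iff M x rs).mp h
    have hxm : x ∈ maximalIdeal R := hrs x (by simp)
    obtain ⟨z, hz⟩ := (isAssociatedPrime_iff.mp hp).2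
    have hz0 : z ≠ 0 := by
      rintro rfl
      exact hpp.ne_top (by rw [hz]; simp)
    have hxp : x ∉ p := fun hxp => by
      have : x • z = 0 := by
        rw [hz] at hxp
        simpa [Submodule.mem_colon_singleton] using hxp
      exact hz0 (hx (by simpa using this))
    -- If every element killed by p were in xM, the submodule N of these elements would satisfy N =
    -- xN because x is regular, so N = 0 by Nakayama; but z ∈ N. An associated prime of M/xM
    -- containing the annihilator of the class of w contains p and x, so it is strictly larger than
    -- p.
    have hex : ∃ w : M, (∀ a ∈ p, a • w = 0) ∧ w ∉ x • (⊤ : Submodule R M) := by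
      by_contra! hc
      let N : Submodule R M := Submodule.torsionBySet R M p
      have hmem : ∀ w, w ∈ N ↔ ∀ a ∈ p, a • w = 0 := fun w => by
        simp [N, Submodule.mem_torsionBySet_iff]
      have hN : N = ⊥ := by
        refine Submodule.eq_bot_of_le_smul_of_le_jacobson_bot (maximalIdeal R) N
          (IsNoetherian.noetherian N) ?_ (maximalIdeal_le_jacobson _)
        intro w hw
        obtain ⟨w', -, rfl⟩ := Submodule.mem_smul_pointwise_iff_exists _ _ _ |>.mp
          (hc w ((hmem w).mp hw))
        refine Submodule.smul_mem_smul hxm ((hmem w').mpr fun a ha => hx ?_)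
        simpa [smul_comm x a] using (hmem _).mp hw a ha
      exact hz0 (by
        rw [← Submodule.mem_bot R, ← hN, hmem]
        intro a ha
        rw [hz] at ha
        simpa [Submodule.mem_colon_singleton] using ha)
    obtain ⟨w, hw, hwx⟩ := hex
    have hw0 : (Submodule.Quotient.mk w : QuotSMulTop x M) ≠ 0 := by
      rwa [Ne, Submodule.Quotient.mk_eq_zero]
    obtain ⟨p', hp', hle⟩ := exists_le_isAssociatedPrime_of_isNoetherianRing R _ hw0
    have hpp' : p < p' := by
      refine lt_of_le_of_ne (fun a ha => hle ?_) ?_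
      · rw [Submodule.mem_colon_singleton, ← Submodule.Quotient.mk_smul, hw a ha]
        simp
      · rintro rfl
        refine hxp (hle ?_)
        rw [Submodule.mem_colon_singleton, ← Submodule.Quotient.mk_smul, Submodule.mem_bot,
          Submodule.Quotient.mk_eq_zero]
        exact Submodule.smul_mem_pointwise_smul _ _ _ trivial
    have h1 := ih (fun r hr => hrs r (by simp [hr])) hreg hp'
    calc ((x :: rs).length : WithBot ℕ∞) = rs.length + 1 := by simp
      _ ≤ ringKrullDim (R ⧸ p') + 1 := by gcongr
      _ ≤ _ := ringKrullDim_quotient_succ_le_of_lt hpp'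

theorem ringKrullDim_quotient_le_sup_span_singleton_add_one (a : Ideal R) {y : R}
    (hy : y ∈ maximalIdeal R) :
    ringKrullDim (R ⧸ a) ≤ ringKrullDim (R ⧸ (a ⊔ Ideal.span {y})) + 1 := by
  have h1 := Module.supportDim_le_supportDim_quotSMulTop_succ (M := R ⧸ a) hy
  rw [Module.supportDim_quotient_eq_ringKrullDim] at h1
  have h2 : Module.support R (QuotSMulTop y (R ⧸ a)) =
      PrimeSpectrum.zeroLocus ((a ⊔ Ideal.span {y} : Ideal R) : Set R) := by
    rw [Module.support_quotSMulTop, Module.support_eq_zeroLocus, Ideal.annihilator_quotient,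
      PrimeSpectrum.zeroLocus_sup, PrimeSpectrum.zeroLocus_span]
  rwa [Module.supportDim, h2, ← ringKrullDim_quotient] at h1

/-- Each element lowers the dimension by at most one, and after all of them at most the maximal
ideal is left. -/
theorem ringKrullDim_quotient_le_length (a : Ideal R) (ys : List R)
    (hys : ∀ y ∈ ys, y ∈ maximalIdeal R)
    (h : ∀ q : Ideal R, q.IsPrime → a ≤ q → (∀ y ∈ ys, y ∈ q) → q = maximalIdeal R) :
    ringKrullDim (R ⧸ a) ≤ ys.length := by
  induction ys generalizing a with
  | nil =>
    refine (ringKrullDim_quotient_le_iff a 0).mpr fun l hl => ?_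
    by_contra! hpos
    have h1 : l.head < l.last := l.strictMono (Fin.pos_iff_ne_zero.mpr (by
        intro h; have := congrArg Fin.val h; simp at this; omega))
    have h2 : l.last.asIdeal ≤ l.head.asIdeal := by
      rw [h l.head.asIdeal l.head.2 hl (by simp)]
      exact le_maximalIdeal l.last.2.ne_top
    exact absurd h2 (not_le_of_gt h1)
  | cons y ys ih =>
    have h1 := ih (a ⊔ Ideal.span {y}) (fun z hz => hys z (by simp [hz])) (fun q hq hle hmem =>
      h q hq (le_sup_left.trans hle) (by
        intro z hz
        rcases List.mem_cons.mp hz with rfl | hz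
        · exact hle (Ideal.mem_sup_right (Ideal.mem_span_singleton_self _))
        · exact hmem z hz))
    calc _ ≤ _ := ringKrullDim_quotient_le_sup_span_singleton_add_one a (hys y (by simp))
      _ ≤ (ys.length : WithBot ℕ∞) + 1 := by gcongr
      _ = _ := by simp

/-- On a Cohen-Macaulay module every system of parameters is a regular sequence. -/
theorem isWeaklyRegular_of_length_eq {rs ys : List R} [Nontrivial M]
    (hrs : ∀ r ∈ rs, r ∈ maximalIdeal R)
    (h : IsRegular M rs) (hys : ∀ y ∈ ys, y ∈ maximalIdeal R) (hlen : rs.length = ys.length)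
    (hmax : ∀ q : Ideal R, q.IsPrime → Module.annihilator R M ≤ q → (∀ y ∈ ys, y ∈ q) →
      q = maximalIdeal R) : IsWeaklyRegular M ys := by
  induction ys generalizing M rs with
  | nil => exact .nil R M
  | cons y ys ih =>
    -- Otherwise y lies in an associated prime p. The remaining parameters cut R/p down to the
    -- closed point, so dim R/p < `rs.length`, against the depth bound for associated primes.
    have hreg : IsSMulRegular M y := by
      by_contra hn
      obtain ⟨p, hp, hyp⟩ := exists_mem_associatedPrimes_of_not_isSMulRegular hn
      have h1 := length_le_ringKrullDim_quotient_of_mem_associatedPrimes hrs h hp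
      have h2 := ringKrullDim_quotient_le_length p ys (fun z hz => hys z (by simp [hz]))
        (fun q hq hle hmem => hmax q hq ((Submodule.annihilator_top (R := R) (M := M)).ge.trans
          (hp.annihilator_le.trans hle)) (by
          intro z hz
          rcases List.mem_cons.mp hz with rfl | hz
          · exact hle hyp
          · exact hmem z hz))
      have h3 : (rs.length : WithBot ℕ∞) ≤ ys.length := h1.trans h2
      have h4 : rs.length ≤ ys.length := by exact_mod_cast h3
      simp at hlen
      omega
    obtain ⟨ss, hss, hssm, hssr⟩ := exists_isRegular_quotSMulTop (hys y (by simp)) hreg hrs h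
      (n := ys.length) (by simpa using hlen)
    have := nontrivial_quotSMulTop_of_mem_maximalIdeal M (hys y (by simp))
    refine (isWeaklyRegular_cons_iff M y ys).mpr ⟨hreg, ih hssm hssr
      (fun z hz => hys z (by simp [hz])) hss ?_⟩
    intro q hq hle hmem
    have h1 : q ∈ {q | q.IsPrime} := hq
    have h2 : (⟨q, hq⟩ : PrimeSpectrum R) ∈ Module.support R (QuotSMulTop y M) :=
      Module.mem_support_iff_of_finite.mpr hle
    rw [Module.support_quotSMulTop] at h2
    refine hmax q hq (Module.mem_support_iff_of_finite.mp h2.1) ?_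
    intro z hz
    rcases List.mem_cons.mp hz with rfl | hz
    · simpa using h2.2
    · exact hmem z hz

/-- Every prime contains a regular sequence whose length is at least the depth minus the
codimension. -/
theorem exists_isRegular_mem_of_isPrime (q : Ideal R) [hq : q.IsPrime] {rs : List R}
    [Nontrivial M] (hsupp : Module.annihilator R M ≤ q)
    (hrs : ∀ r ∈ rs, r ∈ maximalIdeal R) (h : IsRegular M rs) :
    ∃ ss : List R, (∀ r ∈ ss, r ∈ q) ∧ IsRegular M ss ∧
      (rs.length : WithBot ℕ∞) ≤ ss.length + ringKrullDim (R ⧸ q) := by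
  generalize hn : rs.length = n
  induction n generalizing M rs with
  | zero => exact ⟨[], by simp, .nil R M, by
      simpa using ringKrullDim_nonneg_of_nontrivial (R := R ⧸ q)⟩
  | succ n ih =>
    by_cases hex : ∃ x ∈ q, IsSMulRegular M x
    · obtain ⟨x, hxq, hx⟩ := hex
      have hxm := le_maximalIdeal hq.ne_top hxq
      obtain ⟨ss, hss, hssm, hssr⟩ := exists_isRegular_quotSMulTop hxm hx hrs h hn
      have := nontrivial_quotSMulTop_of_mem_maximalIdeal M hxm
      have hsup : Module.annihilator R (QuotSMulTop x M) ≤ q := by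
        have h2 : (⟨q, hq⟩ : PrimeSpectrum R) ∈ Module.support R (QuotSMulTop x M) := by
          rw [Module.support_quotSMulTop]
          exact ⟨Module.mem_support_iff_of_finite.mpr hsupp, by simpa using hxq⟩
        exact Module.mem_support_iff_of_finite.mp h2
      obtain ⟨us, hus, husr, hle⟩ := ih hsup hssm hssr hss
      refine ⟨x :: us, by simpa [hxq] using hus, (isRegular_cons_iff M x us).mpr ⟨hx, husr⟩, ?_⟩
      calc ((n + 1 : ℕ) : WithBot ℕ∞) = n + 1 := by simp
        _ ≤ (us.length + ringKrullDim (R ⧸ q)) + 1 := by gcongr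
        _ = _ := by simp [add_right_comm]
    -- If q has no regular element, it lies in an associated prime p, and depth ≤ dim R/p ≤ dim R/q:
    -- the empty sequence is long enough.
    · have hsub : (q : Set R) ⊆ ⋃ p ∈ associatedPrimes R M, (p : Set R) := by
        intro x hx
        obtain ⟨p, hp, hxp⟩ := exists_mem_associatedPrimes_of_not_isSMulRegular
          (fun hr => hex ⟨x, hx, hr⟩ : ¬ IsSMulRegular M x)
        simp only [Set.mem_iUnion]
        exact ⟨p, hp, hxp⟩
      obtain ⟨p, hp, hle⟩ := (Ideal.subset_union_prime_finite (associatedPrimes.finite R M)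
        (f := id) ⊤ ⊤ (fun p hp _ _ => hp.1)).mp (by simpa using hsub)
      refine ⟨[], by simp, .nil R M, ?_⟩
      have h1 := length_le_ringKrullDim_quotient_of_mem_associatedPrimes hrs h hp
      rw [hn] at h1
      simpa using h1.trans (ringKrullDim_quotient_mono hle)

end Depth

end

section

/-! ### Veronese subalgebras of finitely generated filtrations. -/

section Veronese

variable {R : Type*} [CommRing R]

theorem mem_iSup_span_mul (F : ℕ → Ideal R) {B : Finset (ℕ × R)} {n j : ℕ} {b a : R}
    (hx : (j, b) ∈ B) (hn : j ≤ n) (ha : a ∈ Ideal.span {b} * F (n - j)) :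
    a ∈ ⨆ x ∈ B, ⨆ _ : x.1 ≤ n, Ideal.span {x.2} * F (n - x.1) :=
  Submodule.mem_iSup_of_mem (j, b) (Submodule.mem_iSup_of_mem hx (Submodule.mem_iSup_of_mem hn ha))

/-- Recursive description of a filtration by a finite set of homogeneous generators. -/
theorem exists_pow_eq_of_finite_generators (F : ℕ → Ideal R) (h0 : F 0 = ⊤)
    (hmul : ∀ m n, F m * F n ≤ F (m + n)) (B : Finset (ℕ × R))
    (hB : ∀ x ∈ B, 1 ≤ x.1 ∧ x.2 ∈ F x.1)
    (hgen : ∀ n, 1 ≤ n → F n ≤ ⨆ x ∈ B, ⨆ _ : x.1 ≤ n, Ideal.span {x.2} * F (n - x.1)) :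
    ∃ k, 1 ≤ k ∧ ∀ n, F (k * n) = F k ^ n := by
  classical
  let Mon : ℕ → Set R := fun n => {a | ∃ s : Multiset (ℕ × R), (∀ x ∈ s, x ∈ B) ∧
    (s.map Prod.fst).sum = n ∧ (s.map Prod.snd).prod = a}
  have hmon : ∀ s : Multiset (ℕ × R), (∀ x ∈ s, x ∈ B) →
      (s.map Prod.snd).prod ∈ F (s.map Prod.fst).sum := by
    intro s
    induction s using Multiset.induction with
    | empty => simp [h0]
    | cons x s ih =>
      intro hs
      simp only [Multiset.map_cons, Multiset.prod_cons, Multiset.sum_cons]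
      exact hmul _ _ (Ideal.mul_mem_mul (hB x (hs x (by simp))).2
        (ih fun y hy => hs y (by simp [hy])))
  have hspan : ∀ n, F n ≤ Ideal.span (Mon n) := by
    intro n
    induction n using Nat.strong_induction_on with
    | _ n ih =>
      rcases Nat.eq_zero_or_pos n with rfl | hn
      · have : (1 : R) ∈ Mon 0 := ⟨0, by simp, by simp, by simp⟩
        rw [(Ideal.eq_top_iff_one _).mpr (Ideal.subset_span this)]
        exact le_top
      · refine (hgen n hn).trans ?_
        refine iSup₂_le fun x hx => iSup_le fun hxn => ?_
        refine (Ideal.mul_mono_right (ih (n - x.1) (by have := (hB x hx).1; omega))).trans ?_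
        rw [Ideal.span_mul_span', Ideal.span_le]
        rintro _ ⟨a, ha, b, ⟨s, hs, hsum, rfl⟩, rfl⟩
        obtain rfl := Set.mem_singleton_iff.mp ha
        refine Ideal.subset_span ⟨x ::ₘ s, ?_, ?_, ?_⟩
        · intro y hy
          rcases Multiset.mem_cons.mp hy with rfl | hy
          · exact hx
          · exact hs y hy
        · simp [hsum]; omega
        · simp
  let L := ∏ x ∈ B, x.1
  have hL : 1 ≤ L := Finset.one_le_prod' fun x hx => (hB x hx).1
  -- L is a common multiple of the degrees. In a monomial of degree n + L > L * |B|, by pigeonhole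
  -- some generator x contributes degree at least L, so a power of x of degree exactly L splits off.
  have hstep : ∀ n, L * B.card ≤ n → F (n + L) ≤ F L * F n := by
    intro n hn
    refine (hspan _).trans (Ideal.span_le.mpr ?_)
    rintro _ ⟨s, hs, hsum, rfl⟩
    have hex : ∃ x ∈ B, L ≤ s.count x * x.1 := by
      by_contra! hc
      have h1 : (s.map Prod.fst).sum = ∑ x ∈ B, s.count x * x.1 := by
        rw [Finset.sum_multiset_map_count]
        refine Finset.sum_subset (fun x hx => hs x (by simpa using hx)) ?_
        intro x _ hx
        simp [Multiset.count_eq_zero.mpr (by simpa using hx)]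
      have h2 : ∑ x ∈ B, s.count x * x.1 ≤ ∑ x ∈ B, L :=
        Finset.sum_le_sum fun x hx => (hc x hx).le
      simp only [Finset.sum_const, smul_eq_mul] at h2
      have := Nat.mul_comm L B.card
      omega
    obtain ⟨x, hx, hLx⟩ := hex
    have hdvd : x.1 ∣ L := Finset.dvd_prod_of_mem _ hx
    obtain ⟨c, hc⟩ := hdvd
    have hcs : c ≤ s.count x := by
      rw [hc, mul_comm] at hLx
      exact Nat.le_of_mul_le_mul_right hLx (hB x hx).1
    obtain ⟨t, rfl⟩ := Multiset.le_iff_exists_add.mp (Multiset.le_count_iff_replicate_le.mp hcs)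
    have h1 := hmon (Multiset.replicate c x) (fun y hy => by
      rw [Multiset.eq_of_mem_replicate hy]; exact hx)
    have h2 := hmon t (fun y hy => hs y (by simp [hy]))
    have e1 : ((Multiset.replicate c x).map Prod.fst).sum = L := by
      simp [hc, mul_comm]
    rw [Multiset.map_add, Multiset.sum_add, e1] at hsum
    rw [e1] at h1
    rw [show (t.map Prod.fst).sum = n by omega] at h2
    rw [Multiset.map_add, Multiset.prod_add]
    exact Ideal.mul_mem_mul h1 h2
  have hiter : ∀ j n, L * B.card ≤ n → F (n + L * j) ≤ F L ^ j * F n := by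
    intro j
    induction j with
    | zero => intro n _; simp
    | succ j ih =>
      intro n hn
      calc F (n + L * (j + 1)) = F ((n + L * j) + L) := by congr 1; ring
        _ ≤ F L * F (n + L * j) := hstep _ (by omega)
        _ ≤ F L * (F L ^ j * F n) := Ideal.mul_mono_right (ih n hn)
        _ = _ := by rw [← mul_assoc, ← pow_succ']
  have hpow : ∀ m n, F m ^ n ≤ F (m * n) := by
    intro m n
    induction n with
    | zero => simp [h0]
    | succ n ih =>
      rw [pow_succ]
      exact (Ideal.mul_mono_left ih).trans (hmul _ _)
  -- The factor |B| + 1 puts the degree K itself above the threshold L * |B|, so every excess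
  -- multiple of L over K can be peeled off.
  refine ⟨L * (B.card + 1), Nat.mul_pos hL (Nat.succ_pos _), fun n => le_antisymm ?_ (hpow _ _)⟩
  cases n with
  | zero => simp
  | succ n =>
    set K := L * (B.card + 1)
    calc F (K * (n + 1)) = F (K + L * ((B.card + 1) * n)) := by congr 1; simp only [K]; ring
      _ ≤ F L ^ ((B.card + 1) * n) * F K := hiter _ _ (Nat.mul_le_mul_left _ (Nat.le_succ _))
      _ = (F L ^ (B.card + 1)) ^ n * F K := by rw [pow_mul]
      _ ≤ F K ^ n * F K := Ideal.mul_mono_left (Ideal.pow_right_mono (hpow _ _) n)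
      _ = _ := (pow_succ _ _).symm

end Veronese

/-! ### Symbolic powers and the symbolic Rees algebra. -/

section SymbolicPower

variable {R : Type*} [CommRing R] (I : Ideal R)

theorem symbolicPower_mul_le (m n : ℕ) :
    symbolicPower I m * symbolicPower I n ≤ symbolicPower I (m + n) :=
  Ideal.mul_le.mpr fun _ hr _ hs => mul_mem_symbolicPower I hr hs

theorem pow_le_symbolicPower (n : ℕ) : I ^ n ≤ symbolicPower I n :=
  le_iInf fun _ => Ideal.le_comap_map

theorem symbolicPower_le_radical {n : ℕ} (hn : 1 ≤ n) : symbolicPower I n ≤ I.radical := by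
  rw [← Ideal.sInf_minimalPrimes]
  refine le_sInf fun p hp => ?_
  have hpp : p.IsPrime := hp.1.1
  refine (iInf_le _ ⟨⟨p, hpp⟩, hp⟩).trans ?_
  have h1 : (I ^ n).map (algebraMap R (Localization.AtPrime p)) ≤
      IsLocalRing.maximalIdeal (Localization.AtPrime p) := by
    rw [← Localization.AtPrime.map_eq_maximalIdeal]
    exact Ideal.map_mono ((Ideal.pow_le_self (by omega)).trans hp.1.2)
  calc _ ≤ (IsLocalRing.maximalIdeal (Localization.AtPrime p)).comap
        (algebraMap R (Localization.AtPrime p)) := Ideal.comap_mono h1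
    _ = p := Localization.AtPrime.under_maximalIdeal

theorem radical_symbolicPower {n : ℕ} (hn : 1 ≤ n) : (symbolicPower I n).radical = I.radical := by
  refine le_antisymm ?_ ?_
  · exact (Ideal.radical_mono (symbolicPower_le_radical I hn)).trans (Ideal.radical_idem I).le
  · rw [← Ideal.radical_pow I (by omega : n ≠ 0)]
    exact Ideal.radical_mono (pow_le_symbolicPower I n)

/-- Only the ideal of elements with zero constant coefficient has to be finitely generated: the
positive-degree coefficients of its generators form B. Comparing coefficients of t^n in an
expression of a t^n through these generators gives the recursion. -/
theorem exists_finite_generators_symbolicPower [IsNoetherianRing (symbolicReesAlgebra I)] :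
    ∃ B : Finset (ℕ × R), (∀ x ∈ B, 1 ≤ x.1 ∧ x.2 ∈ symbolicPower I x.1) ∧
      ∀ n, 1 ≤ n → symbolicPower I n ≤
        ⨆ x ∈ B, ⨆ _ : x.1 ≤ n, Ideal.span {x.2} * symbolicPower I (n - x.1) := by
  classical
  let φ : symbolicReesAlgebra I →+* R :=
    (Polynomial.constantCoeff).comp (symbolicReesAlgebra I).val.toRingHom
  have hφ : ∀ f : symbolicReesAlgebra I, φ f = (f : Polynomial R).coeff 0 := fun f => rfl
  obtain ⟨G, hG⟩ := (RingHom.ker φ).fg_of_isNoetherianRing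
  let B : Finset (ℕ × R) := G.biUnion fun g =>
    ((Finset.range ((g : Polynomial R).natDegree + 1)).filter (1 ≤ ·)).image
      fun j => (j, (g : Polynomial R).coeff j)
  have hBmem : ∀ g ∈ G, ∀ j, 1 ≤ j → (g : Polynomial R).coeff j ≠ 0 →
      (j, (g : Polynomial R).coeff j) ∈ B := by
    intro g hg j hj h
    simp only [B, Finset.mem_biUnion, Finset.mem_image, Finset.mem_filter, Finset.mem_range]
    exact ⟨g, hg, j, ⟨Nat.lt_succ_of_le (Polynomial.le_natDegree_of_ne_zero h), hj⟩, rfl⟩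
  refine ⟨B, ?_, ?_⟩
  · intro x hx
    simp only [B, Finset.mem_biUnion, Finset.mem_image, Finset.mem_filter, Finset.mem_range] at hx
    obtain ⟨g, hg, j, ⟨-, hj⟩, rfl⟩ := hx
    exact ⟨hj, g.2 j⟩
  · intro n hn a ha
    have hmem : Polynomial.monomial n a ∈ symbolicReesAlgebra I := by
      intro m
      rw [Polynomial.coeff_monomial]
      split_ifs with h
      · exact h ▸ ha
      · exact zero_mem _
    have hker : (⟨_, hmem⟩ : symbolicReesAlgebra I) ∈ RingHom.ker φ := by
      rw [RingHom.mem_ker, hφ, Polynomial.coeff_monomial, if_neg (by omega)]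
    rw [← hG] at hker
    obtain ⟨c, hc⟩ := Submodule.mem_span_finset'.mp hker
    have hc' := congrArg (fun f : symbolicReesAlgebra I => (f : Polynomial R).coeff n) hc
    simp only [smul_eq_mul, AddSubmonoidClass.coe_finsetSum, Polynomial.finsetSum_coeff,
      MulMemClass.coe_mul, Polynomial.coeff_monomial, if_true] at hc'
    rw [← hc']
    refine Ideal.sum_mem _ fun g _ => ?_
    rw [Polynomial.coeff_mul]
    refine Ideal.sum_mem _ fun ij hij => ?_
    rw [Finset.HasAntidiagonal.mem_antidiagonal] at hij
    by_cases hz : ((g : symbolicReesAlgebra I) : Polynomial R).coeff ij.2 = 0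
    · rw [hz, mul_zero]; exact zero_mem _
    have hj : 1 ≤ ij.2 := by
      by_contra hj
      have hg : (g : symbolicReesAlgebra I) ∈ RingHom.ker φ := by
        rw [← hG]; exact Ideal.subset_span g.2
      rw [RingHom.mem_ker, hφ] at hg
      rw [show ij.2 = 0 by omega] at hz
      exact hz hg
    have h1 := hBmem g g.2 ij.2 hj hz
    have h3 : ((c g : symbolicReesAlgebra I) : Polynomial R).coeff ij.1 ∈
        symbolicPower I (n - ij.2) := by
      rw [show n - ij.2 = ij.1 by omega]
      exact (c g).2 ij.1
    rw [mul_comm]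
    exact mem_iSup_span_mul _ h1 (show ij.2 ≤ n by omega)
      (Ideal.mul_mem_mul (Ideal.mem_span_singleton_self _) h3)

/-- A Veronese subalgebra of a Noetherian symbolic Rees algebra is a Rees algebra. -/
theorem exists_symbolicPower_mul_eq_pow [IsNoetherianRing (symbolicReesAlgebra I)] (N : ℕ) :
    ∃ k, N ≤ k ∧ 1 ≤ k ∧ ∀ n, symbolicPower I (k * n) = symbolicPower I k ^ n := by
  obtain ⟨B, hB, hgen⟩ := exists_finite_generators_symbolicPower I
  obtain ⟨k, hk, h⟩ := exists_pow_eq_of_finite_generators (symbolicPower I) (symbolicPower_zero I)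
    (symbolicPower_mul_le I) B hB hgen
  refine ⟨k * (N + 1), ?_, Nat.mul_pos hk (Nat.succ_pos N), fun n => ?_⟩
  · nlinarith
  · rw [mul_assoc, h, h, pow_mul]

end SymbolicPower

end

section

open IsLocalRing

/-! ### Algebraic independence along chains of primes. -/

section Independence

theorem MvPolynomial.aeval_eq_eval₂_finSuccEquiv {R P : Type*} [CommRing R] [CommRing P]
    [Algebra R P] {s : ℕ} (f : Fin (s + 1) → P) (φ : MvPolynomial (Fin (s + 1)) R) :
    aeval f φ = (finSuccEquiv R s φ).eval₂ (aeval fun i : Fin s => f i.succ).toRingHom (f 0) := by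
  induction φ using MvPolynomial.induction_on with
  | C a =>
    have : finSuccEquiv R s (C a) = Polynomial.C (C a) := by
      exact (finSuccEquiv R s).commutes a
    simp [this]
  | add p q hp hq => simp [hp, hq]
  | mul_X p i hp =>
    rw [map_mul, map_mul, hp, Polynomial.eval₂_mul]
    refine i.cases ?_ fun j => ?_
    · simp [finSuccEquiv_X_zero]
    · simp [finSuccEquiv_X_succ]

/-- Elements separating the members of a chain of primes are algebraically independent modulo the
smallest one, over the residue ring of the largest one. -/
theorem coeff_mem_of_aeval_mem {R P : Type*} [CommRing R] [CommRing P] [Algebra R P]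
    (m : Ideal R) {s : ℕ} (Q : ℕ → Ideal P) (hQ : ∀ j, j < s → (Q j).IsPrime)
    (hmono : ∀ j, j < s → Q j ≤ Q (j + 1)) (f : Fin s → P)
    (hf : ∀ j : Fin s, f j ∈ Q (j + 1)) (hf' : ∀ j : Fin s, f j ∉ Q j)
    (hm : m.map (algebraMap R P) ≤ Q 0) (hs : (Q s).comap (algebraMap R P) ≤ m)
    (φ : MvPolynomial (Fin s) R) (h : MvPolynomial.aeval f φ ∈ Q 0) (α : Fin s →₀ ℕ) :
    φ.coeff α ∈ m := by
  induction s generalizing Q with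
  | zero =>
    obtain ⟨c, rfl⟩ := MvPolynomial.C_surjective (Fin 0) φ
    rw [MvPolynomial.aeval_C] at h
    rw [Subsingleton.elim α 0, MvPolynomial.coeff_C, if_pos rfl]
    exact hs h
  | succ s ih =>
    have hQ0 := hQ 0 (by omega)
    -- Write ψ = `divX` * X + constant term. Modulo Q 1 the element f 0 vanishes, so the outer
    -- induction puts the coefficients of the constant term in m; its value then lies in Q 0, and f
    -- 0 ∉ Q 0 can be cancelled from the rest, which has smaller degree.
    have key : ∀ (d : ℕ) (ψ : Polynomial (MvPolynomial (Fin s) R)), ψ.natDegree ≤ d →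
        ψ.eval₂ (MvPolynomial.aeval fun i : Fin s => f i.succ).toRingHom (f 0) ∈ Q 0 →
        ∀ i β, (ψ.coeff i).coeff β ∈ m := by
      intro d
      induction d using Nat.strong_induction_on with
      | _ d ihd =>
        intro ψ hd hψ
        rw [← Polynomial.divX_mul_X_add ψ, Polynomial.eval₂_add, Polynomial.eval₂_mul,
          Polynomial.eval₂_X, Polynomial.eval₂_C] at hψ
        have h0 : ∀ β, (ψ.coeff 0).coeff β ∈ m := by
          refine ih (fun j => Q (j + 1)) (fun j hj => hQ _ (by omega))
            (fun j hj => hmono _ (by omega)) (fun i => f i.succ) (fun j => by simpa using hf j.succ)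
            (fun j => by simpa using hf' j.succ) (hm.trans (hmono 0 (by omega))) hs _ ?_
          have h1 := hmono 0 (by omega) hψ
          rwa [Ideal.add_mem_iff_right _ (Ideal.mul_mem_left _ _ (by simpa using hf 0))] at h1
        have h1 : (MvPolynomial.aeval fun i : Fin s => f i.succ).toRingHom (ψ.coeff 0) ∈ Q 0 := by
          have : (MvPolynomial.aeval fun i : Fin s => f i.succ) (ψ.coeff 0) ∈ Q 0 := by
            rw [MvPolynomial.aeval_def, MvPolynomial.eval₂_eq]
            exact Ideal.sum_mem _ fun β _ => Ideal.mul_mem_right _ _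
              (hm (Ideal.mem_map_of_mem _ (h0 β)))
          exact this
        rw [Ideal.add_mem_iff_left _ h1] at hψ
        have h2 := (hQ0.mem_or_mem hψ).resolve_right (by simpa using hf' 0)
        intro i β
        cases i with
        | zero => exact h0 β
        | succ i =>
          rw [← Polynomial.coeff_divX]
          by_cases hz : ψ.natDegree = 0
          · have : ψ.divX = 0 := by
              rw [Polynomial.divX_eq_zero_iff]
              exact Polynomial.eq_C_of_natDegree_eq_zero hz
            simp [this]
          · refine ihd (d - 1) (by omega) ψ.divX ?_ h2 i β
            rw [Polynomial.natDegree_divX_eq_natDegree_tsub_one]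
            omega
    rw [MvPolynomial.aeval_eq_eval₂_finSuccEquiv] at h
    have := key _ _ le_rfl h (α 0) α.tail
    rwa [MvPolynomial.finSuccEquiv_coeff_coeff, Finsupp.cons_tail] at this

/-- Reduction modulo m factors through (A → R)/ker T, so (R/m)^A is a quotient of the image of T,
which is a submodule of N. -/
theorem card_le_length_of_ker_le {R N A : Type*} [CommRing R] [AddCommGroup N] [Module R N]
    [Fintype A] (m : Ideal R) [m.IsMaximal] (T : (A → R) →ₗ[R] N)
    (hT : ∀ c, T c = 0 → ∀ a, c a ∈ m) : (Fintype.card A : ℕ∞) ≤ Module.length R N := by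
  let π : (A → R) →ₗ[R] (A → R ⧸ m) := (Submodule.mkQ m).compLeft A
  have hπ : Function.Surjective π := fun x => by
    choose y hy using fun a => Submodule.mkQ_surjective m (x a)
    exact ⟨y, funext hy⟩
  have h1 : LinearMap.ker T ≤ LinearMap.ker π := fun c hc => by
    rw [LinearMap.mem_ker]
    funext a
    exact (Submodule.Quotient.mk_eq_zero m).mpr (hT c hc a)
  have h2 : Function.Surjective ((LinearMap.ker T).liftQ π h1) := fun x => by
    obtain ⟨y, rfl⟩ := hπ x
    exact ⟨Submodule.Quotient.mk y, rfl⟩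
  have h3 : Module.length R (R ⧸ m) = 1 := by
    have : IsSimpleModule R (R ⧸ m) := isSimpleModule_iff_isCoatom.mpr ‹m.IsMaximal›.out
    exact Module.length_eq_one R _
  calc (Fintype.card A : ℕ∞) = Module.length R (A → R ⧸ m) := by
        rw [Module.length_pi_of_fintype]; simp [h3]
    _ ≤ Module.length R ((A → R) ⧸ LinearMap.ker T) := Module.length_le_of_surjective _ h2
    _ = Module.length R (LinearMap.range T) := T.quotKerEquivRange.length_eq
    _ ≤ Module.length R N := Module.length_le_of_injective _ (Submodule.injective_subtype _)

end Independence

/-! ### The presentation of the fiber cone. -/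

section FiberIdeal

variable {R σ : Type*} [CommRing R]

namespace MvPolynomial

theorem homogeneousComponent_mul_of_isHomogeneous {f : MvPolynomial σ R} {m : ℕ}
    (hf : f.IsHomogeneous m) (g : MvPolynomial σ R) (n : ℕ) :
    homogeneousComponent n (f * g) = if m ≤ n then f * homogeneousComponent (n - m) g else 0 := by
  have h1 : ∀ i, homogeneousComponent n (f * homogeneousComponent i g) =
      if m + i = n then f * homogeneousComponent i g else 0 := fun i => by
    rw [homogeneousComponent_of_mem (hf.mul (homogeneousComponent_isHomogeneous i g))]
    simp only [eq_comm]
  conv_lhs => rw [← sum_homogeneousComponent g, Finset.mul_sum, map_sum]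
  simp only [h1]
  split_ifs with h
  · rw [Finset.sum_eq_single (n - m)]
    · rw [if_pos (by omega)]
    · intro i _ hi
      rw [if_neg (by omega)]
    · intro hi
      rw [if_pos (by omega), homogeneousComponent_eq_zero _ _ (by
        rw [Finset.mem_range, not_lt] at hi; omega), mul_zero]
  · exact Finset.sum_eq_zero fun i _ => if_neg (by omega)

end MvPolynomial

open MvPolynomial

theorem eval_mem_pow_of_isHomogeneous (b : σ → R) {f : MvPolynomial σ R} {n : ℕ}
    (hf : f.IsHomogeneous n) : eval b f ∈ Ideal.span (Set.range b) ^ n :=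
  (Ideal.mem_span_pow_iff_exists_isHomogeneous b _).mpr ⟨f, hf, rfl⟩

/-- The relations of the fiber cone `⨁ J ^ n / m J ^ n` of the ideal `J` generated by `b`. -/
noncomputable def fiberIdeal (m : Ideal R) (b : σ → R) : Ideal (MvPolynomial σ R) where
  carrier := {φ | ∀ n, eval b (homogeneousComponent n φ) ∈ m * Ideal.span (Set.range b) ^ n}
  zero_mem' n := by simp
  add_mem' hf hg n := by
    rw [map_add, map_add]
    exact add_mem (hf n) (hg n)
  smul_mem' c φ hφ n := by
    rw [smul_eq_mul, ← sum_homogeneousComponent c, Finset.sum_mul, map_sum, map_sum]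
    refine Ideal.sum_mem _ fun i _ => ?_
    rw [homogeneousComponent_mul_of_isHomogeneous (homogeneousComponent_isHomogeneous i c)]
    split_ifs with h
    · rw [map_mul]
      have := Ideal.mul_mem_mul (eval_mem_pow_of_isHomogeneous b
        (homogeneousComponent_isHomogeneous i c)) (hφ (n - i))
      rwa [mul_left_comm, ← pow_add, Nat.add_sub_cancel' h] at this
    · simp

theorem map_C_le_fiberIdeal (m : Ideal R) (b : σ → R) :
    m.map (C : R →+* MvPolynomial σ R) ≤ fiberIdeal m b := by
  refine Ideal.map_le_iff_le_comap.mpr fun r hr n => ?_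
  rw [homogeneousComponent_of_mem (isHomogeneous_C σ r)]
  split_ifs with h
  · subst h; simpa using hr
  · simp

attribute [local instance] MvPolynomial.gradedAlgebra in
theorem isHomogeneous_fiberIdeal (m : Ideal R) (b : σ → R) :
    (fiberIdeal m b).IsHomogeneous (homogeneousSubmodule σ R) := by
  intro i φ hφ n
  have h1 : ((DirectSum.decompose (homogeneousSubmodule σ R) φ i : homogeneousSubmodule σ R i) :
      MvPolynomial σ R) = homogeneousComponent i φ := decomposition.decompose'_apply φ i
  rw [h1, homogeneousComponent_of_mem (homogeneousComponent_isHomogeneous i φ)]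
  split_ifs with h
  · subst h; exact hφ n
  · simp

end FiberIdeal

end

section

open IsLocalRing

/-! ### Lengths and Hilbert–Samuel growth. -/

section Length

variable {R : Type*} [CommRing R]

theorem Module.length_le_add_of_exact {N M P : Type*} [AddCommGroup N] [AddCommGroup M]
    [AddCommGroup P] [Module R N] [Module R M] [Module R P] (f : N →ₗ[R] M) (g : M →ₗ[R] P)
    (hg : Function.Surjective g) (H : Function.Exact f g) :
    Module.length R M ≤ Module.length R N + Module.length R P := by
  have h1 := Module.length_eq_add_of_exact (LinearMap.range f).subtype g
    (Submodule.injective_subtype _) hg (by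
      rw [LinearMap.exact_iff] at H ⊢
      rw [H, Submodule.range_subtype])
  rw [h1]
  gcongr
  exact Module.length_le_of_surjective f.rangeRestrict f.surjective_rangeRestrict

theorem length_quotient_mono {a b : Ideal R} (h : a ≤ b) :
    Module.length R (R ⧸ b) ≤ Module.length R (R ⧸ a) :=
  Module.length_le_of_surjective (Submodule.factor h) (Submodule.factor_surjective h)

/-- Multiplication by z gives the exact sequence R/(z^N, a) → R/(z^(N+1), a) → R/(z, a) → 0. -/
theorem length_quotient_span_pow_sup_le (a : Ideal R) (z : R) (N : ℕ) :
    Module.length R (R ⧸ (Ideal.span {z ^ N} ⊔ a)) ≤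
      N * Module.length R (R ⧸ (Ideal.span {z} ⊔ a)) := by
  induction N with
  | zero =>
    have : Subsingleton (R ⧸ (Ideal.span {z ^ 0} ⊔ a)) := by
      rw [Ideal.Quotient.subsingleton_iff]; simp
    simp [Module.length_eq_zero]
  | succ N ih =>
    have hle : Ideal.span {z ^ (N + 1)} ⊔ a ≤ Ideal.span {z} ⊔ a :=
      sup_le_sup_right ((Ideal.span_singleton_le_span_singleton).mpr (dvd_pow_self z (by omega))) a
    have hf : Ideal.span {z ^ N} ⊔ a ≤ 
        Submodule.comap (LinearMap.mulLeft R z) (Ideal.span {z ^ (N + 1)} ⊔ a) := by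
      refine sup_le ((Ideal.span_singleton_le_iff_mem _).mpr ?_) fun x hx => ?_
      · rw [Submodule.mem_comap, LinearMap.mulLeft_apply, ← pow_succ']
        exact Ideal.mem_sup_left (Ideal.mem_span_singleton_self _)
      · exact Ideal.mem_sup_right (Ideal.mul_mem_left _ _ hx)
    have h1 := Module.length_le_add_of_exact (Submodule.mapQ _ _ (LinearMap.mulLeft R z) hf)
      (Submodule.factor hle) (Submodule.factor_surjective hle) (by
        intro x
        obtain ⟨x, rfl⟩ := Submodule.Quotient.mk_surjective _ x
        constructor
        · intro hx
          have hx' : x ∈ Ideal.span {z} ⊔ a := by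
            exact (Submodule.Quotient.mk_eq_zero _).mp hx
          obtain ⟨u, hu, v, hv, rfl⟩ := Submodule.mem_sup.mp hx'
          obtain ⟨w, rfl⟩ := Ideal.mem_span_singleton'.mp hu
          refine ⟨Submodule.Quotient.mk w, ?_⟩
          rw [Submodule.mapQ_apply, Submodule.Quotient.eq, LinearMap.mulLeft_apply]
          rw [show z * w - (w * z + v) = - v by ring]
          exact neg_mem (Ideal.mem_sup_right hv)
        · rintro ⟨y, hy⟩
          obtain ⟨y, rfl⟩ := Submodule.Quotient.mk_surjective _ y
          rw [← hy, Submodule.mapQ_apply]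
          simp only [Submodule.factor, Submodule.mapQ_apply, LinearMap.id_apply,
            LinearMap.mulLeft_apply]
          rw [Submodule.Quotient.mk_eq_zero]
          exact Ideal.mem_sup_left (Ideal.mul_mem_right _ _ (Ideal.mem_span_singleton_self _)))
    calc _ ≤ _ := h1
      _ ≤ N * Module.length R (R ⧸ (Ideal.span {z} ⊔ a)) +
          Module.length R (R ⧸ (Ideal.span {z} ⊔ a)) := by gcongr
      _ = _ := by push_cast; ring

theorem length_quotient_ofList_pow_sup_le (a : Ideal R) (zs : List R) (N : ℕ) :
    Module.length R (R ⧸ (Ideal.ofList (zs.map (· ^ N)) ⊔ a)) ≤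
      (N ^ zs.length : ℕ) * Module.length R (R ⧸ (Ideal.ofList zs ⊔ a)) := by
  induction zs generalizing a with
  | nil =>
    rw [show List.map (· ^ N) ([] : List R) = [] from rfl]
    simp
  | cons z zs ih =>
    rw [show List.map (· ^ N) (z :: zs) = z ^ N :: zs.map (· ^ N) from rfl]
    rw [Ideal.ofList_cons, Ideal.ofList_cons, List.length_cons]
    calc _ = Module.length R (R ⧸ (Ideal.span {z ^ N} ⊔ (Ideal.ofList (zs.map (· ^ N)) ⊔ a))) := by
          rw [sup_assoc]
      _ ≤ N * Module.length R (R ⧸ (Ideal.span {z} ⊔ (Ideal.ofList (zs.map (· ^ N)) ⊔ a))) :=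
          length_quotient_span_pow_sup_le _ z N
      _ = N * Module.length R (R ⧸ (Ideal.ofList (zs.map (· ^ N)) ⊔ (Ideal.span {z} ⊔ a))) := by
          rw [sup_left_comm]
      _ ≤ N * ((N ^ zs.length : ℕ) *
            Module.length R (R ⧸ (Ideal.ofList zs ⊔ (Ideal.span {z} ⊔ a)))) := by
          gcongr; exact ih _
      _ = _ := by
          rw [sup_left_comm, ← sup_assoc, ← mul_assoc]
          push_cast
          ring_nf

theorem length_quotient_ne_top [IsNoetherianRing R] [IsLocalRing R] (a : Ideal R)
    (h : ∀ p : Ideal R, p.IsPrime → a ≤ p → p = maximalIdeal R) :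
    Module.length R (R ⧸ a) ≠ ⊤ := by
  have hk : Ring.KrullDimLE 0 (R ⧸ a) := by
    refine Ring.krullDimLE_zero_iff.mpr fun p hp => ?_
    have h1 := h (p.comap (Ideal.Quotient.mk a)) inferInstance fun x hx => by
        rw [Ideal.mem_comap, Ideal.Quotient.eq_zero_iff_mem.mpr hx]; exact zero_mem _
    have h2 : (p.comap (Ideal.Quotient.mk a)).IsMaximal := h1 ▸ inferInstance
    have h3 := Ideal.map_eq_top_or_isMaximal_of_surjective (Ideal.Quotient.mk a)
      Ideal.Quotient.mk_surjective h2
    rw [Ideal.map_comap_of_surjective _ Ideal.Quotient.mk_surjective p] at h3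
    exact h3.resolve_left hp.ne_top
  have hA : IsArtinianRing (R ⧸ a) :=
    isArtinianRing_iff_isNoetherianRing_krullDimLE_zero.mpr ⟨inferInstance, hk⟩
  have : IsArtinian R (R ⧸ a) :=
    isArtinian_of_surjective_algebraMap (Ideal.Quotient.mk_surjective (I := a))
  exact Module.length_ne_top

/-- The image of `J ^ n` in `R ⧸ (J ^ (n + 1) + c)`. -/
def powImage (J c : Ideal R) (n : ℕ) : Submodule R (R ⧸ (J ^ (n + 1) ⊔ c)) :=
  Submodule.map (Submodule.mkQ (J ^ (n + 1) ⊔ c)) (J ^ n)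

/-- `powImage J c n` is the kernel of R/(J^(n+1) + c) → R/(J^n + c), so the lengths telescope. -/
theorem length_quotient_pow_sup_eq_sum (J c : Ideal R) (N : ℕ) :
    Module.length R (R ⧸ (J ^ N ⊔ c)) =
      ∑ n ∈ Finset.range N, Module.length R (powImage J c n) := by
  induction N with
  | zero =>
    have : Subsingleton (R ⧸ (J ^ 0 ⊔ c)) := by
      rw [Ideal.Quotient.subsingleton_iff]; simp [Ideal.one_eq_top]
    simp [Module.length_eq_zero]
  | succ N ih =>
    have hle : J ^ (N + 1) ⊔ c ≤ J ^ N ⊔ c := sup_le_sup_right (Ideal.pow_le_pow_right (by omega)) c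
    rw [Finset.sum_range_succ, ← ih, add_comm (Module.length R _)]
    refine Module.length_eq_add_of_exact (powImage J c N).subtype (Submodule.factor hle)
      (Submodule.injective_subtype _) (Submodule.factor_surjective hle) ?_
    intro x
    obtain ⟨x, rfl⟩ := Submodule.Quotient.mk_surjective _ x
    have h1 : Submodule.factor hle (Submodule.Quotient.mk x) = 0 ↔ x ∈ J ^ N ⊔ c := by
      exact Submodule.Quotient.mk_eq_zero _
    rw [h1, ← SetLike.mem_coe, Set.mem_range]
    constructor
    · intro hx
      obtain ⟨u, hu, v, hv, rfl⟩ := Submodule.mem_sup.mp hx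
      refine ⟨⟨Submodule.Quotient.mk u, u, hu, rfl⟩, ?_⟩
      simp only [Submodule.subtype_apply]
      rw [Submodule.Quotient.eq]
      rw [show u - (u + v) = -v by ring]
      exact neg_mem (Ideal.mem_sup_right hv)
    · rintro ⟨⟨_, u, hu, rfl⟩, hux⟩
      have h2 : u - x ∈ J ^ (N + 1) ⊔ c := (Submodule.Quotient.eq _).mp hux
      have : x = u - (u - x) := by ring
      rw [this]
      exact sub_mem (Ideal.mem_sup_left hu) (hle h2)

end Length

/-! ### The dimension of the fiber cone. -/

section Chains

variable {R σ : Type*} [CommRing R] [IsLocalRing R]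

open MvPolynomial

/-- Elements f_j in Q_(j+1) but not in Q_j are algebraically independent over the residue field
modulo Q_0, hence in the fiber cone. Their (L+1)^s monomials with exponents at most L have degree at
most L * D. By `hc` the fiber cone is a quotient of gr_J(R/c), so these monomials stay independent
in its pieces of degree at most L * D, whose total length is that of R/(J^(L * D + 1) + c). The f_j
need not be homogeneous, so all components are used together. -/
theorem card_pow_le_length_quotient (b : σ → R) (c : Ideal R)
    (hc : ∀ n, Ideal.span (Set.range b) ^ n ⊓ (Ideal.span (Set.range b) ^ (n + 1) ⊔ c) ≤
      maximalIdeal R * Ideal.span (Set.range b) ^ n) (s : ℕ)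
    (Q : ℕ → Ideal (MvPolynomial σ R)) (hQ : ∀ j, j ≤ s → (Q j).IsPrime)
    (hmono : ∀ j, j < s → Q j < Q (j + 1)) (h0 : fiberIdeal (maximalIdeal R) b ≤ Q 0) :
    ∃ D : ℕ, ∀ L : ℕ, (((L + 1) ^ s : ℕ) : ℕ∞) ≤
      Module.length R (R ⧸ (Ideal.span (Set.range b) ^ (L * D + 1) ⊔ c)) := by
  classical
  set J := Ideal.span (Set.range b)
  choose f hf hf' using fun j : Fin s => SetLike.exists_of_lt (hmono j j.2)
  refine ⟨∑ i, (f i).totalDegree, fun L => ?_⟩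
  set D := ∑ i, (f i).totalDegree
  let w : (Fin s → Fin (L + 1)) → MvPolynomial σ R := fun a => ∏ i, f i ^ (a i : ℕ)
  have hw : ∀ a, (w a).totalDegree ≤ L * D := fun a => by
    refine (totalDegree_finsetProd _ _).trans ?_
    rw [Finset.mul_sum]
    refine Finset.sum_le_sum fun i _ => (totalDegree_pow _ _).trans ?_
    exact Nat.mul_le_mul_right _ (Nat.lt_succ_iff.mp (a i).2)
  let T : ((Fin s → Fin (L + 1)) → R) →ₗ[R] MvPolynomial σ R := Fintype.linearCombination R w
  have hT : ∀ x, T x = ∑ a, x a • w a := fun x => Fintype.linearCombination_apply R w x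
  let ψ : MvPolynomial σ R →ₗ[R] (∀ n : Fin (L * D + 1), powImage J c n) :=
    LinearMap.pi fun n => LinearMap.codRestrict (powImage J c n)
      ((Submodule.mkQ (J ^ ((n : ℕ) + 1) ⊔ c)).comp
        ((aeval b).toLinearMap.comp (homogeneousComponent (n : ℕ))))
      (fun φ => ⟨aeval b (homogeneousComponent (n : ℕ) φ), by
        rw [aeval_eq_eval]
        exact eval_mem_pow_of_isHomogeneous b (homogeneousComponent_isHomogeneous _ φ), rfl⟩)
  have hψ : ∀ φ n, ψ φ n = 0 → eval b (homogeneousComponent (n : ℕ) φ) ∈ J ^ ((n : ℕ) + 1) ⊔ c := by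
    intro φ n h
    have h1 := congrArg Subtype.val h
    have h2 : (Submodule.mkQ (J ^ ((n : ℕ) + 1) ⊔ c))
      (aeval b (homogeneousComponent (n : ℕ) φ)) = 0 := h1
    rw [aeval_eq_eval] at h2
    exact (Submodule.Quotient.mk_eq_zero _).mp h2
  have hker : ∀ x, (ψ.comp T) x = 0 → ∀ a, x a ∈ maximalIdeal R := by
    intro x hx a
    have hmem : T x ∈ fiberIdeal (maximalIdeal R) b := by
      intro n
      have hmem : eval b (homogeneousComponent n (T x)) ∈ J ^ n :=
        eval_mem_pow_of_isHomogeneous b (homogeneousComponent_isHomogeneous n _)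
      by_cases hn : n < L * D + 1
      · exact hc n ⟨hmem, hψ (T x) ⟨n, hn⟩ (congrFun hx ⟨n, hn⟩)⟩
      · rw [homogeneousComponent_eq_zero]
        · simp
        · refine lt_of_le_of_lt ?_ (show L * D < n by omega)
          rw [hT]
          refine (totalDegree_finsetSum _ _).trans (Finset.sup_le fun a _ => ?_)
          exact (totalDegree_smul_le _ _).trans (hw a)
    let e : (Fin s → Fin (L + 1)) → (Fin s →₀ ℕ) := fun a =>
      Finsupp.equivFunOnFinite.symm fun i => (a i : ℕ)
    have he : Function.Injective e := fun a a' h => by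
      funext i
      exact Fin.ext (DFunLike.congr_fun h i)
    have h1 : aeval f (∑ a, monomial (e a) (x a)) = T x := by
      rw [map_sum, hT]
      refine Finset.sum_congr rfl fun a _ => ?_
      rw [aeval_monomial, Algebra.smul_def, Finsupp.prod_fintype _ _ (by simp)]
      rfl
    have h2 := coeff_mem_of_aeval_mem (maximalIdeal R) Q (fun j hj => hQ j hj.le)
      (fun j hj => (hmono j hj).le) f hf hf' ((map_C_le_fiberIdeal _ b).trans h0)
      (le_maximalIdeal ((hQ s le_rfl).comap _).ne_top) _ (by rw [h1]; exact h0 hmem) (e a)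
    rw [coeff_sum, Finset.sum_eq_single a] at h2
    · simpa using h2
    · intro a' _ ha'
      rw [coeff_monomial, if_neg (fun h => ha' (he h))]
    · simp
  have h3 := card_le_length_of_ker_le (maximalIdeal R) (ψ.comp T) hker
  rw [Module.length_pi_of_fintype, ← Finset.sum_range (fun n => Module.length R (powImage J c n)),
    ← length_quotient_pow_sup_eq_sum] at h3
  simpa using h3

/-- The dimension of the fiber cone is bounded by the growth of `R ⧸ (J ^ N + c)`. -/
theorem chain_length_le (b : σ → R) (c : Ideal R)
    (hc : ∀ n, Ideal.span (Set.range b) ^ n ⊓ (Ideal.span (Set.range b) ^ (n + 1) ⊔ c) ≤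
      maximalIdeal R * Ideal.span (Set.range b) ^ n) {e B : ℕ}
    (hB : ∀ N : ℕ, Module.length R (R ⧸ (Ideal.span (Set.range b) ^ N ⊔ c)) ≤ (N ^ e * B : ℕ))
    (s : ℕ) (Q : ℕ → Ideal (MvPolynomial σ R)) (hQ : ∀ j, j ≤ s → (Q j).IsPrime)
    (hmono : ∀ j, j < s → Q j < Q (j + 1)) (h0 : fiberIdeal (maximalIdeal R) b ≤ Q 0) :
    s ≤ e := by
  by_contra! hlt
  obtain ⟨D, hD⟩ := card_pow_le_length_quotient b c hc (e + 1) Q (fun j hj => hQ j (by omega))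
    (fun j hj => hmono j (by omega)) h0
  have h1 : ∀ L : ℕ, (L + 1) ^ (e + 1) ≤ (L * D + 1) ^ e * B := fun L => by
    exact_mod_cast (hD L).trans (hB _)
  -- Since L * D + 1 ≤ (L + 1)(D + 1), the right side is at most (L + 1)^e (D + 1)^e B; at L = (D +
  -- 1)^e B this is below (L + 1)^(e+1).
  have h2 := h1 ((D + 1) ^ e * B)
  set L := (D + 1) ^ e * B
  have h3 : (L * D + 1) ^ e * B ≤ (L + 1) ^ e * L := by
    calc (L * D + 1) ^ e * B ≤ ((L + 1) * (D + 1)) ^ e * B := by gcongr; nlinarith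
      _ = _ := by rw [mul_pow, mul_assoc]
  have h4 : (L + 1) ^ e * L < (L + 1) ^ (e + 1) := by
    rw [pow_succ]
    exact Nat.mul_lt_mul_of_pos_left (Nat.lt_succ_self L) (by positivity)
  omega

end Chains

end

section

open IsLocalRing MvPolynomial RingTheory.Sequence

/-! ### Homogeneous primes and homogeneous parameters of the fiber cone. -/

section HomogeneousPrimes

variable {R σ : Type*} [CommRing R]

attribute [local instance] MvPolynomial.gradedAlgebra

theorem isHomogeneous_iff_homogeneousComponent_mem {P : Ideal (MvPolynomial σ R)} :
    P.IsHomogeneous (homogeneousSubmodule σ R) ↔ ∀ φ ∈ P, ∀ i, homogeneousComponent i φ ∈ P := by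
  have h1 : ∀ φ i, ((DirectSum.decompose (homogeneousSubmodule σ R) φ i :
      homogeneousSubmodule σ R i) : MvPolynomial σ R) = homogeneousComponent i φ :=
    fun φ i => decomposition.decompose'_apply φ i
  constructor
  · intro h φ hφ i
    rw [← h1]
    exact h i hφ
  · intro h i φ hφ
    rw [h1]
    exact h φ hφ i

/-- The homogeneous core of P is prime and still contains a, so it equals P by minimality. -/
theorem isHomogeneous_of_mem_minimalPrimes {a P : Ideal (MvPolynomial σ R)}
    (ha : a.IsHomogeneous (homogeneousSubmodule σ R)) (hP : P ∈ a.minimalPrimes) :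
    P.IsHomogeneous (homogeneousSubmodule σ R) := by
  have hle := Ideal.toIdeal_homogeneousCore_le (homogeneousSubmodule σ R) P
  have h1 : a ≤ (P.homogeneousCore (homogeneousSubmodule σ R)).toIdeal := by
    rw [← ha.toIdeal_homogeneousCore_eq_self]
    exact Ideal.homogeneousCore_mono _ hP.1.2
  have h2 := hP.2 ⟨hP.1.1.homogeneousCore, h1⟩ hle
  rw [le_antisymm h2 hle]
  exact (P.homogeneousCore (homogeneousSubmodule σ R)).isHomogeneous

theorem exists_isHomogeneous_mem_notMem {P Q : Ideal (MvPolynomial σ R)}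
    (hP : P.IsHomogeneous (homogeneousSubmodule σ R)) (h : ¬ P ≤ Q) :
    ∃ f ∈ P, f ∉ Q ∧ ∃ n, f.IsHomogeneous n := by
  obtain ⟨x, hx, hxQ⟩ := SetLike.not_le_iff_exists.mp h
  by_contra! hc
  refine hxQ ?_
  rw [← sum_homogeneousComponent x]
  refine Ideal.sum_mem _ fun i _ => ?_
  by_contra hi
  exact hc _ (isHomogeneous_iff_homogeneousComponent_mem.mp hP x hx i) hi i
    (homogeneousComponent_isHomogeneous i x)

theorem isHomogeneous_sup_ofList {a : Ideal (MvPolynomial σ R)}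
    (ha : a.IsHomogeneous (homogeneousSubmodule σ R)) {fs : List (MvPolynomial σ R)}
    (hfs : ∀ f ∈ fs, ∃ n, f.IsHomogeneous n) :
    (a ⊔ Ideal.ofList fs).IsHomogeneous (homogeneousSubmodule σ R) :=
  ha.sup (Ideal.homogeneous_span _ _ fun f hf => by
    obtain ⟨n, hn⟩ := hfs f hf
    exact ⟨n, hn⟩)

/-- Homogeneous prime avoidance. -/
theorem exists_isHomogeneous_forall_notMem (s : Finset (Ideal (MvPolynomial σ R)))
    (hprime : ∀ Q ∈ s, Q.IsPrime) (hhom : ∀ Q ∈ s, Q.IsHomogeneous (homogeneousSubmodule σ R))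
    (hanti : ∀ Q ∈ s, ∀ Q' ∈ s, Q' ≤ Q → Q' = Q) (hX : ∀ Q ∈ s, ∃ j, X j ∉ Q) :
    ∃ f, (∃ n, 1 ≤ n ∧ f.IsHomogeneous n) ∧ ∀ Q ∈ s, f ∉ Q := by
  classical
  have h1 : ∀ Q : s, ∃ g : MvPolynomial σ R, ∃ n, 1 ≤ n ∧ g.IsHomogeneous n ∧ g ∉ Q.1 ∧
      ∀ Q' ∈ s, Q' ≠ Q.1 → g ∈ Q' := by
    rintro ⟨Q, hQ⟩
    obtain ⟨j, hj⟩ := hX Q hQ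
    have hQp := hprime Q hQ
    have h2 : ∀ Q' : (s.erase Q : Finset _), ∃ f ∈ Q'.1, f ∉ Q ∧ ∃ n, f.IsHomogeneous n := by
      rintro ⟨Q', hQ'⟩
      rw [Finset.mem_erase] at hQ'
      exact exists_isHomogeneous_mem_notMem (hhom Q' hQ'.2) fun h =>
        hQ'.1 (hanti Q hQ Q' hQ'.2 h)
    choose f hf hfQ n hn using h2
    -- The product lies in every other prime but not in Q; the factor X j makes its degree positive.
    refine ⟨X j * ∏ Q', f Q', 1 + ∑ Q', n Q', by omega,
      (isHomogeneous_X R j).mul (IsHomogeneous.prod _ _ _ fun i _ => hn i), ?_, ?_⟩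
    · rw [hQp.mul_mem_iff_mem_or_mem, not_or]
      refine ⟨hj, fun h => ?_⟩
      obtain ⟨i, _, hi⟩ := (hQp.prod_mem_iff).mp h
      exact hfQ i hi
    · intro Q' hQ' hne
      refine Ideal.mul_mem_left _ _ ?_
      exact Ideal.mem_of_dvd _ (Finset.dvd_prod_of_mem f
        (Finset.mem_univ ⟨Q', Finset.mem_erase.mpr ⟨hne, hQ'⟩⟩))
        (hf ⟨Q', Finset.mem_erase.mpr ⟨hne, hQ'⟩⟩)
  choose g n hn1 hn hgQ hg using h1
  -- Raising g Q to the power N / n Q brings all summands to the common degree N, so the sum is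
  -- homogeneous; modulo each Q exactly one summand survives.
  set N := ∏ Q, n Q with hN
  have hNpos : 1 ≤ N := Finset.one_le_prod' fun i _ => hn1 i
  have hdvd : ∀ Q, n Q ∣ N := fun Q => Finset.dvd_prod_of_mem n (Finset.mem_univ Q)
  refine ⟨∑ Q, g Q ^ (N / n Q), ⟨N, hNpos, ?_⟩, fun Q hQ hmem => ?_⟩
  · refine IsHomogeneous.sum _ _ _ fun Q _ => ?_
    have := (hn Q).pow (N / n Q)
    rwa [Nat.mul_div_cancel' (hdvd Q)] at this
  · rw [← Finset.add_sum_erase _ _ (Finset.mem_univ (⟨Q, hQ⟩ : s))] at hmem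
    have h3 : ∑ x ∈ Finset.univ.erase (⟨Q, hQ⟩ : s), g x ^ (N / n x) ∈ Q := by
      refine Ideal.sum_mem _ fun Q' hQ' => Ideal.pow_mem_of_mem _ (hg Q' Q hQ ?_) _ ?_
      · rintro rfl
        simp at hQ'
      · exact Nat.div_pos (Nat.le_of_dvd hNpos (hdvd Q')) (hn1 Q')
    rw [Ideal.add_mem_iff_left _ h3] at hmem
    exact hgQ ⟨Q, hQ⟩ ((hprime Q hQ).mem_of_pow_mem _ hmem)

/-- Homogeneous elements cutting down the relevant part of `a`. -/
theorem exists_ofList_minimalPrimes_chain [IsNoetherianRing R] [Finite σ]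
    {a : Ideal (MvPolynomial σ R)} (ha : a.IsHomogeneous (homogeneousSubmodule σ R)) (i : ℕ) :
    ∃ fs : List (MvPolynomial σ R), fs.length = i ∧
      (∀ f ∈ fs, ∃ n, 1 ≤ n ∧ f.IsHomogeneous n) ∧
      ∀ P ∈ (a ⊔ Ideal.ofList fs).minimalPrimes, (∃ j, X j ∉ P) →
        ∃ Q : ℕ → Ideal (MvPolynomial σ R), (∀ j, j ≤ i → (Q j).IsPrime) ∧
          (∀ j, j < i → Q j < Q (j + 1)) ∧ a ≤ Q 0 ∧ Q i = P := by
  classical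
  induction i with
  | zero =>
    refine ⟨[], rfl, by simp, fun P hP _ => ⟨fun _ => P, fun _ _ => hP.1.1, by simp, ?_, rfl⟩⟩
    exact le_sup_left.trans hP.1.2
  | succ i ih =>
    obtain ⟨fs, hlen, hfs, hmin⟩ := ih
    have hhom := isHomogeneous_sup_ofList ha (fs := fs) fun f hf => (hfs f hf).imp fun _ h => h.2
    have hfin := Ideal.finite_minimalPrimes_of_isNoetherianRing _ (a ⊔ Ideal.ofList fs)
    -- Only minimal primes missing some variable are avoided. A minimal prime P at the next stage
    -- that misses a variable lies strictly above one of them, which lengthens the chain.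
    obtain ⟨f, hf, hfQ⟩ := exists_isHomogeneous_forall_notMem
      (hfin.toFinset.filter fun P => ∃ j, X j ∉ P)
      (fun Q hQ => by simp at hQ; exact hQ.1.1.1)
      (fun Q hQ => by simp at hQ; exact isHomogeneous_of_mem_minimalPrimes hhom hQ.1)
      (fun Q hQ Q' hQ' hle => by
        simp at hQ hQ'
        exact le_antisymm hle (hQ.1.2 hQ'.1.1 hle))
      (fun Q hQ => by simp at hQ; exact hQ.2)
    refine ⟨f :: fs, by simp [hlen], by simpa using ⟨hf, hfs⟩, fun P hP hPX => ?_⟩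
    have hPp : P.IsPrime := hP.1.1
    have hP2 := hP.1.2
    rw [Ideal.ofList_cons, sup_left_comm, sup_le_iff, Ideal.span_singleton_le_iff_mem] at hP2
    obtain ⟨P', hP', hle⟩ := Ideal.exists_minimalPrimes_le hP2.2
    have hP'X : ∃ j, X j ∉ P' := hPX.imp fun j hj h => hj (hle h)
    have hfP' : f ∉ P' := hfQ P' (by simpa using ⟨hP', hP'X⟩)
    have hlt : P' < P := lt_of_le_of_ne hle fun h => hfP' (h ▸ hP2.1)
    obtain ⟨Q, hQ1, hQ2, hQ3, hQ4⟩ := hmin P' hP' hP'X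
    refine ⟨fun j => if j ≤ i then Q j else P, fun j hj => ?_, fun j hj => ?_, ?_, ?_⟩
    · dsimp only
      split_ifs with h
      · exact hQ1 j h
      · exact hPp
    · dsimp only
      rw [if_pos (by omega : j ≤ i)]
      split_ifs with h
      · exact hQ2 j (by omega)
      · obtain rfl : j = i := by omega
        rwa [hQ4]
    · simpa using hQ3
    · simp

theorem eval_homogeneousComponent_mem_ofList (b : σ → R) {fs : List (MvPolynomial σ R)}
    (hfs : ∀ f ∈ fs, ∃ n, 1 ≤ n ∧ f.IsHomogeneous n) {w : MvPolynomial σ R}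
    (hw : w ∈ Ideal.ofList fs) (n : ℕ) :
    eval b (homogeneousComponent n w) ∈ Ideal.ofList (fs.map (eval b)) := by
  refine Submodule.span_induction (p := fun w _ => ∀ n,
    eval b (homogeneousComponent n w) ∈ Ideal.ofList (fs.map (eval b)))
    ?_ (by simp) (fun x y _ _ hx hy n => by rw [map_add, map_add]; exact add_mem (hx n) (hy n))
    ?_ hw n
  · intro f hf n
    obtain ⟨k, _, hk⟩ := hfs f hf
    rw [homogeneousComponent_of_mem hk]
    split_ifs
    · exact Ideal.subset_span (List.mem_map_of_mem hf)
    · simp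
  · intro a x _ hx n
    rw [smul_eq_mul, ← sum_homogeneousComponent a, Finset.sum_mul, map_sum, map_sum]
    refine Ideal.sum_mem _ fun i _ => ?_
    rw [homogeneousComponent_mul_of_isHomogeneous (homogeneousComponent_isHomogeneous i a)]
    split_ifs
    · rw [map_mul]
      exact Ideal.mul_mem_left _ _ (hx _)
    · simp

/-- A minimal prime of a + (fs) missing a variable would end a chain of length e. Being homogeneous
and containing m, it lies strictly inside the ideal M of polynomials with constant term in m, giving
a forbidden chain of length e + 1. So every variable lies in the radical. -/
theorem exists_idealOfVars_pow_le [IsLocalRing R] [IsNoetherianRing R] [Finite σ]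
    {a : Ideal (MvPolynomial σ R)}
    (ha : a.IsHomogeneous (homogeneousSubmodule σ R))
    (hma : (maximalIdeal R).map (C : R →+* MvPolynomial σ R) ≤ a) {e : ℕ}
    (hchain : ∀ (s : ℕ) (Q : ℕ → Ideal (MvPolynomial σ R)), (∀ j, j ≤ s → (Q j).IsPrime) →
      (∀ j, j < s → Q j < Q (j + 1)) → a ≤ Q 0 → s ≤ e) :
    ∃ fs : List (MvPolynomial σ R), fs.length = e ∧
      (∀ f ∈ fs, ∃ n, 1 ≤ n ∧ f.IsHomogeneous n) ∧
      ∃ n, idealOfVars σ R ^ n ≤ a ⊔ Ideal.ofList fs := by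
  obtain ⟨fs, hlen, hfs, hmin⟩ := exists_ofList_minimalPrimes_chain ha e
  refine ⟨fs, hlen, hfs, Ideal.exists_pow_le_of_le_radical_of_fg ?_ (idealOfVars_fg σ R)⟩
  rw [idealOfVars, Ideal.span_le, ← Ideal.sInf_minimalPrimes]
  rintro _ ⟨j, rfl⟩
  rw [SetLike.mem_coe, Ideal.mem_sInf]
  intro P hP
  by_contra hj
  obtain ⟨Q, hQ1, hQ2, hQ3, hQ4⟩ := hmin P hP ⟨j, hj⟩
  have hhom := isHomogeneous_of_mem_minimalPrimes (isHomogeneous_sup_ofList ha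
    fun f hf => (hfs f hf).imp fun _ h => h.2) hP
  have hPp : P.IsPrime := hP.1.1
  have hmP := hma.trans (le_sup_left.trans hP.1.2)
  set M := (maximalIdeal R).comap (constantCoeff : MvPolynomial σ R →+* R) with hM
  have hle : P ≤ M := fun φ hφ => by
    have h1 := isHomogeneous_iff_homogeneousComponent_mem.mp hhom φ hφ 0
    rw [homogeneousComponent_zero] at h1
    rw [hM, Ideal.mem_comap, constantCoeff_eq]
    by_contra hu
    rw [mem_maximalIdeal, mem_nonunits_iff, not_not] at hu
    exact hPp.ne_top (Ideal.eq_top_of_isUnit_mem _ h1 (hu.map C))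
  have hlt : P < M := lt_of_le_of_ne hle fun h => hj (by
    rw [h, hM, Ideal.mem_comap, constantCoeff_X]; exact zero_mem _)
  have hMp : M.IsPrime := inferInstance
  have := hchain (e + 1) (fun j => if j ≤ e then Q j else M) (fun j hj => by
      split_ifs with h
      · exact hQ1 j h
      · exact hMp) (fun j hj => by
      rw [if_pos (by omega : j ≤ e)]
      split_ifs with h
      · exact hQ2 j (by omega)
      · obtain rfl : j = e := by omega
        rwa [hQ4]) (by simpa using hQ3)
  omega

/-- Evaluating the forms at b turns the inclusion in the fiber cone into J^n ⊆ (gs) + mJ^n, and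
Nakayama gives J^n ⊆ (gs). Conversely gs ⊆ J because the forms have positive degree. -/
theorem exists_radical_ofList_eq [IsLocalRing R] [IsNoetherianRing R] [Finite σ]
    (b : σ → R) {e : ℕ}
    (hchain : ∀ (s : ℕ) (Q : ℕ → Ideal (MvPolynomial σ R)), (∀ j, j ≤ s → (Q j).IsPrime) →
      (∀ j, j < s → Q j < Q (j + 1)) → fiberIdeal (maximalIdeal R) b ≤ Q 0 → s ≤ e) :
    ∃ gs : List R, gs.length = e ∧
      (Ideal.ofList gs).radical = (Ideal.span (Set.range b)).radical := by
  obtain ⟨fs, hlen, hfs, n, hn⟩ := exists_idealOfVars_pow_le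
    (isHomogeneous_fiberIdeal (maximalIdeal R) b) (map_C_le_fiberIdeal _ b) hchain
  refine ⟨fs.map (eval b), by simpa using hlen, le_antisymm ?_ ?_⟩
  · refine Ideal.radical_mono (Ideal.span_le.mpr fun x hx => ?_)
    obtain ⟨f, hf, rfl⟩ := List.mem_map.mp hx
    obtain ⟨k, hk1, hk⟩ := hfs f hf
    exact Ideal.pow_le_self (by omega) (eval_mem_pow_of_isHomogeneous b hk)
  · have h1 : Ideal.span (Set.range b) ^ n ≤ Ideal.ofList (fs.map (eval b)) := by
      refine Submodule.le_of_le_smul_of_le_jacobson_bot (I := maximalIdeal R)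
        (IsNoetherian.noetherian _) (maximalIdeal_le_jacobson _) fun x hx => ?_
      obtain ⟨φ, hφ, rfl⟩ := (Ideal.mem_span_pow_iff_exists_isHomogeneous b _).mp hx
      have h2 : φ ∈ idealOfVars σ R ^ n := by
        rw [mem_pow_idealOfVars_iff]
        intro d hd
        have := hφ (mem_support_iff.mp hd)
        rw [← this, Finsupp.degree_eq_weight_one]
        exact le_refl _
      obtain ⟨κ, hκ, w, hw, rfl⟩ := Submodule.mem_sup.mp (hn h2)
      have h3 := homogeneousComponent_of_mem (n := n) (m := n) hφ
      rw [if_pos rfl] at h3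
      rw [← h3, map_add, map_add, add_comm]
      exact Submodule.add_mem_sup (eval_homogeneousComponent_mem_ofList b hfs hw n) (hκ n)
    refine Ideal.radical_le_radical_iff.mpr fun x hx => ⟨n, h1 (Ideal.pow_mem_pow hx n)⟩

end HomogeneousPrimes

end

section

open IsLocalRing RingTheory.Sequence

universe u

/-! ### Cohen–Macaulay powers bound the number of generators up to radical. -/

section AnalyticSpread

variable {R : Type u} [CommRing R]

theorem mk_mem_smul_top_iff {a K : Ideal R} {x : R} :
    Submodule.Quotient.mk x ∈ (a • ⊤ : Submodule R (R ⧸ K)) ↔ x ∈ a ⊔ K := by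
  rw [← Ideal.mem_quotient_iff_mem_sup, Ideal.smul_top_eq_map]
  rfl

/-- This is the vanishing of Tor₁(R/(ys), R/K). If u + ay ∈ K with u in the span of the earlier
elements, regularity of y gives a = v + k with v in that span and k ∈ K; then u + vy falls under the
induction and yk is in the product. -/
theorem ofList_inf_le_mul (K : Ideal R) (ys : List R) (h : IsWeaklyRegular (R ⧸ K) ys) :
    Ideal.ofList ys ⊓ K ≤ Ideal.ofList ys * K := by
  induction ys using List.reverseRecOn with
  | nil => simp
  | append_singleton ys y ih =>
    rw [isWeaklyRegular_append_iff, isWeaklyRegular_singleton_iff] at h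
    rintro x ⟨hx, hxK⟩
    rw [SetLike.mem_coe, Ideal.ofList_append, Ideal.ofList_singleton] at hx
    obtain ⟨u, hu, w, hw, rfl⟩ := Submodule.mem_sup.mp hx
    obtain ⟨a, rfl⟩ := Ideal.mem_span_singleton'.mp hw
    have h1 : a ∈ Ideal.ofList ys ⊔ K := by
      rw [← mk_mem_smul_top_iff, ← Submodule.Quotient.mk_eq_zero]
      refine h.2 ?_
      dsimp only
      rw [smul_zero, ← Submodule.Quotient.mk_smul, Submodule.Quotient.mk_eq_zero,
        ← Submodule.Quotient.mk_smul, mk_mem_smul_top_iff]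
      have : y • a = (u + a * y) - u := by rw [smul_eq_mul]; ring
      rw [this]
      exact sub_mem (Ideal.mem_sup_right hxK) (Ideal.mem_sup_left hu)
    obtain ⟨v, hv, k, hk, rfl⟩ := Submodule.mem_sup.mp h1
    have h2 : u + v * y ∈ Ideal.ofList ys ⊓ K := by
      refine ⟨add_mem hu (Ideal.mul_mem_right _ _ hv), ?_⟩
      have : u + v * y = (u + (v + k) * y) - k * y := by ring
      rw [this]
      exact sub_mem hxK (Ideal.mul_mem_right _ _ hk)
    have h3 : u + (v + k) * y = (u + v * y) + y * k := by ring
    rw [h3]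
    refine add_mem (Ideal.mul_mono_left ?_ (ih h.1 h2)) (Ideal.mul_mem_mul ?_ hk)
    · rw [Ideal.ofList_append]; exact le_sup_left
    · exact Ideal.subset_span (by simp)

variable [IsLocalRing R]

theorem eq_maximalIdeal_of_ringKrullDim_quotient_le_zero {a q : Ideal R}
    (h : ringKrullDim (R ⧸ a) ≤ 0) [hq : q.IsPrime] (hle : a ≤ q) : q = maximalIdeal R := by
  by_contra hne
  have h1 := ringKrullDim_quotient_succ_le_of_lt (lt_of_le_of_ne (le_maximalIdeal hq.ne_top) hne)
  have h2 := h1.trans ((ringKrullDim_quotient_mono hle).trans h)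
  have h3 : (0 : WithBot ℕ∞) ≤ ringKrullDim (R ⧸ maximalIdeal R) :=
    ringKrullDim_nonneg_of_nontrivial
  have h4 : (1 : WithBot ℕ∞) ≤ 0 := by
    calc (1 : WithBot ℕ∞) = 0 + 1 := by simp
      _ ≤ _ := by gcongr
      _ ≤ 0 := h2
  exact absurd h4 (by decide)

theorem IsCohenMacaulayModule.exists_isRegular {M : Type*} [AddCommGroup M] [Module R M]
    [Nontrivial M] (h : IsCohenMacaulayModule R M) {r : ℕ} (hr : Module.supportDim R M = r)
    (hpos : r ≠ 0) :
    ∃ rs : List R, rs.length = r ∧ (∀ x ∈ rs, x ∈ maximalIdeal R) ∧ IsRegular M rs := by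
  have h1 : localDepth R M = r := by
    have := h.resolve_left (not_subsingleton M)
    rw [hr] at this
    exact_mod_cast this
  -- A supremum exceeding r - 1 has a term exceeding it, so the depth is attained. For r = 0 the
  -- truncated r - 1 would not be smaller, whence `hpos`.
  have h2 : ((r - 1 : ℕ) : ℕ∞) < localDepth R M := by
    rw [h1]; exact_mod_cast Nat.sub_lt (Nat.pos_of_ne_zero hpos) one_pos
  rw [localDepth] at h2
  obtain ⟨rs, hrs⟩ := lt_iSup_iff.mp h2
  obtain ⟨hrs', hlt⟩ := lt_iSup_iff.mp hrs
  refine ⟨rs, ?_, hrs'⟩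
  have h3 : (rs.length : ℕ∞) ≤ r := by
    rw [← h1]
    exact le_iSup₂ (f := fun (rs : List R) (_ : (∀ r ∈ rs, r ∈ maximalIdeal R) ∧
      IsRegular M rs) => (rs.length : ℕ∞)) rs hrs'
  have h4 : r - 1 < rs.length := by exact_mod_cast hlt
  have h5 : rs.length ≤ r := by exact_mod_cast h3
  omega

variable [IsNoetherianRing R]

/-- Avoiding the minimal primes of (ys) and of J + (ys) together yields elements that act as
parameters on R and on R/J at once. -/
theorem exists_list_ringKrullDim_quotient_le (J : Ideal R) {r e : ℕ}
    (hd : ringKrullDim R ≤ (r + e : ℕ)) (hr : ringKrullDim (R ⧸ J) ≤ r) (i : ℕ) (hi : i ≤ r) :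
    ∃ ys : List R, ys.length = i ∧ (∀ y ∈ ys, y ∈ maximalIdeal R) ∧
      ringKrullDim (R ⧸ Ideal.ofList ys) ≤ (r - i + e : ℕ) ∧
      ringKrullDim (R ⧸ (J ⊔ Ideal.ofList ys)) ≤ (r - i : ℕ) := by
  induction i with
  | zero =>
    refine ⟨[], rfl, by simp, (ringKrullDim_quotient_le _).trans hd, ?_⟩
    exact (ringKrullDim_quotient_mono le_sup_left).trans hr
  | succ i ih =>
    obtain ⟨ys, hlen, hys, h1, h2⟩ := ih (by omega)
    obtain ⟨y, hy, hy1, hy2⟩ := exists_mem_ringKrullDim_quotient_sup_span_le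
      (Ideal.ofList ys) (J ⊔ Ideal.ofList ys) (maximalIdeal R)
      (fun p hp _ h => le_antisymm (le_maximalIdeal hp.ne_top) h)
      (fun p hp _ h => le_antisymm (le_maximalIdeal hp.ne_top) h)
    refine ⟨y :: ys, by simp [hlen], by simpa using ⟨hy, hys⟩, ?_, ?_⟩
    · rw [Ideal.ofList_cons, sup_comm]
      exact hy1 _ (by convert! h1 using 2; omega)
    · rw [Ideal.ofList_cons, sup_comm (Ideal.span {y}), ← sup_assoc]
      exact hy2 _ (by convert! h2 using 2; omega)

/-- Since only the maximal ideal contains both c and J, parameters of R/c can be found inside J.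
Their N-th powers then lie in J^N, which is what bounds the growth. -/
theorem exists_list_mem_ringKrullDim_quotient_le (J c : Ideal R) {e : ℕ}
    (hc : ringKrullDim (R ⧸ c) ≤ e)
    (hJ : ∀ p : Ideal R, p.IsPrime → c ≤ p → J ≤ p → p = maximalIdeal R) (i : ℕ) (hi : i ≤ e) :
    ∃ zs : List R, zs.length = i ∧ (∀ z ∈ zs, z ∈ J) ∧
      ringKrullDim (R ⧸ (Ideal.ofList zs ⊔ c)) ≤ (e - i : ℕ) := by
  induction i with
  | zero => exact ⟨[], rfl, by simp, (ringKrullDim_quotient_mono le_sup_right).trans hc⟩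
  | succ i ih =>
    obtain ⟨zs, hlen, hzs, h1⟩ := ih (by omega)
    obtain ⟨z, hz, hz1, -⟩ := exists_mem_ringKrullDim_quotient_sup_span_le
      (Ideal.ofList zs ⊔ c) (Ideal.ofList zs ⊔ c) J
      (fun p hp h => hJ p hp (le_sup_right.trans h)) (fun p hp h => hJ p hp (le_sup_right.trans h))
    refine ⟨z :: zs, by simp [hlen], by simpa using ⟨hz, hzs⟩, ?_⟩
    rw [Ideal.ofList_cons, sup_assoc, sup_comm]
    exact hz1 _ (by convert! h1 using 2; omega)

/-- If all powers of `J` are Cohen-Macaulay, then `J` has the same radical as an ideal generated by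
`dim R - dim R ⧸ J` elements. -/
theorem exists_radical_ofList_eq_of_isCohenMacaulayModule {J : Ideal R} (hJ : J ≠ ⊤)
    (hCM : ∀ n, 1 ≤ n → IsCohenMacaulayModule R (R ⧸ J ^ n)) {r e : ℕ}
    (hd : ringKrullDim R ≤ (r + e : ℕ)) (hr : ringKrullDim (R ⧸ J) = r) :
    ∃ gs : List R, gs.length = e ∧ (Ideal.ofList gs).radical = J.radical := by
  obtain ⟨ys, hlen, hys, hy1, hy2⟩ := exists_list_ringKrullDim_quotient_le J hd hr.le r le_rfl
  simp only [Nat.sub_self, Nat.zero_add, Nat.cast_zero] at hy1 hy2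
  set c := Ideal.ofList ys with hc
  have hcm : c ≤ maximalIdeal R := Ideal.span_le.mpr hys
  have hmax : ∀ p : Ideal R, p.IsPrime → c ≤ p → J ≤ p → p = maximalIdeal R :=
    fun p hp h1 h2 => eq_maximalIdeal_of_ringKrullDim_quotient_le_zero hy2 (sup_le h2 h1)
  obtain ⟨zs, hzlen, hzJ, hz⟩ := exists_list_mem_ringKrullDim_quotient_le J c hy1 hmax e le_rfl
  simp only [Nat.sub_self, Nat.cast_zero] at hz
  -- One choice of ys serves all n: J and J^n lie in the same primes, so ys is a system of
  -- parameters of every R/J^n.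
  have hreg : ∀ n, 1 ≤ n → IsWeaklyRegular (R ⧸ J ^ n) ys := by
    intro n hn
    have hne : J ^ n ≠ ⊤ := fun h => hJ (by
      rw [eq_top_iff, ← h]; exact Ideal.pow_le_self (by omega))
    have : Nontrivial (R ⧸ J ^ n) := Ideal.Quotient.nontrivial_iff.mpr hne
    by_cases hr0 : r = 0
    · rw [List.length_eq_zero_iff.mp (hlen.trans hr0)]
      exact .nil R _
    · obtain ⟨rs, hrs, hrsm, hrsr⟩ := (hCM n hn).exists_isRegular (r := r) (by
        rw [Module.supportDim_quotient_eq_ringKrullDim, ← hr]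
        exact ringKrullDim_quotient_eq_of_radical_eq (Ideal.radical_pow J (by omega))) hr0
      refine isWeaklyRegular_of_length_eq hrsm hrsr hys (hrs.trans hlen.symm) fun q hq h1 h2 => ?_
      rw [Ideal.annihilator_quotient] at h1
      exact hmax q hq (Ideal.span_le.mpr h2) (hq.le_of_pow_le h1)
  obtain ⟨s, hs⟩ := IsNoetherian.noetherian J
  have hJb : Ideal.span (Set.range (Subtype.val : s → R)) = J := by
    rw [Subtype.range_coe]; exact hs
  -- An element of c ∩ J^n lies in cJ^n ⊆ mJ^n by regularity. For n = 0, where R/J^n vanishes, c ⊆ m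
  -- suffices.
  have hc' : ∀ n, J ^ n ⊓ (J ^ (n + 1) ⊔ c) ≤ maximalIdeal R * J ^ n := by
    rintro n x ⟨hx1, hx2⟩
    obtain ⟨u, hu, v, hv, rfl⟩ := Submodule.mem_sup.mp hx2
    refine add_mem ?_ ?_
    · rw [pow_succ'] at hu
      exact Ideal.mul_mono_left (le_maximalIdeal hJ) hu
    · have hvJ : v ∈ J ^ n := by
        have : v = (u + v) - u := by ring
        rw [this]
        exact sub_mem hx1 (Ideal.pow_le_pow_right (Nat.le_succ n) hu)
      rcases Nat.eq_zero_or_pos n with rfl | hn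
      · simpa using hcm hv
      · exact Ideal.mul_mono_left hcm (ofList_inf_le_mul (J ^ n) ys (hreg n hn) ⟨hv, hvJ⟩)
  have hfin := length_quotient_ne_top (Ideal.ofList zs ⊔ c) fun p hp h =>
    eq_maximalIdeal_of_ringKrullDim_quotient_le_zero hz h
  obtain ⟨B, hB⟩ := ENat.ne_top_iff_exists.mp hfin
  have hgrowth : ∀ N : ℕ, Module.length R (R ⧸ (J ^ N ⊔ c)) ≤ (N ^ e * B : ℕ) := by
    intro N
    have h1 : Ideal.ofList (zs.map (· ^ N)) ≤ J ^ N := Ideal.span_le.mpr fun x hx => by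
      obtain ⟨z, hz, rfl⟩ := List.mem_map.mp hx
      exact Ideal.pow_mem_pow (hzJ z hz) N
    calc _ ≤ _ := length_quotient_mono (sup_le_sup_right h1 c)
      _ ≤ _ := length_quotient_ofList_pow_sup_le c zs N
      _ = _ := by rw [hzlen, ← hB]; push_cast; rfl
  have := exists_radical_ofList_eq (Subtype.val : s → R) (e := e)
    (chain_length_le _ c (by rwa [hJb]) (B := B) (by rwa [hJb]))
  rwa [hJb] at this

end AnalyticSpread

end

section

open IsLocalRing RingTheory.Sequence

universe u

/-! ### Catenarity from long regular sequences. -/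

section ChainsOfPrimes

variable {R : Type u} [CommRing R]

theorem ringKrullDim_quotient_eq_coheight (p : PrimeSpectrum R) :
    ringKrullDim (R ⧸ p.asIdeal) = Order.coheight p := by
  rw [ringKrullDim_quotient, Order.coheight_eq_krullDim_Ici]
  rfl

theorem height_add_ringKrullDim_quotient_le (p : Ideal R) [hp : p.IsPrime] :
    (p.height : WithBot ℕ∞) + ringKrullDim (R ⧸ p) ≤ ringKrullDim R := by
  have : Nonempty (PrimeSpectrum R) := ⟨⟨p, hp⟩⟩
  have h1 := ringKrullDim_quotient_eq_coheight ⟨p, hp⟩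
  have h2 := PrimeSpectrum.height_eq_orderHeight ⟨p, hp⟩
  dsimp only at h1 h2
  rw [h1, h2, ringKrullDim, Order.krullDim_eq_iSup_height_add_coheight_of_nonempty]
  exact_mod_cast le_iSup (fun a : PrimeSpectrum R => Order.height a + Order.coheight a) ⟨p, hp⟩

theorem length_le_height_of_isRegular [IsNoetherianRing R] {p : Ideal R} [p.IsPrime] {rs : List R}
    (h : IsRegular R rs) (hrs : ∀ r ∈ rs, r ∈ p) : (rs.length : ℕ∞) ≤ p.height := by
  have h1 := h.toIsWeaklyRegular.isRegular_of_isLocalization_of_mem (Localization.AtPrime p) p hrs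
  obtain ⟨q, hq⟩ := associatedPrimes.nonempty (Localization.AtPrime p) (Localization.AtPrime p)
  have h2 := length_le_ringKrullDim_quotient_of_mem_associatedPrimes (R := Localization.AtPrime p)
    (M := Localization.AtPrime p) (fun r hr => by
      obtain ⟨s, hs, rfl⟩ := List.mem_map.mp hr
      exact (IsLocalization.AtPrime.to_map_mem_maximal_iff _ p s).mpr (hrs s hs)) h1 hq
  have h3 := h2.trans (ringKrullDim_quotient_le q)
  rw [IsLocalization.AtPrime.ringKrullDim_eq_height p] at h3
  rw [List.length_map] at h3
  exact_mod_cast h3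

/-- Cohen-Macaulay local rings are catenary. -/
theorem ringKrullDim_quotient_le_length_add [IsNoetherianRing R] [IsLocalRing R] {rs : List R}
    (hrs : ∀ r ∈ rs, r ∈ maximalIdeal R) (h : IsRegular R rs)
    (hdim : ringKrullDim R ≤ rs.length) {p q : Ideal R} [hp : p.IsPrime] [hq : q.IsPrime]
    (hpq : p ≤ q) :
    ∃ l : LTSeries (PrimeSpectrum R), p ≤ l.head.asIdeal ∧ l.last.asIdeal ≤ q ∧
      ringKrullDim (R ⧸ p) ≤ l.length + ringKrullDim (R ⧸ q) := by
  have hann : ∀ (S : Type u) [CommRing S] (a : Ideal S), Module.annihilator S S ≤ a := by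
    intro S _ a
    rw [Module.annihilator_eq_bot.mpr inferInstance]
    exact bot_le
  -- A regular sequence in q has length at least dim R - dim R/q. Localized at q, it yields one in
  -- pR_q shorter by at most n = dim R_q/pR_q, whose length is at most ht p ≤ dim R - dim R/p. Hence
  -- dim R/p ≤ n + dim R/q, and a chain of length n in R_q/pR_q contracts to the required one.
  obtain ⟨ss, hss, hssr, hlen⟩ := exists_isRegular_mem_of_isPrime (M := R) q (hann R q) hrs h
  let S := Localization.AtPrime q
  have hS := hssr.toIsWeaklyRegular.isRegular_of_isLocalization_of_mem S q hss
  have hdis : Disjoint (q.primeCompl : Set R) (p : Set R) := by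
    rw [Set.disjoint_left]
    exact fun x hx hxp => hx (hpq hxp)
  let p' := p.map (algebraMap R S)
  have hp' : p'.IsPrime := IsLocalization.isPrime_of_isPrime_disjoint q.primeCompl S p hp hdis
  obtain ⟨us, hus, husr, hulen⟩ := exists_isRegular_mem_of_isPrime (M := S) p' (hann S p')
    (fun r hr => by
      obtain ⟨s, hs, rfl⟩ := List.mem_map.mp hr
      exact (IsLocalization.AtPrime.to_map_mem_maximal_iff _ q s).mpr (hss s hs)) hS
  have h1 : (us.length : ℕ∞) ≤ p.height := by
    rw [← IsLocalization.height_map_of_disjoint (S := S) q.primeCompl p hdis]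
    exact length_le_height_of_isRegular husr hus
  have h2 := height_add_ringKrullDim_quotient_le p
  obtain ⟨n, hn⟩ := exists_ringKrullDim_quotient_eq hp'.ne_top
  obtain ⟨a, ha⟩ := exists_ringKrullDim_quotient_eq hp.ne_top
  obtain ⟨c, hc⟩ := exists_ringKrullDim_quotient_eq hq.ne_top
  rw [ha] at h2
  rw [hn, List.length_map] at hulen
  rw [hc] at hlen
  have h3 : ((us.length : ℕ∞) : WithBot ℕ∞) + a ≤ rs.length :=
    (add_le_add_left (by exact_mod_cast h1) _).trans (h2.trans hdim)
  have h4 : us.length + a ≤ rs.length := by exact_mod_cast h3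
  have h5 : rs.length ≤ ss.length + c := by exact_mod_cast hlen
  have h6 : ss.length ≤ us.length + n := by exact_mod_cast hulen
  have hex : ∃ l : LTSeries (PrimeSpectrum S), p' ≤ l.head.asIdeal ∧ l.length = n := by
    have h7 := ringKrullDim_quotient_eq_coheight (⟨p', hp'⟩ : PrimeSpectrum S)
    dsimp only at h7
    rw [hn] at h7
    have h8 : ((n : ℕ) : ℕ∞) ≤ Order.coheight (⟨p', hp'⟩ : PrimeSpectrum S) := by
      have : (n : ℕ∞) = Order.coheight (⟨p', hp'⟩ : PrimeSpectrum S) := by exact_mod_cast h7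
      exact this.le
    obtain ⟨l, hl, hln⟩ := Order.exists_series_of_le_coheight _ h8
    exact ⟨l, by rw [hl], hln⟩
  obtain ⟨l, hl, hln⟩ := hex
  have hinj : StrictMono (PrimeSpectrum.comap (algebraMap R S)) := by
    refine Monotone.strictMono_of_injective (fun x y h => Ideal.comap_mono h) ?_
    exact PrimeSpectrum.localization_comap_injective S q.primeCompl
  refine ⟨l.map _ hinj, ?_, ?_, ?_⟩
  · exact Ideal.map_le_iff_le_comap.mp hl
  · intro x hx
    exact (IsLocalization.AtPrime.to_map_mem_maximal_iff S q x).mp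
      (le_maximalIdeal l.last.2.ne_top hx)
  · rw [LTSeries.map_length, hln, ha, hc]
    exact_mod_cast (by omega : a ≤ n + c)

theorem ringKrullDim_quotient_comap_of_surjective {S A : Type u} [CommRing S] [CommRing A]
    {f : S →+* A} (hf : Function.Surjective f) (P : Ideal A) :
    ringKrullDim (S ⧸ P.comap f) = ringKrullDim (A ⧸ P) := by
  have hs : Function.Surjective ((Ideal.Quotient.mk P).comp f) :=
    Ideal.Quotient.mk_surjective.comp hf
  have hk : RingHom.ker ((Ideal.Quotient.mk P).comp f) = P.comap f := by
    rw [← RingHom.comap_ker, Ideal.mk_ker]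
  rw [← hk]
  exact ringKrullDim_eq_of_ringEquiv (RingHom.quotientKerEquivOfSurjective hs)

/-- The dimension inequality in quotients of Cohen-Macaulay local rings. -/
theorem ringKrullDim_quotient_le_height_add_of_surjective {S A : Type u} [CommRing S] [CommRing A]
    [IsNoetherianRing S] [IsLocalRing S] {f : S →+* A} (hf : Function.Surjective f) {rs : List S}
    (hrs : ∀ r ∈ rs, r ∈ maximalIdeal S) (h : IsRegular S rs)
    (hdim : ringKrullDim S ≤ rs.length) {p q : Ideal A} [hp : p.IsPrime] [hq : q.IsPrime]
    (hpq : p ≤ q) : ringKrullDim (A ⧸ p) ≤ q.height + ringKrullDim (A ⧸ q) := by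
  obtain ⟨l, hl1, hl2, hl3⟩ := ringKrullDim_quotient_le_length_add hrs h hdim
    (p := p.comap f) (q := q.comap f) (Ideal.comap_mono hpq)
  rw [ringKrullDim_quotient_comap_of_surjective hf, ringKrullDim_quotient_comap_of_surjective hf]
    at hl3
  refine hl3.trans (add_le_add_left ?_ _)
  have hker : ∀ i, RingHom.ker f ≤ (l i).asIdeal := fun i =>
    (Ideal.ker_le_comap f).trans (hl1.trans (l.head_le i))
  have hcm : ∀ i, ((l i).asIdeal.map f).comap f = (l i).asIdeal := fun i => by
    rw [Ideal.comap_map_of_surjective f hf, ← RingHom.ker_eq_comap_bot, sup_eq_left.mpr (hker i)]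
  let l' : LTSeries (PrimeSpectrum A) := ⟨l.length, fun i =>
    ⟨(l i).asIdeal.map f, Ideal.map_isPrime_of_surjective hf (hker i)⟩, fun i => by
      have h1 : l i.castSucc < l i.succ := l.step i
      refine lt_of_le_of_ne (Ideal.map_mono (f := f) h1.le) fun h => h1.ne ?_
      have h2 := congrArg (Ideal.comap f) h
      exact PrimeSpectrum.ext ((hcm _).symm.trans (h2.trans (hcm _)))⟩
  have h2 : (l'.length : ℕ∞) ≤ Order.height (⟨q, hq⟩ : PrimeSpectrum A) := by
    refine Order.length_le_height (p := l') ?_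
    show (l.last.asIdeal.map f) ≤ q
    exact Ideal.map_le_iff_le_comap.mpr hl2
  rw [← PrimeSpectrum.height_eq_orderHeight] at h2
  exact_mod_cast h2

end ChainsOfPrimes

end

section

open IsLocalRing RingTheory.Sequence

universe u

/-! ### Descent of the dimension formula along a flat local map. -/

section FlatTransfer

variable {R A : Type u} [CommRing R] [IsLocalRing R] [IsNoetherianRing R]
  [CommRing A] [IsLocalRing A] [IsNoetherianRing A] [Algebra R A]

/-- The image of a system of parameters of R/p cuts A/pA down to its closed point, since the maximal
ideal of A is extended from R. -/
theorem ringKrullDim_quotient_map_le (hmax : maximalIdeal A = (maximalIdeal R).map (algebraMap R A))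
    (p : Ideal R) [hp : p.IsPrime] :
    ringKrullDim (A ⧸ p.map (algebraMap R A)) ≤ ringKrullDim (R ⧸ p) := by
  obtain ⟨n, hn⟩ := exists_ringKrullDim_quotient_eq hp.ne_top
  obtain ⟨ys, hlen, hys, hdim⟩ := exists_list_mem_ringKrullDim_quotient_le (maximalIdeal R) p hn.le
    (fun q hq _ h => le_antisymm (le_maximalIdeal hq.ne_top) h) n le_rfl
  rw [Nat.sub_self, Nat.cast_zero] at hdim
  rw [hn]
  have h1 := ringKrullDim_quotient_le_length (p.map (algebraMap R A)) (ys.map (algebraMap R A))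
    (fun y hy => by
      obtain ⟨x, hx, rfl⟩ := List.mem_map.mp hy
      rw [hmax]
      exact Ideal.mem_map_of_mem _ (hys x hx)) fun q hq hle hmem => by
    have h2 : q.comap (algebraMap R A) = maximalIdeal R := by
      refine eq_maximalIdeal_of_ringKrullDim_quotient_le_zero hdim (sup_le ?_ ?_)
      · exact Ideal.span_le.mpr fun y hy => hmem _ (List.mem_map_of_mem hy)
      · exact Ideal.map_le_iff_le_comap.mp hle
    refine le_antisymm (le_maximalIdeal hq.ne_top) ?_
    rw [hmax, ← h2]
    exact Ideal.map_comap_le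
  rwa [List.length_map, hlen] at h1

variable [Module.Flat R A]

theorem ringKrullDim_le_of_flat (hmax : maximalIdeal A = (maximalIdeal R).map (algebraMap R A)) :
    ringKrullDim R ≤ ringKrullDim A := by
  have h0 : (maximalIdeal A).LiesOver (maximalIdeal R) := ⟨by
    refine (eq_maximalIdeal_of_ringKrullDim_quotient_le_zero (a := maximalIdeal R) ?_ ?_).symm
    · let _ := Ideal.Quotient.field (maximalIdeal R)
      exact (ringKrullDim_eq_zero_of_field (R ⧸ maximalIdeal R)).le
    · rw [hmax]; exact Ideal.le_comap_map⟩
  have h1 := Ideal.height_eq_height_add_of_liesOver_of_hasGoingDown (maximalIdeal R)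
    (maximalIdeal A)
  rw [← maximalIdeal_height_eq_ringKrullDim, ← maximalIdeal_height_eq_ringKrullDim, h1]
  exact_mod_cast le_self_add

/-- A local ring whose completion is equidimensional and catenary satisfies the dimension
formula. -/
theorem ringKrullDim_le_height_add_of_flat
    (hmax : maximalIdeal A = (maximalIdeal R).map (algebraMap R A))
    (hequi : ∀ P ∈ minimalPrimes A, ringKrullDim (A ⧸ P) = ringKrullDim A)
    (hcat : ∀ P Q : Ideal A, P.IsPrime → Q.IsPrime → P ≤ Q →
      ringKrullDim (A ⧸ P) ≤ Q.height + ringKrullDim (A ⧸ Q))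
    (p : Ideal R) [hp : p.IsPrime] : ringKrullDim R ≤ p.height + ringKrullDim (R ⧸ p) := by
  have hne : p.map (algebraMap R A) ≠ ⊤ := ne_top_of_le_ne_top (maximalIdeal.isMaximal A).ne_top
    (by rw [hmax]; exact Ideal.map_mono (le_maximalIdeal hp.ne_top))
  obtain ⟨Q, hQ⟩ := Ideal.nonempty_minimalPrimes hne
  have hQp : Q.IsPrime := hQ.1.1
  -- Going down gives a prime Q' ≤ Q over p; it contains pA, so Q' = Q by minimality. The fiber then
  -- adds nothing to the height of Q.
  have hlies : Q.LiesOver p := by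
    have hover : Q.LiesOver (Q.under R) := inferInstance
    have hle : p ≤ Q.under R := Ideal.map_le_iff_le_comap.mp hQ.1.2
    obtain ⟨Q', hQ', hQ'p, hQ'o⟩ := Ideal.exists_ideal_le_liesOver_of_le Q hle
    have h1 : Q ≤ Q' := hQ.2 ⟨hQ'p, Ideal.map_le_iff_le_comap.mpr hQ'o.over.le⟩ hQ'
    rwa [le_antisymm h1 hQ']
  have hht : Q.height = p.height := by
    rw [Ideal.height_eq_height_add_of_liesOver_of_hasGoingDown p Q]
    have h1 : (Q.map (Ideal.Quotient.mk (p.map (algebraMap R A)))).IsPrime :=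
      Ideal.map_isPrime_of_surjective Ideal.Quotient.mk_surjective (by
        rw [Ideal.mk_ker]; exact hQ.1.2)
    have h2 : Q.map (Ideal.Quotient.mk (p.map (algebraMap R A))) ∈
        minimalPrimes (A ⧸ p.map (algebraMap R A)) := by
      refine ⟨⟨h1, bot_le⟩, fun P hP hle => ?_⟩
      have hPp : P.IsPrime := hP.1
      have h3 : p.map (algebraMap R A) ≤ P.comap (Ideal.Quotient.mk _) := fun x hx => by
        rw [Ideal.mem_comap, Ideal.Quotient.eq_zero_iff_mem.mpr hx]
        exact zero_mem _
      have h4 := Ideal.comap_mono (f := Ideal.Quotient.mk (p.map (algebraMap R A))) hle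
      rw [Ideal.comap_map_of_surjective _ Ideal.Quotient.mk_surjective,
        ← RingHom.ker_eq_comap_bot, Ideal.mk_ker, sup_eq_left.mpr hQ.1.2] at h4
      exact Ideal.map_le_iff_le_comap.mpr (hQ.2 ⟨inferInstance, h3⟩ h4)
    rw [Ideal.height_eq_zero_iff.mpr h2, add_zero]
  obtain ⟨P, hP, hPQ⟩ := Ideal.exists_minimalPrimes_le (bot_le (a := Q))
  calc ringKrullDim R ≤ ringKrullDim A := ringKrullDim_le_of_flat hmax
    _ = ringKrullDim (A ⧸ P) := (hequi P hP).symm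
    _ ≤ Q.height + ringKrullDim (A ⧸ Q) := hcat P Q hP.1.1 hQp hPQ
    _ ≤ p.height + ringKrullDim (R ⧸ p) := by
      rw [hht]
      exact add_le_add_right ((ringKrullDim_quotient_mono hQ.1.2).trans
        (ringKrullDim_quotient_map_le hmax p)) _

end FlatTransfer

end

section

open IsLocalRing RingTheory.Sequence Pointwise

universe u

/-! ### Power series rings mapping onto complete local rings. -/

section PowerSeriesSurjection

variable {V A : Type*} [CommRing V] [CommRing A]

open MvPolynomial in
/-- Complete rings receive maps from power series rings. -/
theorem exists_ringHom_mvPowerSeries {n : ℕ} (φ : V →+* A) (x : Fin n → A)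
    [IsAdicComplete (Ideal.span (Set.range x)) A] :
    ∃ F : MvPowerSeries (Fin n) V →+* A, (∀ v, F (MvPowerSeries.C v) = φ v) ∧
      ∀ i, F (MvPowerSeries.X i) = x i := by
  set m := Ideal.span (Set.range x) with hm
  set I := idealOfVars (Fin n) V with hI
  have hle : ∀ k, I ^ k ≤ (m ^ k).comap (eval₂Hom φ x) := fun k => by
    rw [← Ideal.map_le_iff_le_comap, Ideal.map_pow, hI, idealOfVars, Ideal.map_span,
      ← Set.range_comp]
    refine Ideal.pow_right_mono (Ideal.span_mono ?_) k
    rintro _ ⟨i, rfl⟩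
    exact ⟨i, by simp⟩
  -- The power series ring is the completion of the polynomial ring at the ideal of the variables,
  -- so polynomial evaluation modulo m^k extends to it. Compatibility in k then gives a map to A.
  let f : ∀ k, MvPowerSeries (Fin n) V →+* A ⧸ m ^ k := fun k =>
    ((Ideal.quotientMap (m ^ k) (eval₂Hom φ x) (hle k)).comp
      (AdicCompletion.evalₐ I k).toRingHom).comp
      (MvPowerSeries.toAdicCompletionAlgEquiv (Fin n) V).toRingEquiv.toRingHom
  have hf : ∀ {a b : ℕ} (hab : a ≤ b), (Ideal.Quotient.factorPow m hab).comp (f b) = f a := by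
    intro a b hab
    ext p
    simp only [f, RingHom.comp_apply]
    obtain ⟨c, hc⟩ := AdicCompletion.mk_surjective I _
      (MvPowerSeries.toAdicCompletionAlgEquiv (Fin n) V p)
    change Ideal.Quotient.factorPow m hab (Ideal.quotientMap (m ^ b) (eval₂Hom φ x) (hle b)
      (AdicCompletion.evalₐ I b (MvPowerSeries.toAdicCompletionAlgEquiv (Fin n) V p))) =
      Ideal.quotientMap (m ^ a) (eval₂Hom φ x) (hle a)
      (AdicCompletion.evalₐ I a (MvPowerSeries.toAdicCompletionAlgEquiv (Fin n) V p))
    rw [← hc, AdicCompletion.evalₐ_mk, AdicCompletion.evalₐ_mk]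
    have hca : Ideal.Quotient.mk (I ^ a) (c.val b) = Ideal.Quotient.mk (I ^ a) (c.val a) :=
      AdicCompletion.Ideal.mk_eq_mk I hab c
    rw [← hca, Ideal.quotientMap_mk, Ideal.quotientMap_mk]
    rfl
  have hpoly : ∀ p : MvPolynomial (Fin n) V,
      IsAdicComplete.liftRingHom m f hf (p : MvPowerSeries (Fin n) V) = eval₂Hom φ x p := by
    intro p
    refine (IsHausdorff.eq_iff_smodEq (I := m)).mpr fun k => ?_
    rw [SModEq, smul_eq_mul, Ideal.mul_top]
    refine (IsAdicComplete.mk_liftRingHom m f hf k _).trans ?_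
    change Ideal.quotientMap (m ^ k) (eval₂Hom φ x) (hle k)
      (AdicCompletion.evalₐ I k (MvPowerSeries.toAdicCompletionAlgEquiv (Fin n) V p)) = _
    rw [MvPowerSeries.toAdicCompletionAlgEquiv_apply, MvPowerSeries.toAdicCompletion_coe,
      AdicCompletion.evalₐ_of, Ideal.quotientMap_mk]
    rfl
  refine ⟨IsAdicComplete.liftRingHom m f hf, fun v => ?_, fun i => ?_⟩
  · rw [← MvPolynomial.coe_C, hpoly]; simp
  · rw [← MvPolynomial.coe_X, hpoly]; simp

/-- Send the variables to generators of the maximal ideal. Modulo the variables surjectivity is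
`hφ`, and it lifts by completeness of the power series ring and separatedness of A. -/
theorem exists_surjective_mvPowerSeries [IsLocalRing A] [IsAdicComplete (maximalIdeal A) A]
    (hfg : (maximalIdeal A).FG) (φ : V →+* A)
    (hφ : ∀ a : A, ∃ v, a - φ v ∈ maximalIdeal A) :
    ∃ (n : ℕ) (F : MvPowerSeries (Fin n) V →+* A), Function.Surjective F := by
  obtain ⟨n, x, hx⟩ := Submodule.fg_iff_exists_fin_generating_family.mp hfg
  have hx' : Ideal.span (Set.range x) = maximalIdeal A := hx
  have : IsAdicComplete (Ideal.span (Set.range x)) A := by rw [hx']; infer_instance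
  obtain ⟨F, hF1, hF2⟩ := exists_ringHom_mvPowerSeries φ x
  refine ⟨n, F, ?_⟩
  have hmap : (Ideal.span (Set.range MvPowerSeries.X)).map F = maximalIdeal A := by
    rw [Ideal.map_span, ← Set.range_comp, ← hx']
    congr 2
    funext i
    exact hF2 i
  have : IsHausdorff ((Ideal.span (Set.range MvPowerSeries.X)).map F) A := by
    rw [hmap]; infer_instance
  refine surjective_of_mk_map_comp_surjective (I := Ideal.span (Set.range MvPowerSeries.X)) F ?_
  intro y
  obtain ⟨a, rfl⟩ := Ideal.Quotient.mk_surjective y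
  obtain ⟨v, hv⟩ := hφ a
  refine ⟨MvPowerSeries.C v, ?_⟩
  rw [RingHom.comp_apply, hF1]
  refine (Ideal.Quotient.eq.mpr ?_).symm
  rwa [hmap]

end PowerSeriesSurjection

/-! ### Regular parameters in power series rings. -/

section RegularParameters

/-- A local ring with a regular sequence that is a system of parameters. -/
def HasRegularParameters (S : Type*) [CommRing S] [IsLocalRing S] : Prop :=
  ∃ rs : List S, (∀ r ∈ rs, r ∈ maximalIdeal S) ∧ IsWeaklyRegular S rs ∧
    ∀ q : Ideal S, q.IsPrime → (∀ r ∈ rs, r ∈ q) → q = maximalIdeal S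

theorem HasRegularParameters.of_ringEquiv {S T : Type*} [CommRing S] [IsLocalRing S] [CommRing T]
    [IsLocalRing T] (e : S ≃+* T) (h : HasRegularParameters S) : HasRegularParameters T := by
  obtain ⟨rs, hrs, hreg, hmax⟩ := h
  have hm : ∀ s : S, s ∈ maximalIdeal S ↔ e s ∈ maximalIdeal T := fun s => by
    rw [mem_maximalIdeal, mem_maximalIdeal, mem_nonunits_iff, mem_nonunits_iff,
      MulEquiv.isUnit_map]
  refine ⟨rs.map e, fun r hr => ?_, ?_, fun q hq hmem => ?_⟩
  · obtain ⟨s, hs, rfl⟩ := List.mem_map.mp hr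
    exact (hm s).mp (hrs s hs)
  · refine (AddEquiv.isWeaklyRegular_congr (e := e.toAddEquiv) ?_).mp hreg
    refine List.forall₂_map_right_iff.mpr (List.forall₂_same.mpr fun r _ x => ?_)
    simp
  · have h1 := hmax (q.comap (e : S →+* T)) inferInstance
      fun r hr => hmem _ (List.mem_map_of_mem hr)
    ext t
    obtain ⟨s, rfl⟩ := e.surjective t
    rw [← hm, ← h1, Ideal.mem_comap]
    rfl

theorem isWeaklyRegular_X_cons {V : Type*} [CommRing V] {rs : List V} (h : IsWeaklyRegular V rs) :
    IsWeaklyRegular (PowerSeries V) (PowerSeries.X :: rs.map PowerSeries.C) := by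
  rw [isWeaklyRegular_cons_iff]
  refine ⟨fun a b hab => PowerSeries.X_mul_cancel hab, ?_⟩
  -- V becomes a module over its power series ring through the constant coefficient, so that it is
  -- the quotient by X and constant series act on it as elements of V.
  let _ : Module (PowerSeries V) V := Module.compHom V (PowerSeries.constantCoeff (R := V))
  have hsmul : ∀ (f : PowerSeries V) (v : V), f • v = PowerSeries.constantCoeff f * v :=
    fun _ _ => rfl
  let π : PowerSeries V →ₗ[PowerSeries V] V :=
    { toFun := fun f => PowerSeries.constantCoeff f
      map_add' := fun f g => map_add _ f g
      map_smul' := fun f g => by rw [RingHom.id_apply, hsmul, smul_eq_mul, map_mul] }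
  have hπ : Function.Surjective π := fun v => ⟨PowerSeries.C v, by simp [π]⟩
  have hker : (PowerSeries.X (R := V)) • (⊤ : Submodule (PowerSeries V) (PowerSeries V)) =
      LinearMap.ker π := by
    ext f
    rw [Submodule.mem_smul_pointwise_iff_exists, LinearMap.mem_ker]
    change _ ↔ PowerSeries.constantCoeff f = 0
    rw [← PowerSeries.X_dvd_iff]
    constructor
    · rintro ⟨g, -, rfl⟩
      exact ⟨g, rfl⟩
    · rintro ⟨g, rfl⟩
      exact ⟨g, trivial, rfl⟩
  let e : QuotSMulTop (PowerSeries.X (R := V)) (PowerSeries V) ≃ₗ[PowerSeries V] V :=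
    (Submodule.quotEquivOfEq _ _ hker).trans (π.quotKerEquivOfSurjective hπ)
  refine (AddEquiv.isWeaklyRegular_congr (e := e.toAddEquiv) (bs := rs) ?_).mpr h
  refine List.forall₂_map_left_iff.mpr (List.forall₂_same.mpr fun r _ x => ?_)
  change e (PowerSeries.C r • x) = r • e x
  rw [map_smul, hsmul, PowerSeries.constantCoeff_C, smul_eq_mul]

theorem HasRegularParameters.powerSeries {V : Type*} [CommRing V] [IsLocalRing V]
    (h : HasRegularParameters V) : HasRegularParameters (PowerSeries V) := by
  obtain ⟨rs, hrs, hreg, hmax⟩ := h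
  have hm : ∀ f : PowerSeries V, f ∈ maximalIdeal (PowerSeries V) ↔
      PowerSeries.constantCoeff f ∈ maximalIdeal V := fun f => by
    rw [mem_maximalIdeal, mem_maximalIdeal, mem_nonunits_iff, mem_nonunits_iff,
      PowerSeries.isUnit_iff_constantCoeff]
  refine ⟨PowerSeries.X :: rs.map PowerSeries.C, ?_, isWeaklyRegular_X_cons hreg, ?_⟩
  · intro r hr
    rcases List.mem_cons.mp hr with rfl | hr
    · rw [hm]; simp
    · obtain ⟨s, hs, rfl⟩ := List.mem_map.mp hr
      rw [hm]; simpa using hrs s hs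
  · intro q hq hmem
    have h1 := hmax (q.comap (PowerSeries.C (R := V))) inferInstance fun r hr =>
      hmem _ (List.mem_cons_of_mem _ (List.mem_map_of_mem hr))
    refine le_antisymm (le_maximalIdeal hq.ne_top) fun f hf => ?_
    rw [hm, ← h1, Ideal.mem_comap] at hf
    have h2 : PowerSeries.X ∣ f - PowerSeries.C (PowerSeries.constantCoeff f) := by
      rw [PowerSeries.X_dvd_iff]; simp
    have h3 := Ideal.mem_of_dvd q h2 (hmem _ (by simp))
    have := add_mem h3 hf
    rwa [sub_add_cancel] at this

theorem HasRegularParameters.mvPowerSeries {V : Type*} [CommRing V] [IsLocalRing V]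
    (h : HasRegularParameters V) (n : ℕ) : HasRegularParameters (MvPowerSeries (Fin n) V) := by
  induction n with
  | zero => exact h.of_ringEquiv (MvPowerSeries.isEmptyEquiv (Fin 0) V).toRingEquiv.symm
  | succ n ih =>
    exact ih.powerSeries.of_ringEquiv (MvPowerSeries.finSuccEquiv V n).toRingEquiv.symm

/-- The dimension inequality for quotients of power series rings. -/
theorem ringKrullDim_quotient_le_height_add_of_coefficientRing {V A : Type u} [CommRing V]
    [IsLocalRing V] [IsNoetherianRing V] (hV : HasRegularParameters V) [CommRing A] [IsLocalRing A]
    [IsAdicComplete (maximalIdeal A) A] (hfg : (maximalIdeal A).FG) (φ : V →+* A)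
    (hφ : ∀ a : A, ∃ v, a - φ v ∈ maximalIdeal A) :
    IsNoetherianRing A ∧ ∀ P Q : Ideal A, P.IsPrime → Q.IsPrime → P ≤ Q →
      ringKrullDim (A ⧸ P) ≤ Q.height + ringKrullDim (A ⧸ Q) := by
  obtain ⟨n, F, hF⟩ := exists_surjective_mvPowerSeries hfg φ hφ
  refine ⟨isNoetherianRing_of_surjective _ _ F hF, fun P Q hP hQ hPQ => ?_⟩
  obtain ⟨rs, hrs, hreg, hmax⟩ := hV.mvPowerSeries n
  refine ringKrullDim_quotient_le_height_add_of_surjective hF hrs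
    ((isRegular_iff_isWeaklyRegular_of_subset_maximalIdeal hrs).mpr hreg) ?_ hPQ
  have h1 := ringKrullDim_quotient_le_length ⊥ rs hrs fun q hq _ hmem => hmax q hq hmem
  rwa [ringKrullDim_eq_of_ringEquiv (RingEquiv.quotientBot _)] at h1

end RegularParameters

end

section

open IsLocalRing RingTheory.Sequence

/-! ### Coefficient fields in residue characteristic zero. -/

section EqualCharacteristicZero

theorem hasRegularParameters_of_field (k : Type*) [Field k] : HasRegularParameters k := by
  refine ⟨[], by simp, .nil k k, fun q hq _ => ?_⟩
  rw [Ideal.eq_bot_of_prime q, Ideal.eq_bot_of_prime (maximalIdeal k)]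

theorem formallySmooth_rat (k : Type*) [Field k] [Algebra ℚ k] : Algebra.FormallySmooth ℚ k := by
  obtain ⟨s, hs⟩ := exists_isTranscendenceBasis ℚ k
  have : Algebra.IsAlgebraic (IntermediateField.adjoin ℚ (Set.range (Subtype.val : s → k))) k :=
    hs.isAlgebraic_field
  have : CharZero k := algebraRat.charZero k
  exact Algebra.FormallySmooth.of_algebraicIndependent_of_isSeparable hs.1

/-- Here A contains ℚ and the residue field is formally smooth over ℚ, so its identity map lifts
along the complete ring A to a section of A → A/m. -/
theorem exists_coefficientRing_of_charZero.{u} (A : Type u) [CommRing A] [IsLocalRing A]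
    [IsAdicComplete (maximalIdeal A) A] [hk : CharZero (A ⧸ maximalIdeal A)] :
    ∃ (V : Type u) (_ : CommRing V) (_ : IsLocalRing V) (_ : IsNoetherianRing V) (φ : V →+* A),
      HasRegularParameters V ∧ ∀ a, ∃ v, a - φ v ∈ maximalIdeal A := by
  obtain ⟨hA⟩ := (EqualCharZero.nonempty_algebraRat_iff A).mpr fun I hI => by
    refine ⟨fun a b hab => Nat.cast_injective (R := A ⧸ maximalIdeal A) ?_⟩
    have := congrArg (Ideal.Quotient.factor (le_maximalIdeal hI)) hab
    simpa using this
  let _ := Ideal.Quotient.field (maximalIdeal A)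
  let _ : Algebra ℚ (A ⧸ maximalIdeal A) := Ideal.instAlgebraQuotient ℚ (maximalIdeal A)
  have := formallySmooth_rat (A ⧸ maximalIdeal A)
  obtain ⟨g, hg⟩ := Algebra.FormallySmooth.exists_mkₐ_comp_eq_of_isAdicComplete
    (AlgHom.id ℚ (A ⧸ maximalIdeal A))
  refine ⟨A ⧸ maximalIdeal A, inferInstance, inferInstance, inferInstance, g.toRingHom,
    hasRegularParameters_of_field _, fun a => ⟨Ideal.Quotient.mk _ a, ?_⟩⟩
  rw [← Ideal.Quotient.eq]
  exact (DFunLike.congr_fun hg (Ideal.Quotient.mk _ a)).symm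

end EqualCharacteristicZero

end

section

/-! ### Base p expansion of exponents. -/

section DigitExpansion

open MvPolynomial

variable {k ι : Type*}

/-- The quotients by `p` of an exponent. -/
noncomputable def exponentDiv (p : ℕ) (e : ι →₀ ℕ) : ι →₀ ℕ := e.mapRange (· / p) (Nat.zero_div p)

/-- The last digits in base `p` of an exponent. -/
noncomputable def exponentMod (p : ℕ) (e : ι →₀ ℕ) : ι →₀ ℕ := e.mapRange (· % p) (Nat.zero_mod p)

@[simp]
theorem exponentDiv_apply (p : ℕ) (e : ι →₀ ℕ) (i : ι) : exponentDiv p e i = e i / p := rfl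

@[simp]
theorem exponentMod_apply (p : ℕ) (e : ι →₀ ℕ) (i : ι) : exponentMod p e i = e i % p := rfl

theorem exponentMod_add_smul_exponentDiv (p : ℕ) (e : ι →₀ ℕ) :
    exponentMod p e + p • exponentDiv p e = e := by
  ext i
  simpa using Nat.mod_add_div (e i) p

theorem prod_pow_eq_of_digits {S : Type*} [CommSemiring S] (b : ι → S) (p : ℕ) (e : ι →₀ ℕ) :
    (e.prod fun i n => b i ^ n) = ((exponentMod p e).prod fun i n => b i ^ n) *
      ((exponentDiv p e).prod fun i n => b i ^ n) ^ p := by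
  have h1 : ∀ d : ι →₀ ℕ, (d.prod fun i n => b i ^ n) =
      eval₂Hom (RingHom.id S) b (monomial d 1) := fun d => by
    rw [coe_eval₂Hom, eval₂_monomial, map_one, one_mul]
  conv_lhs => rw [← exponentMod_add_smul_exponentDiv p e]
  rw [h1, h1, h1, ← map_pow, ← map_mul, monomial_pow, monomial_mul]
  simp

variable [Field k] {p : ℕ} [Fact p.Prime] [CharP k p]

/-- A family that is independent over `k ^ p` is independent over all `k ^ (p ^ n)`. -/
theorem eq_zero_of_eval₂_iterateFrobenius_eq_zero {b : ι → k}
    (hb : ∀ P : MvPolynomial ι k, (∀ e ∈ P.support, ∀ i, e i < p) →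
      eval₂ (frobenius k p) b P = 0 → P = 0) (n : ℕ) :
    ∀ P : MvPolynomial ι k, (∀ e ∈ P.support, ∀ i, e i < p ^ n) →
      eval₂ (iterateFrobenius k p n) b P = 0 → P = 0 := by
  classical
  have hp : p.Prime := Fact.out
  induction n with
  | zero =>
    intro P hP h
    have h1 : ∀ e ∈ P.support, e = 0 := fun e he => by
      ext i
      have := hP e he i
      simpa using this
    obtain ⟨c, rfl⟩ : ∃ c, P = C c := ⟨coeff 0 P, by
      ext e
      rw [coeff_C]
      split_ifs with h0
      · rw [← h0]
      · by_contra hne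
        exact h0 (h1 e (mem_support_iff.mpr hne)).symm⟩
    simpa using h
  | succ n ih =>
    intro P hP h
    -- P is regrouped by the last base p digits of its exponents. The inner polynomials are
    -- evaluated over p^n-th powers and the result is raised to the p-th power, so independence over
    -- k^p kills the inner values and the induction kills the inner polynomials.
    let D : MvPolynomial ι (MvPolynomial ι k) :=
      ∑ e ∈ P.support, monomial (exponentMod p e) (monomial (exponentDiv p e) (coeff e P))
    let ψ := eval₂Hom (iterateFrobenius k p n) b
    have hcoeff : ∀ d, coeff d D =
        ∑ e ∈ P.support with exponentMod p e = d, monomial (exponentDiv p e) (coeff e P) := by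
      intro d
      rw [coeff_sum, Finset.sum_filter]
      exact Finset.sum_congr rfl fun e _ => coeff_monomial _ _ _
    have heval : eval₂ (frobenius k p) b (map ψ D) = 0 := by
      rw [← h, eval₂_eq (iterateFrobenius k p (n + 1)), map_sum, eval₂_sum]
      refine Finset.sum_congr rfl fun e _ => ?_
      rw [map_monomial, eval₂_monomial, coe_eval₂Hom, eval₂_monomial, map_mul, frobenius_def,
        frobenius_def, iterateFrobenius_def, iterateFrobenius_def, ← pow_mul, ← pow_succ]
      have := prod_pow_eq_of_digits b p e
      rw [Finsupp.prod] at this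
      rw [this]
      ring
    have hD : map ψ D = 0 := by
      refine hb _ (fun d hd i => ?_) heval
      rw [mem_support_iff, coeff_map, hcoeff] at hd
      obtain ⟨e, he, -⟩ := Finset.exists_ne_zero_of_sum_ne_zero (fun h0 => hd (by rw [h0, map_zero]))
      rw [← (Finset.mem_filter.mp he).2]
      exact Nat.mod_lt _ hp.pos
    have hzero : ∀ d, coeff d D = 0 := by
      intro d
      refine ih _ (fun e' he' i => ?_) ?_
      · rw [hcoeff, mem_support_iff, coeff_sum] at he'
        obtain ⟨e, he, hne⟩ := Finset.exists_ne_zero_of_sum_ne_zero he'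
        rw [coeff_monomial] at hne
        have h1 : exponentDiv p e = e' := by
          by_contra h0
          rw [if_neg h0] at hne
          exact hne rfl
        rw [← h1, exponentDiv_apply, Nat.div_lt_iff_lt_mul hp.pos, ← pow_succ]
        exact hP e (Finset.mem_filter.mp he).1 i
      · have := congrArg (coeff d) hD
        rwa [coeff_map, coeff_zero] at this
    ext e
    rw [coeff_zero]
    by_contra hne
    have h1 := congrArg (coeff (exponentDiv p e)) (hzero (exponentMod p e))
    rw [hcoeff, coeff_sum, coeff_zero, Finset.sum_eq_single_of_mem e] at h1
    · rw [coeff_monomial, if_pos rfl] at h1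
      exact hne h1
    · exact Finset.mem_filter.mpr ⟨mem_support_iff.mpr hne, rfl⟩
    · intro e' he' hne'
      rw [coeff_monomial, if_neg]
      intro h2
      refine hne' ?_
      rw [← exponentMod_add_smul_exponentDiv p e', (Finset.mem_filter.mp he').2, h2,
        exponentMod_add_smul_exponentDiv]

end DigitExpansion

/-! ### Existence of p-bases. -/

section PBasis

open MvPolynomial

variable {k : Type*} [Field k] {p : ℕ} [Fact p.Prime]

/-- A subring containing all `p`-th powers is closed under inverses. -/
theorem inv_mem_of_frobenius_mem {L : Subring k} (hL : ∀ x, x ^ p ∈ L) {x : k} (hx : x ∈ L) :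
    x⁻¹ ∈ L := by
  have hp : p.Prime := Fact.out
  rcases eq_or_ne x 0 with rfl | hx0
  · simp
  · have : x⁻¹ = x ^ (p - 1) * (x⁻¹) ^ p := by
      conv_rhs => rw [← Nat.sub_add_cancel hp.one_le, Nat.add_sub_cancel]
      rw [pow_succ, ← mul_assoc, ← mul_pow, mul_inv_cancel₀ hx0, one_pow, one_mul]
    rw [this]
    exact mul_mem (pow_mem hx _) (hL _)

variable [CharP k p]

/-- L is a field containing all p-th powers. As a ∉ L, the element a^p has no p-th root in L, so X^p
- a^p is the minimal polynomial of a and no nonzero polynomial of smaller degree kills a. -/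
theorem polynomial_eq_zero_of_frobenius_mem {L : Subring k} (hL : ∀ x, x ^ p ∈ L) {a : k}
    (ha : a ∉ L) {Q : Polynomial k} (hQ : ∀ n, Q.coeff n ∈ L) (hdeg : Q.degree < p)
    (h : Q.eval a = 0) : Q = 0 := by
  have hp : p.Prime := Fact.out
  let F : Subfield k := { L with inv_mem' := fun x hx => inv_mem_of_frobenius_mem hL hx }
  have hirr : Irreducible (Polynomial.X ^ p - Polynomial.C (⟨a ^ p, hL a⟩ : F)) := by
    refine X_pow_sub_C_irreducible_of_prime hp fun b hb => ha ?_
    have h1 : (b : k) ^ p = a ^ p := congrArg Subtype.val hb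
    have h2 : (b : k) = a := frobenius_inj k p h1
    rw [← h2]
    exact b.2
  have hmin : Polynomial.X ^ p - Polynomial.C (⟨a ^ p, hL a⟩ : F) = minpoly F a :=
    minpoly.eq_of_irreducible_of_monic hirr (by
      have : algebraMap F k ⟨a ^ p, hL a⟩ = a ^ p := rfl
      simp [this]) (Polynomial.monic_X_pow_sub_C _ hp.ne_zero)
  have hco : (Q.coeffs : Set k) ⊆ F.toSubring := fun c hc => by
    obtain ⟨n, -, rfl⟩ := Polynomial.mem_coeffs_iff.mp hc
    exact hQ n
  have hmap : (Q.toSubring F.toSubring hco).map (algebraMap F k) = Q := by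
    ext n
    rw [Polynomial.coeff_map]
    exact Polynomial.coeff_toSubring Q F.toSubring hco
  by_contra hne
  have hne' : Q.toSubring F.toSubring hco ≠ 0 := fun h0 => hne (by
    rw [← hmap]
    exact (congrArg _ h0).trans (Polynomial.map_zero _))
  have h2 := minpoly.degree_le_of_ne_zero F a (p := Q.toSubring F.toSubring hco) hne' (by
    rw [Polynomial.aeval_def, ← Polynomial.eval_map, hmap, h])
  rw [← hmin, Polynomial.degree_X_pow_sub_C hp.pos] at h2
  have h3 := Polynomial.degree_toSubring Q F.toSubring hco
  exact absurd hdeg (not_lt.mpr (h2.trans h3.le))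

/-- Induction on the variables in use, removing the largest, a: P becomes a polynomial in a of
degree below p whose coefficients lie in the subring generated by k^p and smaller elements, which
misses a. -/
theorem eq_zero_of_eval₂_frobenius_eq_zero [LinearOrder k] {s : Set k}
    (hs : ∀ a ∈ s, a ∉ Subring.closure (Set.range (frobenius k p) ∪ Set.Iio a)) (F : Finset s) :
    ∀ P : MvPolynomial s k, (∀ e ∈ P.support, e.support ⊆ F) → (∀ e ∈ P.support, ∀ i, e i < p) →
      eval₂ (frobenius k p) Subtype.val P = 0 → P = 0 := by
  classical
  have hp : p.Prime := Fact.out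
  induction F using Finset.induction_on_max with
  | empty =>
    intro P hF _ h
    obtain ⟨c, rfl⟩ : ∃ c, P = C c := ⟨coeff 0 P, by
      ext e
      rw [coeff_C]
      split_ifs with h0
      · rw [← h0]
      · by_contra hne
        have := hF e (mem_support_iff.mpr hne)
        exact h0 (by simpa [eq_comm] using this)⟩
    simpa using h
  | insert a F ha ih =>
    intro P hF hP h
    let D : Polynomial (MvPolynomial s k) :=
      ∑ e ∈ P.support, Polynomial.monomial (e a) (monomial (e.erase a) (coeff e P))
    let ψ := eval₂Hom (frobenius k p) (Subtype.val : s → k)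
    have hcoeff : ∀ j, D.coeff j =
        ∑ e ∈ P.support with e a = j, monomial (e.erase a) (coeff e P) := by
      intro j
      rw [Polynomial.finsetSum_coeff, Finset.sum_filter]
      exact Finset.sum_congr rfl fun e _ => Polynomial.coeff_monomial
    have heval : (D.map ψ).eval (a : k) = 0 := by
      rw [← h, eval₂_eq, Polynomial.map_sum, Polynomial.eval_finsetSum]
      refine Finset.sum_congr rfl fun e _ => ?_
      rw [Polynomial.map_monomial, Polynomial.eval_monomial, coe_eval₂Hom, eval₂_monomial,
        mul_assoc]
      congr 1
      have := Finsupp.mul_prod_erase' e a (fun (i : s) n => (i : k) ^ n) (by simp)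
      rw [mul_comm, this, Finsupp.prod]
    have herase : ∀ e ∈ P.support, (e.erase a).support ⊆ F := fun e he => by
      rw [Finsupp.support_erase]
      exact (Finset.erase_subset_erase a (hF e he)).trans (Finset.erase_insert_subset a F)
    have hD : D.map ψ = 0 := by
      refine polynomial_eq_zero_of_frobenius_mem
        (L := Subring.closure (Set.range (frobenius k p) ∪ Set.Iio (a : k)))
        (fun x => Subring.subset_closure (Or.inl ⟨x, rfl⟩)) (hs a a.2) (fun j => ?_) ?_ heval
      · rw [Polynomial.coeff_map, hcoeff, map_sum]
        refine sum_mem fun e he => ?_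
        rw [coe_eval₂Hom, eval₂_monomial]
        refine mul_mem (Subring.subset_closure (Or.inl ⟨_, rfl⟩)) (prod_mem fun i hi => ?_)
        refine pow_mem (Subring.subset_closure (Set.mem_union_right _ ?_)) _
        exact ha i (herase e (Finset.mem_filter.mp he).1 hi)
      · refine (Polynomial.degree_lt_iff_coeff_zero _ _).mpr fun j hj => ?_
        rw [Polynomial.coeff_map, hcoeff, Finset.filter_false_of_mem, Finset.sum_empty, map_zero]
        intro e he h0
        have := hP e he a
        omega
    have hzero : ∀ j, D.coeff j = 0 := by
      intro j
      have hex : ∀ e' ∈ (D.coeff j).support, ∃ e ∈ P.support, e.erase a = e' := by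
        intro e' he'
        rw [hcoeff, mem_support_iff, coeff_sum] at he'
        obtain ⟨e, he, hne⟩ := Finset.exists_ne_zero_of_sum_ne_zero he'
        refine ⟨e, (Finset.mem_filter.mp he).1, ?_⟩
        rw [coeff_monomial] at hne
        by_contra h0
        rw [if_neg h0] at hne
        exact hne rfl
      refine ih _ (fun e' he' => ?_) (fun e' he' i => ?_) ?_
      · obtain ⟨e, he, rfl⟩ := hex e' he'
        exact herase e he
      · obtain ⟨e, he, rfl⟩ := hex e' he'
        rw [Finsupp.erase_apply]
        split_ifs
        · exact hp.pos
        · exact hP e he i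
      · have := congrArg (fun Q => Polynomial.coeff Q j) hD
        rwa [Polynomial.coeff_map, Polynomial.coeff_zero] at this
    ext e
    rw [coeff_zero]
    by_contra hne
    have h1 := congrArg (coeff (e.erase a)) (hzero (e a))
    rw [hcoeff, coeff_sum, coeff_zero, Finset.sum_eq_single_of_mem e] at h1
    · rw [coeff_monomial, if_pos rfl] at h1
      exact hne h1
    · exact Finset.mem_filter.mpr ⟨mem_support_iff.mpr hne, rfl⟩
    · intro e' he' hne'
      rw [coeff_monomial, if_neg]
      intro h2
      refine hne' ?_
      rw [← Finsupp.single_add_erase a e', (Finset.mem_filter.mp he').2, h2,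
        Finsupp.single_add_erase]

variable (k p)

/-- Existence of `p`-bases. -/
theorem exists_pBasis : ∃ s : Set k,
    (∀ n, Subring.closure (Set.range (iterateFrobenius k p n) ∪ s) = ⊤) ∧
    ∀ n, ∀ P : MvPolynomial s k, (∀ e ∈ P.support, ∀ i, e i < p ^ n) →
      eval₂ (iterateFrobenius k p n) Subtype.val P = 0 → P = 0 := by
  classical
  obtain ⟨_, _⟩ := exists_wellFoundedLT k
  -- After well-ordering k, exactly the elements not generated over k^p by their predecessors are
  -- kept.
  let s : Set k := {a | a ∉ Subring.closure (Set.range (frobenius k p) ∪ Set.Iio a)}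
  have hgen : ∀ a : k, a ∈ Subring.closure (Set.range (frobenius k p) ∪ s) := by
    intro a
    induction a using WellFoundedLT.induction with
    | ind a ih =>
      by_cases ha : a ∈ s
      · exact Subring.subset_closure (Or.inr ha)
      · have ha' : a ∈ Subring.closure (Set.range (frobenius k p) ∪ Set.Iio a) := not_not.mp ha
        refine Subring.closure_le.mpr ?_ ha'
        rintro x (hx | hx)
        · exact Subring.subset_closure (Or.inl hx)
        · exact ih x hx
  refine ⟨s, fun n => ?_, eq_zero_of_eval₂_iterateFrobenius_eq_zero fun P hP h =>
    eq_zero_of_eval₂_frobenius_eq_zero (fun a ha => ha) (P.support.biUnion Finsupp.support) P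
      (fun e he => Finset.subset_biUnion_of_mem Finsupp.support he) hP h⟩
  induction n with
  | zero =>
    rw [eq_top_iff]
    exact fun x _ => Subring.subset_closure (Or.inl ⟨x, by simp⟩)
  | succ n ih =>
    rw [eq_top_iff]
    refine fun a _ => Subring.closure_le.mpr ?_ (hgen a)
    rintro x (⟨y, rfl⟩ | hx)
    · have hy : y ∈ (Subring.closure (Set.range (iterateFrobenius k p (n + 1)) ∪ s)).comap
          (frobenius k p) := by
        have hle : Subring.closure (Set.range (iterateFrobenius k p n) ∪ s) ≤
            (Subring.closure (Set.range (iterateFrobenius k p (n + 1)) ∪ s)).comap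
              (frobenius k p) := by
          refine Subring.closure_le.mpr ?_
          rintro _ (⟨z, rfl⟩ | hz)
          · refine Subring.subset_closure (Or.inl ⟨z, ?_⟩)
            rw [iterateFrobenius_def, iterateFrobenius_def, frobenius_def, ← pow_mul, ← pow_succ]
          · exact Subring.pow_mem _ (Subring.subset_closure (Set.mem_union_right _ hz)) p
        rw [ih] at hle
        exact hle trivial
      exact hy
    · exact Subring.subset_closure (Or.inr hx)

end PBasis

end

section

/-! ### Subrings generated by p^N-th powers and lifts of a p-basis. -/

section CohenSubring

variable {B k : Type*} [CommRing B] [Field k]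

/-- The subring generated by the `q`-th powers and `t`. -/
def powSubring {ι : Type*} (q : ℕ) (t : ι → B) : Subring B :=
  Subring.closure (Set.range (fun x : B => x ^ q) ∪ Set.range t)

theorem pow_mem_powSubring {ι : Type*} (q : ℕ) (t : ι → B) (x : B) : x ^ q ∈ powSubring q t :=
  Subring.subset_closure (Set.mem_union_left _ ⟨x, rfl⟩)

theorem mem_powSubring {ι : Type*} (q : ℕ) (t : ι → B) (i : ι) : t i ∈ powSubring q t :=
  Subring.subset_closure (Set.mem_union_right _ ⟨i, rfl⟩)

/-- The multiples of `p ^ r` in a subring. -/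
def primeMultiples (p : ℕ) (V : Subring B) (r : ℕ) : AddSubgroup B :=
  V.toAddSubgroup.map (AddMonoidHom.mulLeft ((p : B) ^ r))

theorem primeMultiples_anti (p : ℕ) (V : Subring B) : Antitone (primeMultiples p V) := by
  rintro r s h x ⟨y, hy, rfl⟩
  refine ⟨(p : B) ^ (s - r) * y, V.mul_mem (pow_mem (natCast_mem V p) _) hy, ?_⟩
  change (p : B) ^ r * ((p : B) ^ (s - r) * y) = (p : B) ^ s * y
  rw [← mul_assoc, ← pow_add, Nat.add_sub_cancel' h]

variable {p : ℕ} [hp : Fact p.Prime]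

/-- Here u is the p-adic valuation of i, and the valuation of the binomial coefficient is v - u. -/
theorem exists_pow_dvd_choose_prime_pow {v i : ℕ} (hi0 : i ≠ 0) (hi : i < p ^ v) :
    ∃ u < v, ∃ a b c : ℕ, i = p ^ u * a ∧ p ^ v - i = p ^ u * b ∧
      (p ^ v).choose i = p ^ (v - u) * c := by
  have h1 := Nat.factorization_choose_prime_pow_add_factorization hp.out hi.le hi0
  have h2 : p ^ i.factorization p ∣ i := Nat.ordProj_dvd i p
  have h3 : i.factorization p < v := by
    by_contra! h
    have := Nat.le_of_dvd (Nat.pos_of_ne_zero hi0) ((pow_dvd_pow p h).trans h2)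
    omega
  obtain ⟨a, ha⟩ := h2
  obtain ⟨b, hb⟩ : p ^ i.factorization p ∣ p ^ v - i :=
    Nat.dvd_sub (pow_dvd_pow p h3.le) (Nat.ordProj_dvd i p)
  obtain ⟨c, hc⟩ : p ^ (v - i.factorization p) ∣ (p ^ v).choose i := by
    have : v - i.factorization p = ((p ^ v).choose i).factorization p := by omega
    rw [this]
    exact Nat.ordProj_dvd _ p
  exact ⟨_, h3, a, b, c, ha, hb, hc⟩

theorem pow_prime_pow_sub_mem {m : Ideal B} (hpm : (p : B) ∈ m) {x y : B} (h : x - y ∈ m) (v : ℕ) :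
    x ^ p ^ v - y ^ p ^ v ∈ m ^ (v + 1) := by
  induction v with
  | zero => simpa using h
  | succ v ih =>
    obtain ⟨r, hr⟩ := exists_add_pow_prime_eq hp.out (y ^ p ^ v) (x ^ p ^ v - y ^ p ^ v)
    rw [add_sub_cancel] at hr
    rw [pow_succ p, pow_mul, pow_mul, hr]
    set d := x ^ p ^ v - y ^ p ^ v
    have h1 : d ^ p ∈ m ^ (v + 1 + 1) := by
      have := Ideal.pow_mem_pow ih p
      rw [← pow_mul] at this
      refine Ideal.pow_le_pow_right ?_ this
      have := hp.out.two_le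
      nlinarith
    have h2 : (p : B) * d ∈ m ^ (v + 1 + 1) := by
      rw [pow_succ' m]
      exact Ideal.mul_mem_mul hpm ih
    have h3 : (y ^ p ^ v) ^ p + d ^ p + ↑p * y ^ p ^ v * d * r - (y ^ p ^ v) ^ p =
        d ^ p + (y ^ p ^ v * r) * (↑p * d) := by ring
    rw [h3]
    exact add_mem h1 (Ideal.mul_mem_left _ _ h2)

/-- A mixed binomial term whose index has valuation u < v is an integer multiple of p^(v-u) times a
p^u-th power. After multiplication by p^(N-v) it lies in p^(N-u)V by assumption, and N - u ≥ N - v +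
1. -/
theorem add_pow_sub_mem_primeMultiples {V : Subring B} {N v : ℕ} (hv : v ≤ N)
    (hV : ∀ u < v, ∀ w : B, (p : B) ^ (N - u) * w ^ p ^ u ∈ primeMultiples p V (N - u)) (x y : B) :
    (p : B) ^ (N - v) * ((x + y) ^ p ^ v - x ^ p ^ v - y ^ p ^ v) ∈
      primeMultiples p V (N - v + 1) := by
  have hpos : 0 < p ^ v := pow_pos hp.out.pos v
  have h1 : (x + y) ^ p ^ v - x ^ p ^ v - y ^ p ^ v =
      ∑ i ∈ Finset.Ioo 0 (p ^ v), x ^ i * y ^ (p ^ v - i) * ((p ^ v).choose i : B) := by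
    rw [add_pow, Finset.sum_range_succ, Finset.range_eq_Ico, ← Finset.sum_Ioo_add_eq_sum_Ico hpos]
    simp
  rw [h1, Finset.mul_sum]
  refine sum_mem fun i hi => ?_
  rw [Finset.mem_Ioo] at hi
  obtain ⟨u, hu, a, b, c, ha, hb, hc⟩ := exists_pow_dvd_choose_prime_pow hi.1.ne' hi.2
  have h2 : (p : B) ^ (N - v) * (x ^ i * y ^ (p ^ v - i) * ((p ^ v).choose i : B)) =
      c • ((p : B) ^ (N - u) * (x ^ a * y ^ b) ^ p ^ u) := by
    have h3 : N - u = N - v + (v - u) := by omega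
    rw [hc, hb, h3]
    conv_lhs => rw [ha]
    rw [nsmul_eq_mul]
    push_cast
    ring
  rw [h2]
  exact nsmul_mem (primeMultiples_anti p V (by omega) (hV u hu _)) c

variable {ι : Type*} {π : B →+* k} {t : ι → B} [CharP k p]

theorem exists_mem_powSubring_sub_mem_ker (hπ : Function.Surjective π) {n : ℕ}
    (hgen : Subring.closure (Set.range (iterateFrobenius k p n) ∪ Set.range (π ∘ t)) = ⊤) (w : B) :
    ∃ s ∈ powSubring (p ^ n) t, w - s ∈ RingHom.ker π := by
  have h1 : (powSubring (p ^ n) t).map π = ⊤ := by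
    rw [powSubring, RingHom.map_closure, ← hgen, Set.image_union, ← Set.range_comp,
      ← Set.range_comp]
    congr 2
    ext x
    constructor
    · rintro ⟨y, rfl⟩
      exact ⟨π y, by simp [iterateFrobenius_def]⟩
    · rintro ⟨y, rfl⟩
      obtain ⟨z, rfl⟩ := hπ y
      exact ⟨z, by simp [iterateFrobenius_def]⟩
  have h2 : π w ∈ (powSubring (p ^ n) t).map π := h1 ▸ Subring.mem_top _
  obtain ⟨s, hs, hsw⟩ := h2
  exact ⟨s, hs, by rw [RingHom.mem_ker, map_sub, hsw, sub_self]⟩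

/-- These elements are like terms of a Witt ghost component. Replacing w by a congruent s generated
by p^(N-v)-th powers and t changes nothing, as the error lies in ker π^(N+1) = 0. On the generators
of s the claim is immediate, and it extends to sums because the smaller v control the failure of
additivity. -/
theorem pow_mul_pow_mem_primeMultiples (hπ : Function.Surjective π)
    (hgen : ∀ n, Subring.closure (Set.range (iterateFrobenius k p n) ∪ Set.range (π ∘ t)) = ⊤)
    {N : ℕ} (hN : RingHom.ker π ^ (N + 1) = ⊥) (v : ℕ) (hv : v ≤ N) (w : B) :
    (p : B) ^ (N - v) * w ^ p ^ v ∈ primeMultiples p (powSubring (p ^ N) t) (N - v) := by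
  have hpm : (p : B) ∈ RingHom.ker π := by simp [RingHom.mem_ker]
  induction v using Nat.strong_induction_on generalizing w with
  | _ v ih =>
  set V := powSubring (p ^ N) t with hVdef
  have hmul : ∀ x ∈ V, ∀ r, ∀ y ∈ primeMultiples p V r, x * y ∈ primeMultiples p V r := by
    rintro x hx r _ ⟨y, hy, rfl⟩
    exact ⟨x * y, V.mul_mem hx hy, mul_left_comm _ _ _⟩
  have hadd := add_pow_sub_mem_primeMultiples hv (fun u hu w => ih u hu (by omega) w)
  obtain ⟨s, hs, hws⟩ := exists_mem_powSubring_sub_mem_ker hπ (hgen (N - v)) w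
  have h1 : (p : B) ^ (N - v) * w ^ p ^ v = (p : B) ^ (N - v) * s ^ p ^ v := by
    rw [← sub_eq_zero, ← mul_sub, ← Ideal.mem_bot, ← hN]
    have h2 : N + 1 = (N - v) + (v + 1) := by omega
    rw [h2, pow_add]
    exact Ideal.mul_mem_mul (Ideal.pow_mem_pow hpm _) (pow_prime_pow_sub_mem hpm hws v)
  rw [h1]
  clear h1 hws
  induction hs using Subring.closure_induction with
  | mem x hx =>
    rcases hx with ⟨y, rfl⟩ | ⟨i, rfl⟩
    · refine ⟨y ^ p ^ N, pow_mem_powSubring _ t y, ?_⟩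
      change (p : B) ^ (N - v) * y ^ p ^ N = (p : B) ^ (N - v) * (y ^ p ^ (N - v)) ^ p ^ v
      rw [← pow_mul, ← pow_add, Nat.sub_add_cancel hv]
    · exact ⟨t i ^ p ^ v, pow_mem (mem_powSubring _ t i) _, rfl⟩
  | zero => rw [zero_pow (pow_pos hp.out.pos v).ne', mul_zero]; exact zero_mem _
  | one => exact ⟨1, V.one_mem, by simp⟩
  | add x y _ _ hx hy =>
    have h3 := primeMultiples_anti p V (Nat.le_succ _) (hadd x y)
    have h4 : (p : B) ^ (N - v) * (x + y) ^ p ^ v =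
        (p : B) ^ (N - v) * ((x + y) ^ p ^ v - x ^ p ^ v - y ^ p ^ v) +
          (p : B) ^ (N - v) * x ^ p ^ v + (p : B) ^ (N - v) * y ^ p ^ v := by ring
    rw [h4]
    exact add_mem (add_mem h3 hx) hy
  | neg x _ hx =>
    rw [neg_pow, mul_left_comm]
    exact hmul _ (pow_mem (neg_mem (one_mem V)) _) _ _ hx
  | mul x y _ _ hx hy =>
    obtain ⟨z, hz, hzx⟩ := hx
    have h5 : (p : B) ^ (N - v) * z = (p : B) ^ (N - v) * x ^ p ^ v := hzx
    rw [mul_pow, ← mul_assoc, ← h5, mul_right_comm, mul_comm]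
    exact hmul z hz _ _ hy

open MvPolynomial in
-- The q-th power of each t' i comes from S, so all but the remainder modulo q of an exponent can be
-- absorbed in the coefficients.
theorem exists_eval₂_eq_of_pow_eq {S E : Type*} [CommRing S] [CommRing E] (τ : S →+* E)
    (t : ι → S) (t' : ι → E) {q : ℕ} (hq : 0 < q) (h : ∀ i, τ (t i) = t' i ^ q)
    (P : MvPolynomial ι S) :
    ∃ Q : MvPolynomial ι S, (∀ e ∈ Q.support, ∀ i, e i < q) ∧ eval₂ τ t' Q = eval₂ τ t' P := by
  classical
  induction P using MvPolynomial.induction_on' with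
  | monomial e a =>
    refine ⟨monomial (exponentMod q e) (a * (exponentDiv q e).prod fun i n => t i ^ n), ?_, ?_⟩
    · intro d hd i
      rw [Finset.mem_singleton.mp (support_monomial_subset hd)]
      exact Nat.mod_lt _ hq
    · rw [eval₂_monomial, eval₂_monomial, prod_pow_eq_of_digits t' q e, map_mul, mul_assoc]
      congr 1
      rw [mul_comm]
      congr 1
      rw [Finsupp.prod, Finsupp.prod, map_prod, ← Finset.prod_pow]
      refine Finset.prod_congr rfl fun i _ => ?_
      rw [map_pow, h, pow_right_comm]
  | add P₁ P₂ h₁ h₂ =>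
    obtain ⟨Q₁, hQ₁, he₁⟩ := h₁
    obtain ⟨Q₂, hQ₂, he₂⟩ := h₂
    refine ⟨Q₁ + Q₂, fun e he i => ?_, by rw [eval₂_add, eval₂_add, he₁, he₂]⟩
    rcases Finset.mem_union.mp (support_add he) with h' | h'
    exacts [hQ₁ e h' i, hQ₂ e h' i]

open MvPolynomial in
-- Raising to the p^N-th power is a ring map τ from B to V/pV. Hence x modulo p is a polynomial in t
-- with exponents below p^N and coefficients in τ(B). Applying π and p-independence puts the
-- underlying coefficients in ker π, whose p^N-th powers vanish; so x = 0 in V/pV.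
theorem exists_eq_mul_of_mem_powSubring_of_mem_ker (hπ : Function.Surjective π)
    (hgen : ∀ n, Subring.closure (Set.range (iterateFrobenius k p n) ∪ Set.range (π ∘ t)) = ⊤)
    {N : ℕ} (hN : RingHom.ker π ^ (N + 1) = ⊥)
    (hind : ∀ P : MvPolynomial ι k, (∀ e ∈ P.support, ∀ i, e i < p ^ N) →
      eval₂ (iterateFrobenius k p N) (π ∘ t) P = 0 → P = 0)
    {x : B} (hx : x ∈ powSubring (p ^ N) t) (hx0 : π x = 0) :
    ∃ y ∈ powSubring (p ^ N) t, x = p * y := by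
  have hpos : 0 < p ^ N := pow_pos hp.out.pos N
  set V := powSubring (p ^ N) t with hVdef
  let J : Ideal V := Ideal.span {(p : V)}
  have hmk : ∀ x y : V, (∃ z ∈ V, (p : B) * z = x - y) →
      Ideal.Quotient.mk J x = Ideal.Quotient.mk J y := by
    rintro x y ⟨z, hz, h⟩
    rw [Ideal.Quotient.eq, Ideal.mem_span_singleton']
    exact ⟨⟨z, hz⟩, Subtype.ext (by rw [mul_comm]; exact h)⟩
  let τ : B →+* V ⧸ J :=
    { toFun := fun x => Ideal.Quotient.mk J ⟨x ^ p ^ N, pow_mem_powSubring _ t x⟩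
      map_one' := by
        rw [← map_one (Ideal.Quotient.mk J)]
        congr 1
        exact Subtype.ext (one_pow _)
      map_mul' := fun x y => by
        rw [← map_mul]
        congr 1
        exact Subtype.ext (mul_pow x y _)
      map_zero' := by
        rw [← map_zero (Ideal.Quotient.mk J)]
        congr 1
        exact Subtype.ext (zero_pow hpos.ne')
      map_add' := fun x y => by
        rw [← map_add]
        refine hmk _ _ ?_
        obtain ⟨z, hz, h⟩ := add_pow_sub_mem_primeMultiples le_rfl
          (fun u hu w => pow_mul_pow_mem_primeMultiples hπ hgen hN u hu.le w) x y
        refine ⟨z, hz, ?_⟩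
        have h' : (p : B) ^ (N - N + 1) * z =
          (p : B) ^ (N - N) * ((x + y) ^ p ^ N - x ^ p ^ N - y ^ p ^ N) := h
        rw [Nat.sub_self, zero_add, pow_one, pow_zero, one_mul, sub_sub] at h'
        exact h' }
  let ρ : V ⧸ J →+* k := Ideal.Quotient.lift J (π.comp V.subtype) fun a ha => by
    obtain ⟨c, rfl⟩ := Ideal.mem_span_singleton'.mp ha
    simp
  let t' : ι → V ⧸ J := fun i => Ideal.Quotient.mk J ⟨t i, mem_powSubring _ t i⟩
  have hτt : ∀ i, τ (t i) = t' i ^ p ^ N := fun i => rfl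
  have hrep : ∃ P : MvPolynomial ι B, eval₂ τ t' P = Ideal.Quotient.mk J ⟨x, hx⟩ := by
    clear hx0
    induction hx using Subring.closure_induction with
    | mem x hx =>
      rcases hx with ⟨y, rfl⟩ | ⟨i, rfl⟩
      · exact ⟨C y, eval₂_C _ _ _⟩
      · exact ⟨X i, eval₂_X _ _ _⟩
    | zero => exact ⟨0, by rw [eval₂_zero]; exact (map_zero _).symm⟩
    | one => exact ⟨1, by rw [eval₂_one]; exact (map_one _).symm⟩
    | add x y _ _ hx hy =>
      obtain ⟨P, hP⟩ := hx
      obtain ⟨Q, hQ⟩ := hy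
      exact ⟨P + Q, by rw [eval₂_add, hP, hQ, ← map_add]; rfl⟩
    | neg x _ hx =>
      obtain ⟨P, hP⟩ := hx
      exact ⟨-P, by rw [← coe_eval₂Hom, map_neg, coe_eval₂Hom, hP, ← map_neg]; rfl⟩
    | mul x y _ _ hx hy =>
      obtain ⟨P, hP⟩ := hx
      obtain ⟨Q, hQ⟩ := hy
      exact ⟨P * Q, by rw [eval₂_mul, hP, hQ, ← map_mul]; rfl⟩
  obtain ⟨P, hP⟩ := hrep
  obtain ⟨Q, hQ, hQP⟩ := exists_eval₂_eq_of_pow_eq τ t t' hpos hτt P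
  have hρτ : ρ.comp τ = (iterateFrobenius k p N).comp π := by
    ext y
    change π (y ^ p ^ N) = iterateFrobenius k p N (π y)
    rw [map_pow, iterateFrobenius_def]
  have h0 : map π Q = 0 := by
    refine hind _ (fun e he => hQ e (support_map_subset _ _ he)) ?_
    rw [eval₂_map, ← hρτ]
    have h1 : (π ∘ t : ι → k) = ρ ∘ t' := rfl
    rw [h1, ← MvPolynomial.eval₂_comp_left, hQP, hP]
    exact hx0
  have h1 : eval₂ τ t' Q = 0 := by
    rw [eval₂_eq]
    refine Finset.sum_eq_zero fun e _ => ?_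
    have h2 : π (coeff e Q) = 0 := by rw [← coeff_map, h0, coeff_zero]
    have h3 : coeff e Q ^ p ^ N = 0 := by
      rw [← Ideal.mem_bot, ← hN]
      exact Ideal.pow_le_pow_right (Nat.lt_pow_self hp.out.one_lt)
        (Ideal.pow_mem_pow (RingHom.mem_ker.mpr h2) _)
    have h4 : τ (coeff e Q) = 0 := by
      rw [← map_zero (Ideal.Quotient.mk J)]
      exact congrArg _ (Subtype.ext h3)
    rw [h4, zero_mul]
  rw [← hQP, h1] at hP
  obtain ⟨c, hc⟩ := Ideal.mem_span_singleton'.mp (Ideal.Quotient.eq_zero_iff_mem.mp hP.symm)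
  refine ⟨c, c.2, ?_⟩
  rw [mul_comm]
  exact (congrArg Subtype.val hc).symm

end CohenSubring

end

section

open IsLocalRing RingTheory.Sequence

/-! ### Subrings of a complete local ring with uniformizer p. -/

section PrimeUniformizer

variable {A : Type*} [CommRing A] [IsLocalRing A]

theorem eq_zero_of_forall_mem_pow_succ [IsHausdorff (maximalIdeal A) A] {x : A}
    (h : ∀ n, x ∈ maximalIdeal A ^ (n + 1)) : x = 0 := by
  refine IsHausdorff.haus (I := maximalIdeal A) inferInstance x fun n => ?_
  rw [SModEq.zero, smul_eq_mul, Ideal.mul_top]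
  exact Ideal.pow_le_pow_right (Nat.le_succ n) (h n)

theorem exists_limit_of_sub_mem_pow [IsPrecomplete (maximalIdeal A) A] (f : ℕ → A)
    (hf : ∀ i j, i ≤ j → f i - f j ∈ maximalIdeal A ^ i) :
    ∃ L, ∀ n, f n - L ∈ maximalIdeal A ^ n := by
  obtain ⟨L, hL⟩ := IsPrecomplete.prec (I := maximalIdeal A) inferInstance (f := f)
    fun {i j} hij => by
      rw [SModEq.sub_mem, smul_eq_mul, Ideal.mul_top]
      exact hf i j hij
  refine ⟨L, fun n => ?_⟩
  have := hL n
  rwa [SModEq.sub_mem, smul_eq_mul, Ideal.mul_top] at this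

/-- A closed subring, closed under inverses, whose elements of the maximal ideal are approximately
multiples of `p`. -/
structure IsApproxUniformizer (V : Subring A) (p : ℕ) : Prop where
  mem : (p : A) ∈ maximalIdeal A
  closed : ∀ x, (∀ n, ∃ v ∈ V, x - v ∈ maximalIdeal A ^ (n + 1)) → x ∈ V
  approx : ∀ x ∈ V, x ∈ maximalIdeal A → ∀ n, ∃ v ∈ V, x - p * v ∈ maximalIdeal A ^ (n + 1)
  inv : ∀ x ∈ V, x ∉ maximalIdeal A → ∃ y ∈ V, x * y = 1

namespace IsApproxUniformizer

variable {V : Subring A} {p : ℕ}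

/-- Approximate division by p either stops at a unit or continues n + 1 times; then x is zero modulo
the given power, and so is p^(n+1) * 1. -/
theorem exists_sub_pow_mul_mem (h : IsApproxUniformizer V p) {x : A} (hx : x ∈ V) (n : ℕ) :
    ∃ j, ∃ u ∈ V, u ∉ maximalIdeal A ∧ x - (p : A) ^ j * u ∈ maximalIdeal A ^ (n + 1) := by
  by_contra! hne
  have key : ∀ J : ℕ, ∃ w ∈ V, x - (p : A) ^ J * w ∈ maximalIdeal A ^ (n + 1) := fun J => by
    induction J with
    | zero => exact ⟨x, hx, by simp⟩
    | succ J ih =>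
      obtain ⟨w, hw, hxw⟩ := ih
      by_cases hwm : w ∈ maximalIdeal A
      · obtain ⟨v, hv, hwv⟩ := h.approx w hw hwm n
        refine ⟨v, hv, ?_⟩
        have h1 : x - (p : A) ^ (J + 1) * v = x - p ^ J * w + p ^ J * (w - p * v) := by ring
        rw [h1]
        exact add_mem hxw (Ideal.mul_mem_left _ _ hwv)
      · exact absurd hxw (hne J w hw hwm)
  obtain ⟨w, hw, hxw⟩ := key (n + 1)
  refine hne (n + 1) 1 V.one_mem (fun h1 => (maximalIdeal.isMaximal A).ne_top
    ((Ideal.eq_top_iff_one _).mpr h1)) ?_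
  have hp := Ideal.pow_mem_pow h.mem (n + 1)
  have h1 : x - (p : A) ^ (n + 1) * 1 = x - p ^ (n + 1) * w + p ^ (n + 1) * (w - 1) := by ring
  rw [h1]
  exact add_mem hxw (Ideal.mul_mem_right _ _ hp)

theorem mem_of_mul_mem_of_notMem {I : Ideal A} {a u : A} (hu : u ∉ maximalIdeal A)
    (hau : a * u ∈ I) : a ∈ I :=
  (Ideal.mul_unit_mem_iff_mem I (notMem_maximalIdeal.mp hu)).mp hau

/-- Let M be minimal with p^M = 0 and let p^(M-1) ∉ m^(n+1). An approximate quotient v of order n is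
already exact: x - pv is close to some p^j u with u a unit, and j < M would force p^(M-1) ∈ m^(n+1).
-/
theorem exists_eq_mul_of_pow_eq_zero [IsHausdorff (maximalIdeal A) A]
    (h : IsApproxUniformizer V p) (hp : ∃ M, (p : A) ^ M = 0) {x : A} (hx : x ∈ V) (hxm : x ∈ maximalIdeal A) :
    ∃ y ∈ V, x = p * y := by
  classical
  have hM := Nat.find_spec hp
  have hlt : ∀ j < Nat.find hp, (p : A) ^ j ≠ 0 := fun j hj => Nat.find_min hp hj
  set M := Nat.find hp
  have hM0 : M ≠ 0 := fun h0 => by simp [h0] at hM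
  have h1 : ∃ n, (p : A) ^ (M - 1) ∉ maximalIdeal A ^ (n + 1) := by
    by_contra! hall
    exact hlt (M - 1) (by omega) (eq_zero_of_forall_mem_pow_succ hall)
  obtain ⟨n, hn⟩ := h1
  obtain ⟨v, hv, hxv⟩ := h.approx x hx hxm n
  refine ⟨v, hv, sub_eq_zero.mp (eq_zero_of_forall_mem_pow_succ fun k => ?_)⟩
  obtain ⟨j, u, huV, hu, hxu⟩ := h.exists_sub_pow_mul_mem
    (sub_mem hx (mul_mem (natCast_mem V p) hv)) (n + k)
  have hj : M ≤ j := by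
    by_contra! hj
    refine hn ?_
    have h2 : (p : A) ^ j * u ∈ maximalIdeal A ^ (n + 1) := by
      have h3 := sub_mem hxv (Ideal.pow_le_pow_right (by omega : n + 1 ≤ n + k + 1) hxu)
      rwa [sub_sub_cancel] at h3
    have h4 : (p : A) ^ (M - 1) = p ^ (M - 1 - j) * p ^ j := by
      rw [← pow_add]
      congr 1
      omega
    rw [h4]
    exact Ideal.mul_mem_left _ _ (mem_of_mul_mem_of_notMem hu h2)
  rw [pow_eq_zero_of_le hj hM, zero_mul, sub_zero] at hxu
  exact Ideal.pow_le_pow_right (by omega) hxu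

/-- When p is not nilpotent, division by p is continuous on V (`hdiv`): if pz is small, so is z.
Approximate quotients are therefore Cauchy, and their limit stays in the closed subring V. -/
theorem exists_eq_mul_of_pow_ne_zero [IsAdicComplete (maximalIdeal A) A]
    (h : IsApproxUniformizer V p)
    (hp : ∀ M, (p : A) ^ M ≠ 0) {x : A} (hx : x ∈ V) (hxm : x ∈ maximalIdeal A) :
    ∃ y ∈ V, x = p * y := by
  have hex : ∀ j, ∃ n, (p : A) ^ (j + 1) ∉ maximalIdeal A ^ (n + 1) := fun j => by
    by_contra! hall
    exact hp _ (eq_zero_of_forall_mem_pow_succ hall)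
  choose n hn using hex
  have hdiv : ∀ j, ∀ r, n j ≤ r → j ≤ r → ∀ z ∈ V, (p : A) * z ∈ maximalIdeal A ^ (r + 1) →
      z ∈ maximalIdeal A ^ (j + 1) := fun j r hr hjr z hz hpz => by
    obtain ⟨i, u, huV, hu, hzu⟩ := h.exists_sub_pow_mul_mem hz r
    have h2 : (p : A) ^ (i + 1) * u ∈ maximalIdeal A ^ (r + 1) := by
      have h3 := sub_mem hpz (Ideal.mul_mem_left _ (p : A) hzu)
      have h4 : (p : A) ^ (i + 1) * u = p * z - p * (z - p ^ i * u) := by ring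
      rwa [h4]
    have h5 := mem_of_mul_mem_of_notMem hu h2
    have hij : j + 1 ≤ i := by
      by_contra! hij
      refine hn j (Ideal.pow_le_pow_right (by omega : n j + 1 ≤ r + 1) ?_)
      have h6 : (p : A) ^ (j + 1) = p ^ (j - i) * p ^ (i + 1) := by
        rw [← pow_add]
        congr 1
        omega
      rw [h6]
      exact Ideal.mul_mem_left _ _ h5
    have h7 := add_mem (Ideal.pow_le_pow_right (by omega : j + 1 ≤ r + 1) hzu)
      (Ideal.mul_mem_right u _ (Ideal.pow_le_pow_right hij (Ideal.pow_mem_pow h.mem i)))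
    rwa [sub_add_cancel] at h7
  -- A monotone sequence dominating both n j and j.
  let N : ℕ → ℕ := fun j => ∑ i ∈ Finset.range (j + 1), (n i + 1)
  have hNmono : Monotone N := fun i j hij =>
    Finset.sum_le_sum_of_subset (Finset.range_mono (by omega))
  have hnN : ∀ j, n j ≤ N j := fun j =>
    (Nat.le_succ _).trans (Finset.single_le_sum (f := fun i => n i + 1) (fun _ _ => Nat.zero_le _)
      (Finset.self_mem_range_succ j))
  have hjN : ∀ j, j ≤ N j := fun j => by
    have : ∑ i ∈ Finset.range (j + 1), 1 ≤ N j := Finset.sum_le_sum fun i _ => by omega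
    simp at this
    omega
  choose v hvV hv using fun j => h.approx x hx hxm (N j)
  have hcauchy : ∀ i j, i ≤ j → v i - v j ∈ maximalIdeal A ^ (i + 1) := fun i j hij => by
    refine hdiv i (N i) (hnN i) (hjN i) _ (sub_mem (hvV i) (hvV j)) ?_
    have h1 := sub_mem (Ideal.pow_le_pow_right (Nat.succ_le_succ (hNmono hij)) (hv j)) (hv i)
    have h2 : (p : A) * (v i - v j) = x - p * v j - (x - p * v i) := by ring
    rwa [h2]
  obtain ⟨y, hy⟩ := exists_limit_of_sub_mem_pow v fun i j hij =>
    Ideal.pow_le_pow_right (Nat.le_succ i) (hcauchy i j hij)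
  refine ⟨y, h.closed y fun r => ⟨v (r + 1), hvV _, ?_⟩, ?_⟩
  · rw [← neg_sub]
    exact neg_mem (hy (r + 1))
  · refine sub_eq_zero.mp (eq_zero_of_forall_mem_pow_succ fun r => ?_)
    have h1 : x - p * y = x - p * v (r + 1) + p * (v (r + 1) - y) := by ring
    rw [h1]
    exact add_mem (Ideal.pow_le_pow_right (by have := hjN (r + 1); omega) (hv (r + 1)))
      (Ideal.mul_mem_left _ _ (hy (r + 1)))

theorem exists_eq_mul [IsAdicComplete (maximalIdeal A) A]
    (h : IsApproxUniformizer V p) {x : A} (hx : x ∈ V)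
    (hxm : x ∈ maximalIdeal A) : ∃ y ∈ V, x = p * y := by
  by_cases hp : ∃ M, (p : A) ^ M = 0
  · exact h.exists_eq_mul_of_pow_eq_zero hp hx hxm
  · exact h.exists_eq_mul_of_pow_ne_zero (not_exists.mp hp) hx hxm

theorem exists_eq_pow_mul_unit [IsAdicComplete (maximalIdeal A) A]
    (h : IsApproxUniformizer V p) {x : V}
    (hx : x ≠ 0) : ∃ j, ∃ u : Vˣ, x = (p : V) ^ j * u := by
  by_contra! hne
  have key : ∀ J : ℕ, ∃ w : V, x = (p : V) ^ J * w := fun J => by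
    induction J with
    | zero => exact ⟨x, by simp⟩
    | succ J ih =>
      obtain ⟨w, hw⟩ := ih
      by_cases hwm : (w : A) ∈ maximalIdeal A
      · obtain ⟨v, hv, hwv⟩ := h.exists_eq_mul w.2 hwm
        refine ⟨⟨v, hv⟩, ?_⟩
        rw [hw, pow_succ, mul_assoc]
        congr 1
        exact Subtype.ext hwv
      · obtain ⟨y, hy, hwy⟩ := h.inv w w.2 hwm
        exact absurd hw (hne J ⟨w, ⟨y, hy⟩, Subtype.ext hwy,
          Subtype.ext ((mul_comm _ _).trans hwy)⟩)
  refine hx (Subtype.ext (eq_zero_of_forall_mem_pow_succ fun n => ?_))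
  obtain ⟨w, hw⟩ := key (n + 1)
  have h1 : (x : A) = (p : A) ^ (n + 1) * w := by
    rw [hw]
    push_cast
    rfl
  rw [h1]
  exact Ideal.mul_mem_right _ _ (Ideal.pow_mem_pow h.mem _)

theorem isLocalHom_subtype (h : IsApproxUniformizer V p) : IsLocalHom V.subtype := by
  refine ⟨fun x hx => ?_⟩
  obtain ⟨y, hy, hxy⟩ := h.inv x x.2 (notMem_maximalIdeal.mpr hx)
  exact IsUnit.of_mul_eq_one ⟨y, hy⟩ (Subtype.ext hxy)

theorem isLocalRing (h : IsApproxUniformizer V p) : IsLocalRing V :=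
  have := h.isLocalHom_subtype
  RingHom.domain_isLocalRing V.subtype

theorem isPrincipalIdealRing [IsAdicComplete (maximalIdeal A) A]
    (h : IsApproxUniformizer V p) : IsPrincipalIdealRing V := by
  classical
  refine ⟨fun I => ?_⟩
  by_cases hI : ∃ j, (p : V) ^ j ∈ I
  · refine ⟨(p : V) ^ Nat.find hI, le_antisymm (fun x hx => ?_) ?_⟩
    · rcases eq_or_ne x 0 with rfl | hx0
      · exact zero_mem _
      · obtain ⟨j, u, rfl⟩ := h.exists_eq_pow_mul_unit hx0
        have h1 : (p : V) ^ j ∈ I := (Ideal.mul_unit_mem_iff_mem I u.isUnit).mp hx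
        exact Ideal.mem_span_singleton.mpr
          (Dvd.dvd.mul_right (pow_dvd_pow _ (Nat.find_min' hI h1)) _)
    · exact (Ideal.span_singleton_le_iff_mem I).mpr (Nat.find_spec hI)
  · refine ⟨0, ?_⟩
    rw [Submodule.span_zero_singleton, eq_bot_iff]
    intro x hx
    by_contra hx0
    obtain ⟨j, u, rfl⟩ := h.exists_eq_pow_mul_unit hx0
    exact hI ⟨j, (Ideal.mul_unit_mem_iff_mem I u.isUnit).mp hx⟩

/-- If p is nilpotent, the maximal ideal is the only prime and the empty sequence works. Otherwise
no p^j u with u a unit vanishes, so p is regular. -/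
theorem hasRegularParameters [IsAdicComplete (maximalIdeal A) A]
    (h : IsApproxUniformizer V p) [IsLocalRing V] :
    HasRegularParameters V := by
  have hloc := h.isLocalHom_subtype
  have hpm : (p : V) ∈ maximalIdeal V := by
    rw [mem_maximalIdeal, mem_nonunits_iff]
    intro hu
    have := hu.map V.subtype
    rw [map_natCast] at this
    exact notMem_maximalIdeal.mpr this h.mem
  have hmax : ∀ q : Ideal V, q.IsPrime → (p : V) ∈ q → q = maximalIdeal V := fun q hq hpq => by
    refine le_antisymm (le_maximalIdeal hq.ne_top) fun x hx => ?_
    have hxm : (x : A) ∈ maximalIdeal A := by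
      rw [mem_maximalIdeal, mem_nonunits_iff] at hx ⊢
      exact fun hu => hx (hloc.map_nonunit x hu)
    obtain ⟨y, hy, hxy⟩ := h.exists_eq_mul x.2 hxm
    have h1 : x = p * ⟨y, hy⟩ := Subtype.ext hxy
    rw [h1]
    exact Ideal.mul_mem_right _ _ hpq
  by_cases hp : ∃ M, (p : V) ^ M = 0
  · obtain ⟨M, hM⟩ := hp
    refine ⟨[], by simp, .nil V V, fun q hq _ => hmax q hq (hq.mem_of_pow_mem M ?_)⟩
    rw [hM]
    exact zero_mem _
  · refine ⟨[(p : V)], by simpa using hpm, ?_, fun q hq hq' => hmax q hq (hq' _ (by simp))⟩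
    refine (isWeaklyRegular_singleton_iff V _).mpr ?_
    refine (isSMulRegular_iff_right_eq_zero_of_smul).mpr fun x hx => ?_
    by_contra hx0
    obtain ⟨j, u, rfl⟩ := h.exists_eq_pow_mul_unit hx0
    refine hp ⟨j + 1, ?_⟩
    rw [smul_eq_mul, ← mul_assoc, ← pow_succ'] at hx
    exact (Units.mul_left_eq_zero u).mp hx

end IsApproxUniformizer

end PrimeUniformizer

end

section

open IsLocalRing RingTheory.Sequence

/-! ### Intersecting a descending sequence of approximating subrings. -/

section Intersection

variable {A : Type*} [CommRing A] [IsLocalRing A] {U : ℕ → Subring A} {p : ℕ}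

/-- An element of U n is v' + pw modulo m^(n+1) with v' ∈ U (n + 1) and w ∈ U n. After n + 1
repetitions the remainder is a multiple of p^(n+1). -/
theorem exists_mem_succ_sub_mem_pow (hp : (p : A) ∈ maximalIdeal A) (hanti : Antitone U)
    (hsurj : ∀ n a, ∃ u ∈ U n, a - u ∈ maximalIdeal A)
    (hdiv : ∀ n, ∀ a ∈ U n, a ∈ maximalIdeal A →
      ∃ u ∈ U n, a - p * u ∈ maximalIdeal A ^ (n + 1))
    {n : ℕ} {u : A} (hu : u ∈ U n) : ∃ v ∈ U (n + 1), u - v ∈ maximalIdeal A ^ (n + 1) := by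
  have key : ∀ j : ℕ, ∃ v ∈ U (n + 1), ∃ w ∈ U n,
      u - v - (p : A) ^ j * w ∈ maximalIdeal A ^ (n + 1) := fun j => by
    induction j with
    | zero => exact ⟨0, zero_mem _, u, hu, by simp⟩
    | succ j ih =>
      obtain ⟨v, hv, w, hw, hvw⟩ := ih
      obtain ⟨v', hv', hwv'⟩ := hsurj (n + 1) w
      obtain ⟨w', hw', h⟩ := hdiv n (w - v') (sub_mem hw (hanti (Nat.le_succ n) hv')) hwv'
      refine ⟨v + p ^ j * v', add_mem hv (mul_mem (pow_mem (natCast_mem _ p) j) hv'), w', hw', ?_⟩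
      have h1 : u - (v + p ^ j * v') - (p : A) ^ (j + 1) * w' =
          u - v - p ^ j * w + p ^ j * (w - v' - p * w') := by ring
      rw [h1]
      exact add_mem hvw (Ideal.mul_mem_left _ _ h)
  obtain ⟨v, hv, w, hw, hvw⟩ := key (n + 1)
  refine ⟨v, hv, ?_⟩
  have := add_mem hvw (Ideal.mul_mem_right w _ (Ideal.pow_mem_pow hp (n + 1)))
  rwa [sub_add_cancel] at this

/-- Successive corrections converge, and the limit lies in each U i because U i contains m^(i+1). -/
theorem exists_mem_iInf_sub_mem_pow [IsPrecomplete (maximalIdeal A) A]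
    (hp : (p : A) ∈ maximalIdeal A) (hanti : Antitone U)
    (hpow : ∀ n, ∀ a ∈ maximalIdeal A ^ (n + 1), a ∈ U n)
    (hsurj : ∀ n a, ∃ u ∈ U n, a - u ∈ maximalIdeal A)
    (hdiv : ∀ n, ∀ a ∈ U n, a ∈ maximalIdeal A →
      ∃ u ∈ U n, a - p * u ∈ maximalIdeal A ^ (n + 1))
    {n : ℕ} {u : A} (hu : u ∈ U n) : ∃ v ∈ ⨅ i, U i, u - v ∈ maximalIdeal A ^ (n + 1) := by
  have hstep : ∀ i, ∀ a : U i, ∃ b : U (i + 1), (a : A) - b ∈ maximalIdeal A ^ (i + 1) :=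
    fun i a => by
      obtain ⟨b, hb, hab⟩ := exists_mem_succ_sub_mem_pow hp hanti hsurj hdiv a.2
      exact ⟨⟨b, hb⟩, hab⟩
  choose g hg using hstep
  obtain ⟨s, hs0, hs⟩ : ∃ s : (i : ℕ) → U (n + i), (s 0 : A) = u ∧
      ∀ i, (s i : A) - s (i + 1) ∈ maximalIdeal A ^ (n + i + 1) :=
    ⟨fun i => Nat.rec (motive := fun i => U (n + i)) ⟨u, hu⟩ (fun i a => g (n + i) a) i, rfl,
      fun i => hg (n + i) _⟩
  have hs' : ∀ i r, (s i : A) - s (i + r) ∈ maximalIdeal A ^ (n + i + 1) := fun i r => by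
    induction r with
    | zero => simp
    | succ r ih =>
      have h1 := add_mem ih (Ideal.pow_le_pow_right (by omega : n + i + 1 ≤ n + (i + r) + 1)
        (hs (i + r)))
      rwa [sub_add_sub_cancel] at h1
  obtain ⟨L, hL⟩ := exists_limit_of_sub_mem_pow (fun i => (s i : A)) fun i j hij => by
    obtain ⟨r, rfl⟩ := Nat.exists_eq_add_of_le hij
    exact Ideal.pow_le_pow_right (by omega) (hs' i r)
  have hL' : ∀ i, (s i : A) - L ∈ maximalIdeal A ^ (n + i + 1) := fun i => by
    have h1 := add_mem (hs' i (n + 1)) (Ideal.pow_le_pow_right (by omega) (hL (i + (n + 1))))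
    rwa [sub_add_sub_cancel] at h1
  refine ⟨L, (Subring.mem_iInf).mpr fun i => hanti (Nat.le_add_left i n) ?_, hs0 ▸ hL' 0⟩
  have h1 := sub_mem (s i).2 (hpow (n + i) _ (hL' i))
  rwa [sub_sub_cancel] at h1

theorem isApproxUniformizer_iInf [IsPrecomplete (maximalIdeal A) A]
    (hp : (p : A) ∈ maximalIdeal A) (hanti : Antitone U)
    (hpow : ∀ n, ∀ a ∈ maximalIdeal A ^ (n + 1), a ∈ U n)
    (hsurj : ∀ n a, ∃ u ∈ U n, a - u ∈ maximalIdeal A)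
    (hdiv : ∀ n, ∀ a ∈ U n, a ∈ maximalIdeal A →
      ∃ u ∈ U n, a - p * u ∈ maximalIdeal A ^ (n + 1)) :
    IsApproxUniformizer (⨅ i, U i) p ∧ ∀ a, ∃ v ∈ ⨅ i, U i, a - v ∈ maximalIdeal A := by
  have hclosed : ∀ x, (∀ n, ∃ v ∈ ⨅ i, U i, x - v ∈ maximalIdeal A ^ (n + 1)) → x ∈ ⨅ i, U i :=
    fun x hx => Subring.mem_iInf.mpr fun n => by
      obtain ⟨v, hv, hxv⟩ := hx n
      have h1 := add_mem (hpow n _ hxv) (Subring.mem_iInf.mp hv n)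
      rwa [sub_add_cancel] at h1
  have hlift := fun {n : ℕ} {u : A} (hu : u ∈ U n) =>
    exists_mem_iInf_sub_mem_pow hp hanti hpow hsurj hdiv hu
  have htop : ∀ a, ∃ v ∈ ⨅ i, U i, a - v ∈ maximalIdeal A := fun a => by
    obtain ⟨u, hu, hau⟩ := hsurj 0 a
    obtain ⟨v, hv, huv⟩ := hlift hu
    rw [zero_add, pow_one] at huv
    have h1 := add_mem hau huv
    rw [sub_add_sub_cancel] at h1
    exact ⟨v, hv, h1⟩
  refine ⟨⟨hp, hclosed, fun x hx hxm n => ?_, fun x hx hxm => ?_⟩, htop⟩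
  · obtain ⟨u, hu, hxu⟩ := hdiv n x (Subring.mem_iInf.mp hx n) hxm
    obtain ⟨v, hv, huv⟩ := hlift hu
    refine ⟨v, hv, ?_⟩
    have h1 := add_mem hxu (Ideal.mul_mem_left _ (p : A) huv)
    rwa [mul_sub, sub_add_sub_cancel] at h1
  -- The inverse y of x in A is a limit of elements of the intersection: with c there congruent to y
  -- modulo m, it is c times the geometric series in 1 - xc.
  · obtain ⟨y, hxy⟩ := (notMem_maximalIdeal.mp hxm).exists_right_inv
    refine ⟨y, hclosed y fun n => ?_, hxy⟩
    obtain ⟨c, hc, hyc⟩ := htop y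
    have hz : 1 - x * c ∈ maximalIdeal A := by
      rw [← hxy, ← mul_sub]
      exact Ideal.mul_mem_left _ _ hyc
    have hzV : 1 - x * c ∈ ⨅ i, U i := sub_mem (one_mem _) (mul_mem hx hc)
    refine ⟨c * ∑ i ∈ Finset.range (n + 1), (1 - x * c) ^ i,
      mul_mem hc (sum_mem fun i _ => pow_mem hzV i), ?_⟩
    have h1 := mul_neg_geom_sum (1 - x * c) (n + 1)
    rw [sub_sub_cancel] at h1
    have h2 : y - c * ∑ i ∈ Finset.range (n + 1), (1 - x * c) ^ i = y * (1 - x * c) ^ (n + 1) := by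
      linear_combination (-y) * h1 + (c * ∑ i ∈ Finset.range (n + 1), (1 - x * c) ^ i) * hxy
    rw [h2]
    exact Ideal.mul_mem_left _ _ (Ideal.pow_mem_pow hz _)

end Intersection

/-! ### Coefficient rings in residue characteristic p. -/

section ResidueCharacteristicP

theorem powSubring_mul_le_comap {B C ι : Type*} [CommRing B] [CommRing C] (f : B →+* C) (q r : ℕ)
    (t : ι → B) : powSubring (q * r) t ≤ (powSubring q (f ∘ t)).comap f := by
  refine Subring.closure_le.mpr ?_
  rintro _ (⟨y, rfl⟩ | ⟨i, rfl⟩)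
  · refine Subring.mem_comap.mpr ?_
    rw [map_pow, mul_comm, pow_mul]
    exact pow_mem_powSubring q _ _
  · exact mem_powSubring q (f ∘ t) i

universe u

/-- The coefficient ring is the intersection of the preimages U n of the subrings of A/m^(n+1)
generated by p^n-th powers and fixed lifts t of a p-basis of k. Equal and mixed characteristic are
treated alike. -/
theorem exists_coefficientRing_of_charP {A : Type u} [CommRing A] [IsLocalRing A]
    [IsAdicComplete (maximalIdeal A) A] {k : Type*} [Field k] (p : ℕ) [Fact p.Prime] [CharP k p]
    (σ : A →+* k) (hσ : Function.Surjective σ) :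
    ∃ (V : Type u) (_ : CommRing V) (_ : IsLocalRing V) (_ : IsNoetherianRing V) (φ : V →+* A),
      HasRegularParameters V ∧ ∀ a, ∃ v, a - φ v ∈ maximalIdeal A := by
  have hm : RingHom.ker σ = maximalIdeal A := ker_eq_maximalIdeal σ hσ
  have hmem : ∀ a, a ∈ maximalIdeal A ↔ σ a = 0 := fun a => by rw [← hm, RingHom.mem_ker]
  obtain ⟨s, hgen, hind⟩ := exists_pBasis k p
  choose t ht using fun i : s => hσ i
  let π : (n : ℕ) → A ⧸ maximalIdeal A ^ (n + 1) →+* k := fun n =>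
    Ideal.Quotient.lift _ σ fun a ha =>
      (hmem a).mp (Ideal.pow_le_self n.succ_ne_zero ha)
  have hπmk : ∀ n a, π n (Ideal.Quotient.mk _ a) = σ a := fun n a => rfl
  have hπ : ∀ n, Function.Surjective (π n) := fun n =>
    Ideal.Quotient.lift_surjective_of_surjective _ _ hσ
  let t' : (n : ℕ) → s → A ⧸ maximalIdeal A ^ (n + 1) := fun n i => Ideal.Quotient.mk _ (t i)
  have ht' : ∀ n, π n ∘ t' n = Subtype.val := fun n => funext fun i => ht i
  have hgen' : ∀ n r, Subring.closure
      (Set.range (iterateFrobenius k p r) ∪ Set.range (π n ∘ t' n)) = ⊤ := fun n r => by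
    rw [ht', Subtype.range_coe]
    exact hgen r
  have hker : ∀ n, RingHom.ker (π n) ^ (n + 1) = ⊥ := fun n => by
    have h1 : RingHom.ker (π n) = _ := Ideal.ker_quotient_lift _ _
    rw [h1, hm, ← Ideal.map_pow, Ideal.map_quotient_self]
  let U : ℕ → Subring A := fun n =>
    (powSubring (p ^ n) (t' n)).comap (Ideal.Quotient.mk (maximalIdeal A ^ (n + 1)))
  have hpm : (p : A) ∈ maximalIdeal A := by
    rw [hmem, map_natCast]
    exact CharP.cast_eq_zero _ p
  have hanti : Antitone U := by
    refine antitone_nat_of_succ_le fun n => ?_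
    let f : A ⧸ maximalIdeal A ^ (n + 1 + 1) →+* A ⧸ maximalIdeal A ^ (n + 1) :=
      Ideal.Quotient.factor (Ideal.pow_le_pow_right (Nat.le_succ _))
    have h1 := powSubring_mul_le_comap f (p ^ n) p (t' (n + 1))
    rw [← pow_succ p] at h1
    intro x hx
    exact h1 hx
  obtain ⟨h, hV⟩ := isApproxUniformizer_iInf hpm hanti
    (fun n a ha => by
      refine Subring.mem_comap.mpr ?_
      rw [Ideal.Quotient.eq_zero_iff_mem.mpr ha]
      exact zero_mem _)
    (fun n a => by
      obtain ⟨w, hw, haw⟩ := exists_mem_powSubring_sub_mem_ker (hπ n) (hgen' n n)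
        (Ideal.Quotient.mk _ a)
      obtain ⟨w, rfl⟩ := Ideal.Quotient.mk_surjective w
      refine ⟨w, hw, ?_⟩
      rwa [← map_sub, RingHom.mem_ker, hπmk, ← hmem] at haw)
    (fun n a ha ham => by
      obtain ⟨w, hw, haw⟩ := exists_eq_mul_of_mem_powSubring_of_mem_ker (hπ n) (hgen' n) (hker n)
        (by rw [ht']; exact hind n) ha (by rw [hπmk]; exact (hmem a).mp ham)
      obtain ⟨w, rfl⟩ := Ideal.Quotient.mk_surjective w
      refine ⟨w, hw, ?_⟩
      rw [← Ideal.Quotient.eq_zero_iff_mem, map_sub, haw, map_mul, map_natCast, sub_self])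
  have := h.isLocalRing
  have := h.isPrincipalIdealRing
  refine ⟨↥(⨅ i, U i), inferInstance, inferInstance, inferInstance, (⨅ i, U i).subtype,
    h.hasRegularParameters, fun a => ?_⟩
  obtain ⟨v, hv, hav⟩ := hV a
  exact ⟨⟨v, hv⟩, hav⟩

theorem exists_coefficientRing (A : Type u) [CommRing A] [IsLocalRing A]
    [IsAdicComplete (maximalIdeal A) A] :
    ∃ (V : Type u) (_ : CommRing V) (_ : IsLocalRing V) (_ : IsNoetherianRing V) (φ : V →+* A),
      HasRegularParameters V ∧ ∀ a, ∃ v, a - φ v ∈ maximalIdeal A := by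
  obtain ⟨q, hq⟩ := CharP.exists (ResidueField A)
  rcases CharP.char_is_prime_or_zero (ResidueField A) q with h | rfl
  · have : Fact q.Prime := ⟨h⟩
    exact exists_coefficientRing_of_charP q (residue A) residue_surjective
  · have : CharZero (A ⧸ maximalIdeal A) := CharP.charP_to_charZero (ResidueField A)
    exact exists_coefficientRing_of_charZero A

end ResidueCharacteristicP

end

/-! ### The dimension formula and the conclusion. -/

section DimensionFormula

open IsLocalRing

theorem IsFormallyEquidimensional.ringKrullDim_le_height_add {R : Type*} [CommRing R]
    [IsNoetherianRing R] [IsLocalRing R] (hR : IsFormallyEquidimensional R) (p : Ideal R)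
    [p.IsPrime] : ringKrullDim R ≤ p.height + ringKrullDim (R ⧸ p) := by
  have hmax := AdicCompletion.maximalIdeal_eq_map (R := R)
  have hfg : (maximalIdeal (AdicCompletion (maximalIdeal R) R)).FG := by
    rw [hmax]
    exact Ideal.FG.map (maximalIdeal R).fg_of_isNoetherianRing _
  obtain ⟨V, _, _, _, φ, hV, hφ⟩ := exists_coefficientRing (AdicCompletion (maximalIdeal R) R)
  obtain ⟨hN, hcat⟩ := ringKrullDim_quotient_le_height_add_of_coefficientRing hV hfg φ hφ
  exact ringKrullDim_le_height_add_of_flat hmax hR hcat p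

theorem height_le_arithmeticRank {R : Type*} [CommRing R] [IsNoetherianRing R] {I : Ideal R}
    (hI : I ≠ ⊤) : (I.height : ℕ∞) ≤ arithmeticRank I := by
  refine le_iInf₂ fun u hu => ?_
  obtain ⟨g, hg⟩ := hu
  obtain ⟨p, hp⟩ := Ideal.nonempty_minimalPrimes hI
  have hpp : p.IsPrime := hp.1.1
  have hp' : p ∈ (Ideal.span (Set.range g)).minimalPrimes := by
    rwa [← Ideal.radical_minimalPrimes, hg, Ideal.radical_minimalPrimes]
  calc I.height ≤ p.height := Ideal.height_mono hp.1.2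
    _ ≤ (Set.range g).ncard :=
      Ideal.height_le_card_of_mem_minimalPrimes_span (Set.finite_range g) hp'
    _ ≤ u := by
      have := Set.ncard_image_le (f := g) (s := Set.univ) Set.finite_univ
      rw [Set.image_univ, Set.ncard_univ, Nat.card_fin] at this
      exact_mod_cast this

end DimensionFormula

theorem corollary3p12 {R : Type*} [CommRing R] [IsNoetherianRing R] [IsLocalRing R]
    (I : Ideal R) (hI : I ≠ ⊤)
    (hR : IsFormallyEquidimensional R)
    (hdepth : ringKrullDim (R ⧸ I) + 1 ≤ (localDepth R R : WithBot ℕ∞))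
    (hRees : IsNoetherianRing (symbolicReesAlgebra I))
    (hCM : ∀ᶠ n : ℕ in atTop, IsCohenMacaulayModule R (R ⧸ symbolicPower I n)) :
    IsSetTheoreticCompleteIntersection I := by
  obtain ⟨N, hN⟩ := eventually_atTop.mp hCM
  obtain ⟨k, hNk, hk, hpow⟩ := exists_symbolicPower_mul_eq_pow I N
  have hrad := radical_symbolicPower I hk
  have hJ : symbolicPower I k ≠ ⊤ := fun h => hI (by
    rwa [h, Ideal.radical_top, eq_comm, Ideal.radical_eq_top] at hrad)
  obtain ⟨r, hr⟩ := exists_ringKrullDim_quotient_eq hI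
  obtain ⟨d, hd⟩ := exists_ringKrullDim_quotient_eq (bot_ne_top (α := Ideal R))
  rw [ringKrullDim_eq_of_ringEquiv (RingEquiv.quotientBot R)] at hd
  have hrd : r ≤ d := by
    have := ringKrullDim_quotient_le I
    rw [hr, hd] at this
    exact_mod_cast this
  obtain ⟨e, rfl⟩ := Nat.exists_eq_add_of_le hrd
  -- The powers of J = I^(k) with n ≥ 1 are the symbolic powers I^(kn) with kn ≥ k ≥ N, so their
  -- quotients are Cohen–Macaulay.
  obtain ⟨gs, hlen, hgs⟩ := exists_radical_ofList_eq_of_isCohenMacaulayModule hJ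
    (fun n hn => by
      rw [← hpow]
      exact hN _ (hNk.trans (Nat.le_mul_of_pos_right k hn))) hd.le
    ((ringKrullDim_quotient_eq_of_radical_eq hrad).trans hr)
  have hara : arithmeticRank I ≤ e := by
    refine iInf₂_le e ⟨fun i => gs.get (i.cast hlen.symm), ?_⟩
    rw [← hrad, ← hgs]
    congr 2
    ext x
    rw [Set.mem_range, Set.mem_ofPred_eq, List.mem_iff_get]
    exact ((finCongr hlen).exists_congr_left (p := fun i => gs.get i = x)).symm
  refine le_antisymm (hara.trans ?_) (height_le_arithmeticRank hI)
  -- For each minimal prime p of I, r + e = dim R ≤ ht p + dim R/p ≤ ht p + r, hence e ≤ ht p.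
  rw [Ideal.height_eq_inf_minimalPrimes]
  refine le_iInf₂ fun p hp => ?_
  have hpp : p.IsPrime := hp.1.1
  have h1 := hR.ringKrullDim_le_height_add p
  have h2 := h1.trans (add_le_add_right (ringKrullDim_quotient_mono hp.1.2) _)
  rw [hd, hr] at h2
  rcases eq_or_ne p.height ⊤ with h | h
  · simp [h]
  · obtain ⟨n, hn⟩ := ENat.ne_top_iff_exists.mp h
    rw [← hn] at h2 ⊢
    have h3 : r + e ≤ n + r := by exact_mod_cast h2
    exact_mod_cast (by omega : e ≤ n)
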